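/- **Setting.** Let $\mathcal K:\mathbb R\to\mathbb R$ be a compactly supported, symmetric, Lipschitz function with $\int\mathcal K=1$, and put $K(u,v)=\mathcal K(u)\mathcal K(v)$. Let $M>0$ and $$0<\varepsilon\le\exp\{-\max[1,(2M\|\mathcal K\|_1\|\mathcal K\|_\infty^{-1})^2]\}.$$ Let $f:\mathbb R\to\mathbb R$ be measurable with $\sup|f|\le M$, let $\theta^*\in\mathbb S^1$, and let $F(x)=f(x^{T}\theta^*)$, $x\in\mathbb R^2$. One observes $Y_\varepsilon(dt)=F(t)\,dt+\varepsilon W(dt)$, $t\in\mathcal D$, where $W$ is a Brownian sheet (Gaussian white noise) and $\mathcal D\subset\mathbb R^2$ is a measurable set of finite area (for instance $[-1,1]^2$) which contains $\{t:K(E(t-x))\ne0\}$ for all $x\in[-1/2,1/2]^2$ and all the matrices $E$ introduced below with $h\in(0,1]$ (for $\mathcal D=[-1,1]^2$ this is so if $\mathcal K$ vanishes outside $[-\sqrt2/8,\sqrt2/8]$). **Oracle bandwidth.** For $h\in(0,1]$ and $y,z\in\mathbb R$ let $$\Delta(h,z)=\sup_{0<\delta\le h}\Big|\delta^{-1}\!\int\mathcal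 K\big(\tfrac{u-z}{\delta}\big)(f(u)-f(z))\,du\Big|,\qquad \Delta^*(h,y)=\max\Big\{\sup_{a>0}\frac1{2a}\int_{y-a}^{y+a}\Delta(h,z)\,dz,\ \Delta(h,y)\Big\},$$ $$h^*_{\mathcal K,f}(y)=\sup\{h\in[\varepsilon^2,1]:\sqrt h\,\Delta^*(h,y)\le\|\mathcal K\|_\infty\,\varepsilon\sqrt{\ln(1/\varepsilon)}\}.$$ **Estimators.** For $\theta,\nu\in\mathbb S^1$ and $h\in(0,1]$ let $$E_{(\theta,h)}=\begin{pmatrix}h^{-1}\theta_1&h^{-1}\theta_2\\-\theta_2&\theta_1\end{pmatrix},\qquad \overline E_{(\theta,h)(\nu,h)}=\frac1{2(1+|\nu^T\theta|)}\begin{pmatrix}h^{-1}(\theta_1+\nu_1)&h^{-1}(\theta_2+\nu_2)\\-(\theta_2+\nu_2)&\theta_1+\nu_1\end{pmatrix},$$ and let $E_{(\theta,h)(\nu,h)}$ be $\overline E_{(\theta,h)(\nu,h)}$ if $\nu^T\theta\ge0$ and $\overline E_{(-\theta,h)(\nu,h)}$ if $\nu^T\theta<0$. Let $\hat F_{(\theta,h)}(x)=\det(E)\int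 K(E(t-x))\,Y_\varepsilon(dt)$ with $E=E_{(\theta,h)}$, and let $\hat F_{(\theta,h)(\nu,h)}(x)$ be the same with $E=E_{(\theta,h)(\nu,h)}$; here the stochastic integrals $\int K(E(t-x))\,Y_\varepsilon(dt)$ are taken in their version with paths continuous in $(E,x)$, $\det E\ne0$. **Selection rule.** For a constant $C>0$ let $\mathrm{TH}(\eta)=C\varepsilon\sqrt{\eta^{-1}\ln(1/\varepsilon)}$, let $\mathcal H_\varepsilon=\{2^{-k}:k=0,1,\dots\}\cap[\varepsilon^2,1]$, and $$R_{(\theta,h)}(x)=\sup_{\eta\in\mathcal H_\varepsilon,\ \eta\le h}\Big\{\sup_{\nu\in\mathbb S^1}\big|\hat F_{(\theta,\eta)(\nu,\eta)}(x)-\hat F_{(\nu,\eta)}(x)\big|-\mathrm{TH}(\eta)\Big\},\qquad \mathcal P(x)=\{(\theta,h)\in\mathbb S^1\times\mathcal H_\varepsilon:R_{(\theta,h)}(x)\le0\}.$$ If $\mathcal P(x)\neq\emptyset$, let $\tilde h=\max\{h:(\theta,h)\in\mathcal P(x)\}$ and let $\hat\theta=\hat\theta(x)$ be any measurable choice with $(\hat\theta,\tilde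 h)\in\mathcal P(x)$; otherwise $\hat\theta=(1,0)^T$. Let $$\hat h=\sup\{h\in\mathcal H_\varepsilon:|\hat F_{(\hat\theta,h)}(x)-\hat F_{(\hat\theta,\eta)}(x)|\le\mathrm{TH}(\eta)\ \ \forall\eta\in\mathcal H_\varepsilon,\ \eta\le h\},\qquad \hat F(x)=\hat F_{(\hat\theta,\hat h)}(x).$$ **Theorem.** Let $r>0$. There is $C_0>0$, depending only on $r$ and $\mathcal K$, such that for every threshold constant $C=C(r,\mathcal K)\ge C_0$ there are a constant $C_{r,1}(\mathcal K)>0$, depending only on $r$, $\mathcal K$ and $C$, and for every $M>0$ a constant $C_{r,2}(M,\mathcal K)>0$, depending only on $r$, $\mathcal K$, $C$ and $M$, such that for all $\varepsilon$, $\mathcal D$, $f$, $\theta^*$ as above the following hold. 1. (Local oracle inequality.) For every $x\in[-1/2,1/2]^2$, $$\big(\mathbb E|\hat F(x)-F(x)|^r\big)^{1/r}\le C_{r,1}(\mathcal K)\sqrt{\frac{\|\mathcal K\|_\infty^4\,\varepsilon^2\ln(1/\varepsilon)}{h^*_{\mathcal K,f}(x^T\theta^*)}}+C_{r,2}(M,\mathcal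 K)\,\|\mathcal K\|_\infty^2\,\varepsilon\sqrt{\ln(1/\varepsilon)}.$$ 2. (Global oracle inequality.) With $\|g\|_r=\big(\int_{[-1/2,1/2]^2}|g(x)|^r\,dx\big)^{1/r}$ and $\hat\theta$ chosen measurably jointly in $x$ and the randomness, $$\mathbb E\|\hat F-F\|_r\le C_{r,1}(\mathcal K)\left\|\sqrt{\frac{\|\mathcal K\|_\infty^4\,\varepsilon^2\ln(1/\varepsilon)}{h^*_{\mathcal K,f}(\,\cdot^{\,T}\theta^*)}}\right\|_r+C_{r,2}(M,\mathcal K)\,\|\mathcal K\|_\infty^2\,\varepsilon\sqrt{\ln(1/\varepsilon)}.$$ -/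

import Mathlib

universe u

open MeasureTheory ProbabilityTheory Set
open scoped Matrix ENNReal

noncomputable section

namespace SingleIndex

/-- The plane `ℝ²`, with Lebesgue measure `volume`; `x ⬝ᵥ y` is the Euclidean scalar product. -/
abbrev Plane : Type := Fin 2 → ℝ

/-- The (Euclidean) unit circle `S¹` in the plane. -/
def unitCircle : Set Plane := {θ | θ 0 ^ 2 + θ 1 ^ 2 = 1}

/-- The square `[-1/2, 1/2]²` on which the function is estimated. -/
def square : Set Plane := Icc (fun _ => -(1 / 2)) (fun _ => 1 / 2)

/-! ### Kernels -/

/-- Compactly supported, symmetric, Lipschitz functions with integral one. -/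
structure IsKernel (k : ℝ → ℝ) : Prop where
  hasCompactSupport : HasCompactSupport k
  symmetric : ∀ u, k (-u) = k u
  lipschitz : ∃ L : NNReal, LipschitzWith L k
  integral_eq_one : ∫ u, k u = 1

/-- The sup-norm of `k`. -/
def supNorm (k : ℝ → ℝ) : ℝ := ⨆ u, |k u|

/-- The `L₁`-norm of `k`. -/
def l1Norm (k : ℝ → ℝ) : ℝ := ∫ u, |k u|

/-- The function `t ↦ K (A (t - x))`, where `K (u, v) = k u * k v`. -/
def kernelAt (k : ℝ → ℝ) (A : Matrix (Fin 2) (Fin 2) ℝ) (x t : Plane) : ℝ :=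
  k ((A *ᵥ (t - x)) 0) * k ((A *ᵥ (t - x)) 1)

/-! ### The oracle bandwidth -/

/-- The monotone approximation error
`Δ(h, z) = sup_{0 < δ ≤ h} |δ⁻¹ ∫ k ((u - z) / δ) (f u - f z) du|`.
(For `f` measurable and bounded all suprema and integrals in this section are finite.) -/
def approxError (k f : ℝ → ℝ) (h z : ℝ) : ℝ :=
  ⨆ δ : Ioc (0 : ℝ) h, |(δ : ℝ)⁻¹ * ∫ u, k ((u - z) / δ) * (f u - f z)|

/-- The maximal function `sup_{a > 0} (2a)⁻¹ ∫_{y-a}^{y+a} Δ(h, z) dz`. -/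
def maximalApproxError (k f : ℝ → ℝ) (h y : ℝ) : ℝ :=
  ⨆ a : Ioi (0 : ℝ), (2 * (a : ℝ))⁻¹ * ∫ z in (y - a)..(y + a), approxError k f h z

/-- `Δ*(h, y)`, the maximum of the two previous quantities. -/
def starApproxError (k f : ℝ → ℝ) (h y : ℝ) : ℝ :=
  max (maximalApproxError k f h y) (approxError k f h y)

/-- The oracle bandwidth `h*(y)`. -/
def oracleBandwidth (k f : ℝ → ℝ) (ε y : ℝ) : ℝ :=
  sSup {h | h ∈ Icc (ε ^ 2) 1 ∧
    √h * starApproxError k f h y ≤ supNorm k * ε * √(Real.log (1 / ε))}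

/-! ### The matrices indexing the kernel estimators -/

/-- The matrix `E_{(θ, h)}`. -/
def indexMatrix (θ : Plane) (h : ℝ) : Matrix (Fin 2) (Fin 2) ℝ :=
  !![h⁻¹ * θ 0, h⁻¹ * θ 1;
     -θ 1, θ 0]

/-- The matrix `Ē_{(θ, h)(ν, h)}`. -/
def pairMatrixAux (θ ν : Plane) (h : ℝ) : Matrix (Fin 2) (Fin 2) ℝ :=
  !![(θ 0 + ν 0) / (2 * h * (1 + |ν ⬝ᵥ θ|)), (θ 1 + ν 1) / (2 * h * (1 + |ν ⬝ᵥ θ|));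
     -((θ 1 + ν 1) / (2 * (1 + |ν ⬝ᵥ θ|))), (θ 0 + ν 0) / (2 * (1 + |ν ⬝ᵥ θ|))]

open Classical in
/-- The matrix `E_{(θ, h)(ν, h)}`. -/
def pairMatrix (θ ν : Plane) (h : ℝ) : Matrix (Fin 2) (Fin 2) ℝ :=
  if 0 ≤ ν ⬝ᵥ θ then pairMatrixAux θ ν h else pairMatrixAux (-θ) ν h

/-- The observation domain `D` contains every window of the kernel estimators at the points of
`[-1/2, 1/2]²`: there are no boundary effects on the square. -/
def WindowsInside (k : ℝ → ℝ) (D : Set Plane) : Prop :=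
  ∀ x ∈ square, ∀ θ ∈ unitCircle, ∀ h ∈ Ioc (0 : ℝ) 1,
    (∀ t, kernelAt k (indexMatrix θ h) x t ≠ 0 → t ∈ D) ∧
    ∀ ν ∈ unitCircle, ∀ t, kernelAt k (pairMatrix θ ν h) x t ≠ 0 → t ∈ D

/-! ### The Gaussian white noise model -/

variable {Ω : Type*} [MeasurableSpace Ω]

/-- `W φ = ∫ φ dW` is the integral of `φ ∈ L²(D)` with respect to a Brownian sheet on `D`: a
centred Gaussian process indexed by `L²(D)` with covariance the scalar product of `L²(D)`.
(The values of `W` outside of `L²(D)` are irrelevant.) -/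
structure IsWhiteNoise (D : Set Plane) (P : Measure Ω) (W : (Plane → ℝ) → Ω → ℝ) : Prop where
  gaussian : IsGaussianProcess
    (fun φ : {φ : Plane → ℝ // MemLp φ 2 (volume.restrict D)} => W φ) P
  mean : ∀ φ, MemLp φ 2 (volume.restrict D) → ∫ ω, W φ ω ∂P = 0
  covariance : ∀ φ ψ, MemLp φ 2 (volume.restrict D) → MemLp ψ 2 (volume.restrict D) →
    ∫ ω, W φ ω * W ψ ω ∂P = ∫ t in D, φ t * ψ t

/-- `Y φ = ∫ φ(t) Y(dt)` for the observation `Y(dt) = F(t) dt + ε W(dt)`, `t ∈ D`. -/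
def IsObservation (D : Set Plane) (F : Plane → ℝ) (ε : ℝ) (P : Measure Ω)
    (Y : (Plane → ℝ) → Ω → ℝ) : Prop :=
  ∃ W : (Plane → ℝ) → Ω → ℝ, IsWhiteNoise D P W ∧
    ∀ φ ω, Y φ ω = (∫ t in D, φ t * F t) + ε * W φ ω

/-- `J ω A x` is the version of `∫ K (A (t - x)) Y(dt)` with paths which are continuous in the
invertible matrix `A` and the point `x`. -/
structure IsKernelIntegral (k : ℝ → ℝ) (P : Measure Ω) (Y : (Plane → ℝ) → Ω → ℝ)
    (J : Ω → Matrix (Fin 2) (Fin 2) ℝ → Plane → ℝ) : Prop where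
  measurable : ∀ A x, Measurable fun ω => J ω A x
  continuousOn : ∀ ω, ContinuousOn
    (fun p : Matrix (Fin 2) (Fin 2) ℝ × Plane => J ω p.1 p.2) {p | p.1.det ≠ 0}
  version : ∀ A x, A.det ≠ 0 → (fun ω => J ω A x) =ᵐ[P] Y (kernelAt k A x)

/-! ### The selection rule

In this section `j A x` is one realization of `∫ K (A (t - x)) Y(dt)`. -/

/-- The kernel estimator `det A ∫ K (A (t - x)) Y(dt)`. -/
def estimator (j : Matrix (Fin 2) (Fin 2) ℝ → Plane → ℝ) (A : Matrix (Fin 2) (Fin 2) ℝ)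
    (x : Plane) : ℝ :=
  A.det * j A x

/-- The threshold `TH(η) = C ε √(η⁻¹ ln(1/ε))`. -/
def threshold (C ε η : ℝ) : ℝ := C * ε * √(η⁻¹ * Real.log (1 / ε))

/-- The dyadic grid `{2⁻ᵏ : k = 0, 1, …} ∩ [ε², 1]`. -/
def grid (ε : ℝ) : Set ℝ := {h | (∃ n : ℕ, h = 2⁻¹ ^ n) ∧ h ∈ Icc (ε ^ 2) 1}

/-- The statistic `R_{(θ, h)}(x)`. -/
def rStat (C ε : ℝ) (j : Matrix (Fin 2) (Fin 2) ℝ → Plane → ℝ) (x θ : Plane) (h : ℝ) : ℝ :=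
  ⨆ η : {η // η ∈ grid ε ∧ η ≤ h},
    ((⨆ ν : unitCircle,
      |estimator j (pairMatrix θ ν η) x - estimator j (indexMatrix ν η) x|) - threshold C ε η)

/-- The set `𝒫(x)` of the accepted pairs `(θ, h)`. -/
def accepted (C ε : ℝ) (j : Matrix (Fin 2) (Fin 2) ℝ → Plane → ℝ) (x : Plane) :
    Set (Plane × ℝ) :=
  {p | p.1 ∈ unitCircle ∧ p.2 ∈ grid ε ∧ rStat C ε j x p.1 p.2 ≤ 0}

/-- The largest accepted bandwidth (a maximum over a finite set, if there is one). -/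
def hTilde (C ε : ℝ) (j : Matrix (Fin 2) (Fin 2) ℝ → Plane → ℝ) (x : Plane) : ℝ :=
  sSup (Prod.snd '' accepted C ε j x)

/-- `θ` is an admissible choice of the selected index at the point `x`. -/
def IsSelectedIndex (C ε : ℝ) (j : Matrix (Fin 2) (Fin 2) ℝ → Plane → ℝ) (x θ : Plane) : Prop :=
  ((accepted C ε j x).Nonempty → (θ, hTilde C ε j x) ∈ accepted C ε j x) ∧
  (¬ (accepted C ε j x).Nonempty → θ = ![1, 0])

/-- The selected bandwidth `ĥ` at the point `x`, given the selected index `θ`. -/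
def hHat (C ε : ℝ) (j : Matrix (Fin 2) (Fin 2) ℝ → Plane → ℝ) (x θ : Plane) : ℝ :=
  sSup {h | h ∈ grid ε ∧ ∀ η ∈ grid ε, η ≤ h →
    |estimator j (indexMatrix θ h) x - estimator j (indexMatrix θ η) x| ≤ threshold C ε η}

/-- The final estimator `F̂_{(θ̂, ĥ)}(x)`, given the selected index `θ`. -/
def finalEstimator (C ε : ℝ) (j : Matrix (Fin 2) (Fin 2) ℝ → Plane → ℝ) (x θ : Plane) : ℝ :=
  estimator j (indexMatrix θ (hHat C ε j x θ)) x

/-! ### Risks and the oracle rate -/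

/-- The pointwise risk `(E |F̂(x) - F(x)|^r)^{1/r}`; `Z` is the random value `F̂(x)` and `a` is
the estimated value `F(x)`. -/
def pointwiseRisk (P : Measure Ω) (r : ℝ) (Z : Ω → ℝ) (a : ℝ) : ℝ≥0∞ :=
  (∫⁻ ω, ENNReal.ofReal (|Z ω - a| ^ r) ∂P) ^ (1 / r)

/-- The `L_r` norm `(∫ |g(x)|^r dx)^{1/r}` on the square `[-1/2, 1/2]²`. -/
def lrNorm (r : ℝ) (g : Plane → ℝ) : ℝ≥0∞ :=
  (∫⁻ x in square, ENNReal.ofReal (|g x| ^ r)) ^ (1 / r)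

/-- The global risk `E ‖F̂ - F‖_r`. -/
def globalRisk (P : Measure Ω) (r : ℝ) (Fhat : Ω → Plane → ℝ) (F : Plane → ℝ) : ℝ≥0∞ :=
  ∫⁻ ω, lrNorm r (fun x => Fhat ω x - F x) ∂P

/-- The oracle rate `√(‖k‖_∞⁴ ε² ln(1/ε) / h*(xᵀθ))`. -/
def oracleRate (k f : ℝ → ℝ) (ε : ℝ) (θ x : Plane) : ℝ :=
  √(supNorm k ^ 4 * ε ^ 2 * Real.log (1 / ε) / oracleBandwidth k f ε (x ⬝ᵥ θ))

end SingleIndex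

end

/-!
The proof separates a deterministic analysis of the selection rule from a bound for the noise.

**Means.** All matrices of the selection rule have the form `indexMatrix σ η` with a vector `σ`
which need not be normalized (`pairMatrixAux_eq`). A change of variables writes the mean of the
estimator at `x` as a double average of `f (y + α a + β b)` with respect to `k a` and `k b`, where
`y = xᵀθ*`. For `σ` belonging to the pairs `(ν, η)` and `(θ*, η)(ν, η)` the coefficient `β` is the
same, and `|α| ≤ 2η`. The average in `a` changes `f` by at most `Δ(2η, ·)`, and the average of
this error in `b` is a mean over an interval around `y`, hence at most a multiple of `Δ*(2η, y)`.
So the means of all these estimators are, up to `Δ*(2η, y)`, equal to one number `centre k f θ* x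
ν`, which does not depend on `η`, and which is `f y` for `ν = θ*` (`abs_mean_index_sub_centre_le`,
`abs_mean_pair_sub_centre_le`).

**Selection.** Let `h₀` be a bandwidth in the grid comparable to the oracle bandwidth
(`exists_oracle_grid`). If all normalized errors are at most a multiple of `√(ln(1/ε))`, then for
`η ≤ h₀` every estimator belonging to `ν` is within half of the threshold of `centre k f θ* x ν`.
Consequently `(θ*, h₀)` is accepted, `ĥ ≥ h₀` whatever the selected direction is, and the symmetry
`F̂_{(θ,η)(ν,η)} = F̂_{(ν,η)(θ,η)}` connects the selected direction with `θ*` through accepted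
differences (`abs_finalEstimator_sub_le`).

**Noise.** In this argument the index `θ*` is fixed in the pairs, so only suprema of the Gaussian
errors over one-parameter families of matrices are needed. A Lipschitz kernel makes these families
Lipschitz in mean square, and for a one-parameter process the maximum is controlled without
chaining: by Jensen's inequality the square of the sum of the increments over a grid of mesh `1 /
n` is at most the average of the squares of `n` times the increments. This bounds `E exp (a sup
Z²)` uniformly in the grid, and by Fatou's lemma and continuity the supremum over all matrices
(`lintegral_noiseEnvelope_le`). The bound is polynomial in `1/ε`, so on the event where the errors
exceed a large multiple of `√(ln(1/ε))` the moments of the loss are smaller than any prescribed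
power of `ε`; the condition on `ε` in terms of `M` enters to compare `M` with `√(ln(1/ε))`
(`abs_le_oracleRate_or_rpow_le`). For the global risk with `r < 1`, where `1 / r > 1`, moments of
order `max r 1` of the remainder are used.
-/

/-! ### Exponential moments of the maximum of a continuous path -/

namespace SingleIndex

/-- A functional of the values of a path `g` at the dyadic points of `[0, 1]` which dominates
`exp (a (g t)²)` for all `t ∈ [0, 1]` if `g` is continuous. The difference quotients of `g` enter only
through averages, so it has a finite mean for Lipschitz Gaussian processes. -/
noncomputable def pathBound (a : ℝ) (g : ℝ → ℝ) : ℝ≥0∞ :=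
  Filter.liminf (fun n : ℕ => ENNReal.ofReal (Real.exp (4 * a * g 0 ^ 2)) +
    ∑ l ∈ Finset.range (2 ^ n), ENNReal.ofReal ((2 ^ n : ℝ)⁻¹ * Real.exp
      (4 * a * (2 ^ n * (g ((l + 1 : ℕ) / 2 ^ n) - g (l / 2 ^ n))) ^ 2))) Filter.atTop

/-- Jensen's inequality, applied to the square and to the exponential function, replaces the variation
of `g` over the grid by an average over the difference quotients. -/
lemma exp_sq_le_dyadic {a : ℝ} (ha : 0 ≤ a) (g : ℝ → ℝ) (N m : ℕ) (hm : m ≤ N) (hN : 0 < N) :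
    Real.exp (a * g (m / N) ^ 2) ≤ Real.exp (4 * a * g 0 ^ 2) +
      ∑ l ∈ Finset.range N, (N : ℝ)⁻¹ * Real.exp
        (4 * a * (N * (g ((l + 1 : ℕ) / N) - g (l / N))) ^ 2) := by
  have hN' : (0 : ℝ) < N := by exact_mod_cast hN
  set d : ℕ → ℝ := fun l => N * (g ((l + 1 : ℕ) / N) - g (l / N)) with hd
  set A : ℝ := ∑ l ∈ Finset.range N, (N : ℝ)⁻¹ * |d l| with hA
  have hw : ∑ l ∈ Finset.range N, (N : ℝ)⁻¹ = 1 := by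
    simp [hN'.ne']
  have h1 : |g (m / N) - g 0| ≤ A := by
    have : g (m / N) - g 0 = ∑ l ∈ Finset.range m, (N : ℝ)⁻¹ * d l := by
      have := Finset.sum_range_sub (fun l : ℕ => g (l / N)) m
      simp only [Nat.cast_zero, zero_div] at this
      rw [← this]
      refine Finset.sum_congr rfl fun l _ => ?_
      simp only [hd]; field_simp
    rw [this]
    refine (Finset.abs_sum_le_sum_abs _ _).trans ?_
    have : ∀ l, |(N : ℝ)⁻¹ * d l| = (N : ℝ)⁻¹ * |d l| := fun l => by
      rw [abs_mul, abs_of_pos (inv_pos.2 hN')]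
    simp only [this]
    exact Finset.sum_le_sum_of_subset_of_nonneg (Finset.range_mono hm)
      fun _ _ _ => by positivity
  have hA0 : 0 ≤ A := (abs_nonneg _).trans h1
  have h2 : g (m / N) ^ 2 ≤ 2 * g 0 ^ 2 + 2 * A ^ 2 := by
    have : (g (m / N) - g 0) ^ 2 ≤ A ^ 2 := sq_le_sq' (abs_le.1 h1).1 (abs_le.1 h1).2
    nlinarith [sq_nonneg (g (m / N) - 2 * g 0)]
  have h3 : A ^ 2 ≤ ∑ l ∈ Finset.range N, (N : ℝ)⁻¹ * d l ^ 2 := by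
    have := (convexOn_pow (𝕜 := ℝ) 2).map_sum_le (t := Finset.range N) (w := fun _ => (N : ℝ)⁻¹)
      (p := fun l => |d l|) (fun _ _ => by positivity) hw (fun l _ => abs_nonneg (d l))
    simpa [hA] using this
  have h4 : Real.exp (4 * a * A ^ 2) ≤
      ∑ l ∈ Finset.range N, (N : ℝ)⁻¹ * Real.exp (4 * a * d l ^ 2) := by
    have := convexOn_exp.map_sum_le (t := Finset.range N) (w := fun _ => (N : ℝ)⁻¹)
      (p := fun l => 4 * a * d l ^ 2) (fun _ _ => by positivity) hw (fun l _ => mem_univ _)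
    simp only [smul_eq_mul] at this
    refine le_trans (Real.exp_le_exp.2 ?_) this
    calc 4 * a * A ^ 2 ≤ 4 * a * ∑ l ∈ Finset.range N, (N : ℝ)⁻¹ * d l ^ 2 := by gcongr
      _ = _ := by rw [Finset.mul_sum]; exact Finset.sum_congr rfl fun _ _ => by ring
  calc Real.exp (a * g (m / N) ^ 2) ≤ Real.exp (2 * a * g 0 ^ 2 + 2 * a * A ^ 2) := by
        gcongr; nlinarith
    _ = Real.exp (2 * a * g 0 ^ 2) * Real.exp (2 * a * A ^ 2) := Real.exp_add _ _
    _ ≤ Real.exp (2 * a * g 0 ^ 2) ^ 2 + Real.exp (2 * a * A ^ 2) ^ 2 := by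
        nlinarith [sq_nonneg (Real.exp (2 * a * g 0 ^ 2) - Real.exp (2 * a * A ^ 2)),
          sq_nonneg (Real.exp (2 * a * g 0 ^ 2)), sq_nonneg (Real.exp (2 * a * A ^ 2))]
    _ = Real.exp (4 * a * g 0 ^ 2) + Real.exp (4 * a * A ^ 2) := by
        rw [← Real.exp_nat_mul, ← Real.exp_nat_mul]; congr 2 <;> push_cast <;> ring
    _ ≤ _ := by gcongr

lemma exp_sq_le_pathBound {a : ℝ} (ha : 0 ≤ a) {g : ℝ → ℝ} (hg : ContinuousOn g (Icc 0 1))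
    {t : ℝ} (ht : t ∈ Icc (0 : ℝ) 1) :
    ENNReal.ofReal (Real.exp (a * g t ^ 2)) ≤ pathBound a g := by
  -- dyadic approximation of `t` from the left
  set u : ℕ → ℝ := fun n => (⌊t * 2 ^ n⌋₊ : ℝ) / 2 ^ n with hu
  have hu1 : ∀ n, u n ∈ Icc (0 : ℝ) 1 := fun n => by
    refine ⟨by positivity, ?_⟩
    rw [hu, div_le_one (by positivity)]
    refine (Nat.floor_le (by have := ht.1; positivity)).trans ?_
    have := ht.2
    have h2 : (0 : ℝ) < 2 ^ n := by positivity
    nlinarith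
  have hut : Filter.Tendsto u Filter.atTop (nhds t) := by
    have h := (tendsto_nat_floor_mul_div_atTop (R := ℝ) ht.1).comp
      (tendsto_pow_atTop_atTop_of_one_lt (r := (2 : ℝ)) one_lt_two)
    exact h
  have hlim : Filter.Tendsto (fun n => ENNReal.ofReal (Real.exp (a * g (u n) ^ 2))) Filter.atTop
      (nhds (ENNReal.ofReal (Real.exp (a * g t ^ 2)))) := by
    have h1 : Filter.Tendsto (fun n => g (u n)) Filter.atTop (nhds (g t)) :=
      (hg t ht).tendsto.comp (tendsto_nhdsWithin_iff.2 ⟨hut, Filter.Eventually.of_forall hu1⟩)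
    exact ENNReal.tendsto_ofReal ((Real.continuous_exp.tendsto _).comp ((h1.pow 2).const_mul a))
  rw [← hlim.liminf_eq]
  refine Filter.liminf_le_liminf (Filter.Eventually.of_forall fun n => ?_)
  have hm : ⌊t * 2 ^ n⌋₊ ≤ 2 ^ n := by
    have := (hu1 n).2
    rw [hu, div_le_one (by positivity)] at this
    exact_mod_cast this
  have := exp_sq_le_dyadic ha g (2 ^ n) ⌊t * 2 ^ n⌋₊ hm (by positivity)
  push_cast at this
  refine (ENNReal.ofReal_le_ofReal this).trans ?_
  rw [ENNReal.ofReal_add (by positivity) (Finset.sum_nonneg fun _ _ => by positivity),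
    ENNReal.ofReal_sum_of_nonneg fun _ _ => by positivity]
  push_cast
  exact le_rfl

lemma measurable_pathBound {α : Type*} [MeasurableSpace α] (a : ℝ) {X : α → ℝ → ℝ}
    (hX : ∀ t ∈ Icc (0 : ℝ) 1, Measurable fun ω => X ω t) :
    Measurable fun ω => pathBound a (X ω) := by
  refine Measurable.liminf fun n => ?_
  have h0 := hX 0 (by simp)
  have hexp : Measurable fun ω => ENNReal.ofReal (Real.exp (4 * a * X ω 0 ^ 2)) := by fun_prop
  refine hexp.add (Finset.measurable_sum _ fun l hl => ?_)
  have hl' : l + 1 ≤ 2 ^ n := Finset.mem_range.1 hl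
  have h2 : (0 : ℝ) < 2 ^ n := by positivity
  have h1 : Measurable fun ω => X ω ((l + 1 : ℕ) / 2 ^ n) := hX _
    ⟨by positivity, by rw [div_le_one h2]; exact_mod_cast hl'⟩
  have h3 : Measurable fun ω => X ω (l / 2 ^ n) := hX _
    ⟨by positivity, by rw [div_le_one h2]; exact_mod_cast (Nat.le_succ l).trans hl'⟩
  fun_prop

lemma lintegral_pathBound_le {α : Type*} [MeasurableSpace α] (P : Measure α) {a : ℝ}
    {X : α → ℝ → ℝ} (hX : ∀ t ∈ Icc (0 : ℝ) 1, Measurable fun ω => X ω t)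
    (h0 : ∫⁻ ω, ENNReal.ofReal (Real.exp (4 * a * X ω 0 ^ 2)) ∂P ≤ 2)
    (hinc : ∀ s ∈ Icc (0 : ℝ) 1, ∀ t ∈ Icc (0 : ℝ) 1, s < t →
      ∫⁻ ω, ENNReal.ofReal (Real.exp (4 * a * ((t - s)⁻¹ * (X ω t - X ω s)) ^ 2)) ∂P ≤ 2) :
    ∫⁻ ω, pathBound a (X ω) ∂P ≤ 4 := by
  have hm0 := hX 0 (by simp)
  have hmem : ∀ n l : ℕ, l < 2 ^ n → ((l : ℝ) / 2 ^ n) ∈ Icc (0 : ℝ) 1 ∧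
      (((l + 1 : ℕ) : ℝ) / 2 ^ n) ∈ Icc (0 : ℝ) 1 := fun n l hl => by
    have h2 : (0 : ℝ) < 2 ^ n := by positivity
    refine ⟨⟨by positivity, ?_⟩, ⟨by positivity, ?_⟩⟩
    · rw [div_le_one h2]; exact_mod_cast hl.le
    · rw [div_le_one h2]; exact_mod_cast hl
  have hm : ∀ n l : ℕ, l < 2 ^ n → Measurable fun ω => ENNReal.ofReal ((2 ^ n : ℝ)⁻¹ * Real.exp
      (4 * a * (2 ^ n * (X ω ((l + 1 : ℕ) / 2 ^ n) - X ω (l / 2 ^ n))) ^ 2)) := fun n l hl => by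
    have h1 := hX _ (hmem n l hl).1
    have h3 := hX _ (hmem n l hl).2
    fun_prop
  refine (lintegral_liminf_le fun n => ?_).trans ?_
  · exact Measurable.add (by fun_prop) (Finset.measurable_sum _ fun l hl =>
      hm n l (Finset.mem_range.1 hl))
  refine Filter.liminf_le_of_frequently_le' (Filter.Eventually.of_forall fun n => ?_).frequently
  rw [lintegral_add_left (by fun_prop), lintegral_finsetSum' _ fun l hl =>
      (hm n l (Finset.mem_range.1 hl)).aemeasurable]
  have h4 : (4 : ℝ≥0∞) = 2 + 2 := by norm_num
  rw [h4]
  refine add_le_add h0 ?_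
  have key : ∀ l ∈ Finset.range (2 ^ n), ∫⁻ ω, ENNReal.ofReal ((2 ^ n : ℝ)⁻¹ * Real.exp
      (4 * a * (2 ^ n * (X ω ((l + 1 : ℕ) / 2 ^ n) - X ω (l / 2 ^ n))) ^ 2)) ∂P
      ≤ ENNReal.ofReal ((2 ^ n : ℝ)⁻¹) * 2 := fun l hl => by
    obtain ⟨hs, ht⟩ := hmem n l (Finset.mem_range.1 hl)
    have h2 : (0 : ℝ) < 2 ^ n := by positivity
    have hd : (((l + 1 : ℕ) : ℝ) / 2 ^ n - l / 2 ^ n)⁻¹ = 2 ^ n := by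
      push_cast; field_simp; ring
    have := hinc _ hs _ ht (by gcongr; exact_mod_cast Nat.lt_succ_self l)
    rw [hd] at this
    simp_rw [ENNReal.ofReal_mul (inv_nonneg.2 h2.le)]
    rw [lintegral_const_mul' _ _ ENNReal.ofReal_ne_top]
    gcongr
  refine (Finset.sum_le_sum key).trans ?_
  rw [Finset.sum_const, Finset.card_range, nsmul_eq_mul, ← mul_assoc]
  have : ((2 ^ n : ℕ) : ℝ≥0∞) * ENNReal.ofReal ((2 ^ n : ℝ)⁻¹) = 1 := by
    rw [← ENNReal.ofReal_natCast, ← ENNReal.ofReal_mul (by positivity)]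
    push_cast
    rw [mul_inv_cancel₀ (by positivity), ENNReal.ofReal_one]
  rw [this, one_mul]

/-- Half of the range `b v < 1 / 2` in which the exponential moment is finite. -/
lemma lintegral_exp_sq_gaussianReal_le {v : NNReal} {b : ℝ} (hbv : b * v ≤ 1 / 4) :
    ∫⁻ z, ENNReal.ofReal (Real.exp (b * z ^ 2)) ∂(gaussianReal 0 v) ≤ 2 := by
  by_cases hv : v = 0
  · subst hv
    rw [gaussianReal_zero_var, lintegral_dirac]
    simp
  have hv' : (0 : ℝ) < v := by positivity
  rw [gaussianReal_of_var_ne_zero _ hv, lintegral_withDensity_eq_lintegral_mul _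
    (measurable_gaussianPDF _ _) (by fun_prop)]
  have hc' : (4 * v : ℝ)⁻¹ ≤ (2 * v : ℝ)⁻¹ - b := by
    have hb' : b ≤ (4 * v : ℝ)⁻¹ := by
      rw [← one_div, le_div_iff₀ (by positivity)]; linarith
    have : (2 * v : ℝ)⁻¹ = (4 * v : ℝ)⁻¹ + (4 * v : ℝ)⁻¹ := by field_simp; norm_num
    linarith
  have hc : 0 < (2 * v : ℝ)⁻¹ - b := lt_of_lt_of_le (by positivity) hc'
  have : ∀ z : ℝ, (gaussianPDF 0 v * fun z => ENNReal.ofReal (Real.exp (b * z ^ 2))) z =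
      ENNReal.ofReal ((√(2 * Real.pi * v))⁻¹ * Real.exp (-((2 * v : ℝ)⁻¹ - b) * z ^ 2)) := by
    intro z
    simp only [Pi.mul_apply, gaussianPDF, gaussianPDFReal]
    rw [← ENNReal.ofReal_mul (by positivity), mul_assoc, ← Real.exp_add]
    congr 3
    field_simp; ring
  simp_rw [this]
  rw [← ofReal_integral_eq_lintegral_ofReal ((integrable_exp_neg_mul_sq hc).const_mul _)
    (Filter.Eventually.of_forall fun _ => by positivity), integral_const_mul, integral_gaussian]
  have h1 : √(Real.pi / ((2 * v : ℝ)⁻¹ - b)) ≤ 2 * √(2 * Real.pi * v) := by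
    rw [show (2 : ℝ) * √(2 * Real.pi * v) = √(2 ^ 2 * (2 * Real.pi * v)) by
      rw [Real.sqrt_mul (x := 2 ^ 2) (by positivity), Real.sqrt_sq (by norm_num)]]
    refine Real.sqrt_le_sqrt ?_
    rw [div_le_iff₀ hc]
    have : Real.pi = 4 * Real.pi * v * (4 * v : ℝ)⁻¹ := by field_simp
    have h3 : 0 < Real.pi * v := by positivity
    have h4 := mul_le_mul_of_nonneg_left hc' h3.le
    have h5 := mul_pos h3 hc
    nlinarith
  refine (ENNReal.ofReal_le_ofReal (?_ : _ ≤ (2 : ℝ))).trans (by simp)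
  rw [inv_mul_le_iff₀ (by positivity)]
  linarith

end SingleIndex

/-! ### Exponential moments of white noise integrals -/

namespace SingleIndex

lemma integral_sq_linear_comb {α : Type*} [MeasurableSpace α] {μ : Measure α} {f g : α → ℝ}
    (hf : MemLp f 2 μ) (hg : MemLp g 2 μ) (c d : ℝ) : ∫ t, (c * f t - d * g t) ^ 2 ∂μ =
      c ^ 2 * ∫ t, f t * f t ∂μ - 2 * c * d * ∫ t, f t * g t ∂μ + d ^ 2 * ∫ t, g t * g t ∂μ := by
  have e : ∀ t, (c * f t - d * g t) ^ 2 =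
      c ^ 2 * (f t * f t) - 2 * c * d * (f t * g t) + d ^ 2 * (g t * g t) := fun t => by ring
  have j1 : Integrable (fun t => f t * f t) μ := hf.integrable_mul hf
  have j2 : Integrable (fun t => f t * g t) μ := hf.integrable_mul hg
  have j3 : Integrable (fun t => g t * g t) μ := hg.integrable_mul hg
  simp_rw [e]
  have j4 : Integrable (fun t => c ^ 2 * (f t * f t) - 2 * c * d * (f t * g t)) μ :=
    (j1.const_mul _).sub (j2.const_mul _)
  rw [integral_add j4 (j3.const_mul _),
    integral_sub (j1.const_mul _) (j2.const_mul _), integral_const_mul, integral_const_mul,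
    integral_const_mul]

lemma IsWhiteNoise.lintegral_exp_sq_le {Ω : Type*} [MeasurableSpace Ω] {D : Set Plane}
    {P : Measure Ω} {W : (Plane → ℝ) → Ω → ℝ} (hW : IsWhiteNoise D P W) {φ ψ : Plane → ℝ}
    (hφ : MemLp φ 2 (volume.restrict D)) (hψ : MemLp ψ 2 (volume.restrict D)) (c d : ℝ)
    {b : ℝ} (hv : b * ∫ t in D, (c * φ t - d * ψ t) ^ 2 ≤ 1 / 4) :
    ∫⁻ ω, ENNReal.ofReal (Real.exp (b * (c * W φ ω - d * W ψ ω) ^ 2)) ∂P ≤ 2 := by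
  have hpair : HasGaussianLaw (fun ω => (W φ ω, W ψ ω)) P :=
    hW.gaussian.hasGaussianLaw_prodMk (s := ⟨φ, hφ⟩) (t := ⟨ψ, hψ⟩)
  have hlin : HasGaussianLaw (fun ω => c * W φ ω - d * W ψ ω) P := by
    have := hpair.map_fun (c • ContinuousLinearMap.fst ℝ ℝ ℝ - d • ContinuousLinearMap.snd ℝ ℝ ℝ)
    simpa using this
  have hP := hpair.isProbabilityMeasure
  have h1 : MemLp (W φ) 2 P := hpair.fst.memLp_two
  have h2 : MemLp (W ψ) 2 P := hpair.snd.memLp_two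
  have i1 : Integrable (W φ) P := hpair.fst.integrable
  have i2 : Integrable (W ψ) P := hpair.snd.integrable
  have hmean : ∫ ω, (c * W φ ω - d * W ψ ω) ∂P = 0 := by
    rw [integral_sub (i1.const_mul c) (i2.const_mul d), integral_const_mul, integral_const_mul,
      hW.mean φ hφ, hW.mean ψ hψ]
    simp
  have hvar : Var[fun ω => c * W φ ω - d * W ψ ω; P] = ∫ t in D, (c * φ t - d * ψ t) ^ 2 := by
    rw [variance_of_integral_eq_zero hlin.aemeasurable hmean, integral_sq_linear_comb h1 h2,
      integral_sq_linear_comb hφ hψ,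
      hW.covariance φ φ hφ hφ, hW.covariance φ ψ hφ hψ, hW.covariance ψ ψ hψ hψ]
  have hmap := hlin.map_eq_gaussianReal
  rw [hmean, hvar] at hmap
  have hm : Measurable fun z : ℝ => ENNReal.ofReal (Real.exp (b * z ^ 2)) := by fun_prop
  rw [← lintegral_map' (f := fun z : ℝ => ENNReal.ofReal (Real.exp (b * z ^ 2)))
    hm.aemeasurable hlin.aemeasurable, hmap]
  refine lintegral_exp_sq_gaussianReal_le ?_
  rwa [Real.coe_toNNReal _ (integral_nonneg fun _ => sq_nonneg _)]

end SingleIndex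

/-! ### Kernels and changes of variables -/

namespace SingleIndex

section Kernel

variable {k : ℝ → ℝ}

lemma IsKernel.continuous (hk : IsKernel k) : Continuous k := hk.lipschitz.choose_spec.continuous

lemma IsKernel.integrable (hk : IsKernel k) : Integrable k :=
  hk.continuous.integrable_of_hasCompactSupport hk.hasCompactSupport

lemma IsKernel.bddAbove (hk : IsKernel k) : BddAbove (range fun u => |k u|) := by
  obtain ⟨c, hc⟩ := hk.continuous.bounded_above_of_compact_support hk.hasCompactSupport
  exact ⟨c, by rintro _ ⟨u, rfl⟩; exact hc u⟩

lemma IsKernel.abs_le (hk : IsKernel k) (u : ℝ) : |k u| ≤ supNorm k := le_ciSup hk.bddAbove u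

lemma IsKernel.supNorm_pos (hk : IsKernel k) : 0 < supNorm k := by
  by_contra! h
  have h0 : ∀ u, k u = 0 := fun u =>
    abs_eq_zero.1 (le_antisymm ((hk.abs_le u).trans h) (abs_nonneg _))
  have := hk.integral_eq_one
  simp [h0] at this

lemma IsKernel.one_le_l1Norm (hk : IsKernel k) : 1 ≤ l1Norm k := by
  rw [← hk.integral_eq_one]
  exact integral_mono hk.integrable hk.integrable.abs fun u => le_abs_self _

lemma IsKernel.exists_radius (hk : IsKernel k) : ∃ R : ℝ, 1 ≤ R ∧ ∀ u, R < |u| → k u = 0 := by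
  obtain ⟨R, hR⟩ := hk.hasCompactSupport.isCompact.isBounded.exists_norm_le
  refine ⟨max R 1, le_max_right _ _, fun u hu => ?_⟩
  by_contra h
  exact absurd (hR u (subset_tsupport _ h)) (not_le.2 ((le_max_left _ _).trans_lt hu))

lemma IsKernel.exists_lipschitz (hk : IsKernel k) :
    ∃ Λ : ℝ, 0 ≤ Λ ∧ ∀ u v, |k u - k v| ≤ Λ * |u - v| := by
  obtain ⟨L, hL⟩ := hk.lipschitz
  exact ⟨L, L.2, fun u v => by simpa [Real.dist_eq] using hL.dist_le_mul u v⟩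

lemma IsKernel.integrable_sq (hk : IsKernel k) : Integrable fun u => k u ^ 2 := by
  have := hk.integrable.bdd_mul (f := k) (c := supNorm k) hk.continuous.aestronglyMeasurable
    (Filter.Eventually.of_forall hk.abs_le)
  simpa [sq] using this

lemma IsKernel.integral_abs_mul_le (hk : IsKernel k) {R : ℝ} (hR1 : 0 ≤ R)
    (hR : ∀ u, R < |u| → k u = 0) {g : ℝ → ℝ} (hg : ∀ u, 0 ≤ g u) (hgi : LocallyIntegrable g) :
    ∫ w, |k w| * g w ≤ supNorm k * ∫ w in (-R)..R, g w := by
  have hi : IntegrableOn g (Icc (-R) R) := hgi.integrableOn_isCompact isCompact_Icc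
  have h0 : ∀ w, |k w| * g w ≤ (Icc (-R) R).indicator (fun w => supNorm k * g w) w := fun w => by
    by_cases hw : w ∈ Icc (-R) R
    · rw [indicator_of_mem hw]; exact mul_le_mul_of_nonneg_right (hk.abs_le w) (hg w)
    · rw [indicator_of_notMem hw, hR w (by rw [← not_le, _root_.abs_le]; exact hw)]; simp
  have hi2 : Integrable ((Icc (-R) R).indicator (fun w => supNorm k * g w)) :=
    (integrable_indicator_iff measurableSet_Icc).2 (hi.const_mul (supNorm k))
  refine (integral_mono_of_nonneg
    (Filter.Eventually.of_forall fun w => mul_nonneg (abs_nonneg _) (hg w)) hi2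
    (Filter.Eventually.of_forall h0)).trans ?_
  rw [integral_indicator measurableSet_Icc, integral_const_mul,
    intervalIntegral.integral_of_le (by linarith), integral_Icc_eq_integral_Ioc]

lemma IsKernel.l1Norm_le (hk : IsKernel k) {R : ℝ} (hR1 : 0 ≤ R) (hR : ∀ u, R < |u| → k u = 0) :
    l1Norm k ≤ 2 * R * supNorm k := by
  have := hk.integral_abs_mul_le hR1 hR (g := fun _ => 1) (by simp) (locallyIntegrable_const _)
  simp at this
  rw [l1Norm]; linarith

end Kernel

section Matrices

lemma det_indexMatrix (σ : Plane) (h : ℝ) :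
    (indexMatrix σ h).det = h⁻¹ * (σ 0 ^ 2 + σ 1 ^ 2) := by
  simp [indexMatrix, Matrix.det_fin_two]; ring

lemma indexMatrix_mulVec_zero (σ u : Plane) (h : ℝ) :
    (indexMatrix σ h *ᵥ u) 0 = h⁻¹ * (σ 0 * u 0 + σ 1 * u 1) := by
  simp [indexMatrix, Matrix.mulVec, dotProduct, Fin.sum_univ_two]; ring

lemma indexMatrix_mulVec_one (σ u : Plane) (h : ℝ) :
    (indexMatrix σ h *ᵥ u) 1 = σ 0 * u 1 - σ 1 * u 0 := by
  simp [indexMatrix, Matrix.mulVec, dotProduct, Fin.sum_univ_two]; ring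

lemma kernelAt_indexMatrix (k : ℝ → ℝ) (σ x t : Plane) (h : ℝ) :
    kernelAt k (indexMatrix σ h) x t =
      k (h⁻¹ * (σ 0 * (t 0 - x 0) + σ 1 * (t 1 - x 1))) *
        k (σ 0 * (t 1 - x 1) - σ 1 * (t 0 - x 0)) := by
  simp [kernelAt, indexMatrix_mulVec_zero, indexMatrix_mulVec_one]

lemma continuous_kernelAt {k : ℝ → ℝ} (hk : IsKernel k) :
    Continuous fun p : (Matrix (Fin 2) (Fin 2) ℝ × Plane) × Plane =>
      kernelAt k p.1.1 p.1.2 p.2 := by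
  have h : ∀ i, Continuous fun p : (Matrix (Fin 2) (Fin 2) ℝ × Plane) × Plane =>
      (p.1.1 *ᵥ (p.2 - p.1.2)) i := fun i => by
    simp only [Matrix.mulVec, dotProduct, Fin.sum_univ_two]
    fun_prop
  exact (hk.continuous.comp (h 0)).mul (hk.continuous.comp (h 1))

lemma abs_kernelAt_le {k : ℝ → ℝ} (hk : IsKernel k) (A : Matrix (Fin 2) (Fin 2) ℝ)
    (x t : Plane) : |kernelAt k A x t| ≤ supNorm k ^ 2 := by
  rw [kernelAt, abs_mul, sq]
  exact mul_le_mul (hk.abs_le _) (hk.abs_le _) (abs_nonneg _) hk.supNorm_pos.le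

lemma memLp_kernelAt {k : ℝ → ℝ} (hk : IsKernel k) (A : Matrix (Fin 2) (Fin 2) ℝ) (x : Plane)
    {D : Set Plane} (hD : volume D ≠ ∞) : MemLp (kernelAt k A x) 2 (volume.restrict D) := by
  have : IsFiniteMeasure (volume.restrict D) := ⟨by simpa using hD.lt_top⟩
  have hc : Continuous (kernelAt k A x) := by
    have h := (continuous_kernelAt hk).comp
      (Continuous.prodMk (continuous_const (y := (A, x))) continuous_id)
    exact h
  exact MemLp.of_bound hc.aestronglyMeasurable (supNorm k ^ 2)
    (Filter.Eventually.of_forall fun t => abs_kernelAt_le hk A x t)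

lemma integral_comp_mulVec_sub {A : Matrix (Fin 2) (Fin 2) ℝ} (hA : A.det ≠ 0) (x : Plane)
    (g : Plane → ℝ) : ∫ t, g (A *ᵥ (t - x)) = |A.det|⁻¹ * ∫ w, g w := by
  rw [integral_sub_right_eq_self (fun t => g (A *ᵥ t)) x]
  have hA' : LinearMap.det (Matrix.toLin' A) ≠ 0 := by simpa using hA
  have := Measure.map_linearMap_addHaar_eq_smul_addHaar (volume : Measure Plane) hA'
  have he : MeasurableEmbedding (Matrix.toLin' A) :=
    (LinearEquiv.ofIsUnitDet (f := Matrix.toLin' A) (v := Pi.basisFun ℝ (Fin 2))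
      (v' := Pi.basisFun ℝ (Fin 2))
      (by simpa [LinearMap.det_toLin'] using hA)).toContinuousLinearEquiv.toHomeomorph.measurableEmbedding
  have h2 := he.integral_map (μ := volume) g
  rw [this, integral_smul_measure] at h2
  simp only [Matrix.toLin'_apply, LinearMap.det_toLin'] at h2
  rw [← h2, ENNReal.toReal_ofReal (abs_nonneg _), abs_inv, smul_eq_mul]

lemma integral_plane {g : ℝ → ℝ → ℝ}
    (hg : Integrable (fun p : ℝ × ℝ => g p.1 p.2)) :
    ∫ w : Plane, g (w 0) (w 1) = ∫ b, ∫ a, g a b := by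
  have h := (volume_preserving_finTwoArrow ℝ).integral_comp
    (MeasurableEquiv.measurableEmbedding _) (fun p : ℝ × ℝ => g p.1 p.2)
  simp only [MeasurableEquiv.finTwoArrow_apply] at h
  rw [h]
  exact integral_prod_symm _ hg

end Matrices

end SingleIndex

/-! ### Means, variances and increments of the kernel estimators -/

namespace SingleIndex

variable {k : ℝ → ℝ}

lemma integrable_kernel_mul (hk : IsKernel k) {f : ℝ → ℝ} (hf : Measurable f) {M : ℝ}
    (hM : ∀ u, |f u| ≤ M) (y α β : ℝ) :
    Integrable fun p : ℝ × ℝ => k p.2 * (k p.1 * f (y + α * p.1 + β * p.2)) := by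
  have h1 : Integrable fun p : ℝ × ℝ => k p.1 * k p.2 := hk.integrable.mul_prod hk.integrable
  have := h1.bdd_mul (f := fun p : ℝ × ℝ => f (y + α * p.1 + β * p.2)) (c := M)
    (hf.comp (by fun_prop)).aestronglyMeasurable (Filter.Eventually.of_forall fun p => hM _)
  refine this.congr (Filter.Eventually.of_forall fun p => ?_)
  simp only; ring

/-- The mean of a kernel estimator, in the coordinates `w = A (t - x)`: with `q = |σ|²` the inverse of
`A = indexMatrix σ h` maps `w` to `q⁻¹ (h w₀ σ + w₁ σ^⊥)`. -/
lemma det_mul_setIntegral_kernelAt (hk : IsKernel k) {f : ℝ → ℝ} (hf : Measurable f) {M : ℝ}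
    (hM : ∀ u, |f u| ≤ M) {σ : Plane} (hσ : 0 < σ 0 ^ 2 + σ 1 ^ 2) {h : ℝ} (hh : 0 < h)
    (θ x : Plane) {D : Set Plane} (hD : ∀ t, kernelAt k (indexMatrix σ h) x t ≠ 0 → t ∈ D) :
    (indexMatrix σ h).det * ∫ t in D, kernelAt k (indexMatrix σ h) x t * f (t ⬝ᵥ θ) =
      ∫ b, k b * ∫ a, k a * f (x ⬝ᵥ θ + h * ((σ ⬝ᵥ θ) / (σ 0 ^ 2 + σ 1 ^ 2)) * a +
        (σ 0 * θ 1 - σ 1 * θ 0) / (σ 0 ^ 2 + σ 1 ^ 2) * b) := by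
  set q := σ 0 ^ 2 + σ 1 ^ 2 with hq
  have hdet : 0 < (indexMatrix σ h).det := by
    rw [det_indexMatrix]; positivity
  rw [setIntegral_eq_integral_of_forall_compl_eq_zero fun t ht => by
    rw [not_imp_comm.1 (hD t) ht, zero_mul]]
  set α := h * ((σ ⬝ᵥ θ) / q) with hα
  set β := (σ 0 * θ 1 - σ 1 * θ 0) / q with hβ
  have e : ∀ t, kernelAt k (indexMatrix σ h) x t * f (t ⬝ᵥ θ) =
      (fun w : Plane => (fun a b => k b * (k a * f (x ⬝ᵥ θ + α * a + β * b))) (w 0) (w 1))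
        (indexMatrix σ h *ᵥ (t - x)) := fun t => by
    have : t ⬝ᵥ θ = x ⬝ᵥ θ + α * (indexMatrix σ h *ᵥ (t - x)) 0 +
        β * (indexMatrix σ h *ᵥ (t - x)) 1 := by
      rw [indexMatrix_mulVec_zero, indexMatrix_mulVec_one, hα, hβ]
      simp only [dotProduct, Fin.sum_univ_two, Pi.sub_apply]
      field_simp
      rw [hq]; ring
    rw [this, kernelAt]; ring
  have e2 := (integral_congr_ae (Filter.Eventually.of_forall e)).trans
    (integral_comp_mulVec_sub hdet.ne' x
      (fun w : Plane => (fun a b => k b * (k a * f (x ⬝ᵥ θ + α * a + β * b))) (w 0) (w 1)))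
  rw [e2, integral_plane (g := fun a b => k b * (k a * f (x ⬝ᵥ θ + α * a + β * b)))
    (integrable_kernel_mul hk hf hM _ _ _), abs_of_pos hdet, mul_inv_cancel_left₀ hdet.ne']
  simp_rw [integral_const_mul]

lemma setIntegral_kernelAt_sq_le (hk : IsKernel k) {A : Matrix (Fin 2) (Fin 2) ℝ}
    (hA : A.det ≠ 0) (x : Plane) (D : Set Plane) :
    ∫ t in D, kernelAt k A x t ^ 2 ≤ |A.det|⁻¹ * (∫ u, k u ^ 2) ^ 2 := by
  have hi : Integrable fun p : ℝ × ℝ => k p.1 ^ 2 * k p.2 ^ 2 :=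
    hk.integrable_sq.mul_prod hk.integrable_sq
  have e : ∀ t, kernelAt k A x t ^ 2 = (fun w : Plane => (fun a b => k a ^ 2 * k b ^ 2)
      (w 0) (w 1)) (A *ᵥ (t - x)) := fun t => by simp [kernelAt, mul_pow]
  have h1 : ∫ t, kernelAt k A x t ^ 2 = |A.det|⁻¹ * (∫ u, k u ^ 2) ^ 2 := by
    have e2 := (integral_congr_ae (Filter.Eventually.of_forall e)).trans
      (integral_comp_mulVec_sub hA x
        (fun w : Plane => (fun a b => k a ^ 2 * k b ^ 2) (w 0) (w 1)))
    rw [e2, integral_plane (g := fun a b => k a ^ 2 * k b ^ 2) hi]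
    simp_rw [integral_mul_const, integral_const_mul]
    ring
  rw [← h1]
  refine setIntegral_le_integral ?_ (Filter.Eventually.of_forall fun t => sq_nonneg _)
  -- the integral over the plane is not a junk value, since it is positive
  by_contra hni
  have hk2 : 0 < (∫ u, k u ^ 2) := by
    rw [integral_pos_iff_support_of_nonneg (fun _ => sq_nonneg _) hk.integrable_sq]
    have hne : (Function.support fun u => k u ^ 2).Nonempty := by
      by_contra! h0
      have h0' : ∀ u, k u = 0 := fun u => by
        simpa using congrFun (Function.support_eq_empty_iff.1 h0) u
      have := hk.integral_eq_one
      simp [h0'] at this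
    exact ((hk.continuous.pow 2).isOpen_support).measure_pos _ hne
  rw [integral_undef hni] at h1
  have : 0 < |A.det| := abs_pos.2 hA
  have : 0 < |A.det|⁻¹ * (∫ u, k u ^ 2) ^ 2 := by positivity
  linarith

lemma abs_apply_le_one {ρ : Plane} (hρ : ρ 0 ^ 2 + ρ 1 ^ 2 ≤ 1) (i : Fin 2) : |ρ i| ≤ 1 := by
  rw [← sq_le_one_iff_abs_le_one]
  fin_cases i
  · exact (le_add_of_nonneg_right (sq_nonneg (ρ 1))).trans hρ
  · exact (le_add_of_nonneg_left (sq_nonneg (ρ 0))).trans hρ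

/-- The windows of the kernel estimators at `x` lie in a square around `x`. -/
lemma kernelAt_indexMatrix_eq_zero {R : ℝ} (hR1 : 1 ≤ R) (hR : ∀ u, R < |u| → k u = 0)
    {ρ x t : Plane} {h : ℝ} (hh : 0 < h) (hh1 : h ≤ 1) (hρ : 1 / 4 ≤ ρ 0 ^ 2 + ρ 1 ^ 2)
    (ht : t ∉ Icc (fun i => x i - 3 * R) (fun i => x i + 3 * R)) :
    kernelAt k (indexMatrix ρ h) x t = 0 := by
  by_contra hne
  rw [kernelAt_indexMatrix] at hne
  set a := ρ 0 * (t 0 - x 0) + ρ 1 * (t 1 - x 1) with ha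
  set b := ρ 0 * (t 1 - x 1) - ρ 1 * (t 0 - x 0) with hb
  have hb1 : |b| ≤ R := by
    by_contra! hc; exact hne (by rw [hR _ hc, mul_zero])
  have ha1 : |a| ≤ R := by
    have h1 : |h⁻¹ * a| ≤ R := by
      by_contra! hc; exact hne (by rw [hR _ hc, zero_mul])
    rw [abs_mul, abs_of_pos (inv_pos.2 hh), inv_mul_le_iff₀ hh] at h1
    nlinarith
  have hab : a ^ 2 + b ^ 2 ≤ 2 * R ^ 2 := by
    have h1 := sq_le_sq' (abs_le.1 ha1).1 (abs_le.1 ha1).2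
    have h2 := sq_le_sq' (abs_le.1 hb1).1 (abs_le.1 hb1).2
    linarith
  have hid : a ^ 2 + b ^ 2 =
      (ρ 0 ^ 2 + ρ 1 ^ 2) * ((t 0 - x 0) ^ 2 + (t 1 - x 1) ^ 2) := by rw [ha, hb]; ring
  have hu : (t 0 - x 0) ^ 2 + (t 1 - x 1) ^ 2 ≤ (3 * R) ^ 2 := by
    nlinarith [sq_nonneg (t 0 - x 0), sq_nonneg (t 1 - x 1)]
  have h0 := abs_le.1 (abs_le_of_sq_le_sq (show (t 0 - x 0) ^ 2 ≤ (3 * R) ^ 2 by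
    nlinarith [sq_nonneg (t 1 - x 1)]) (by positivity))
  have h1 := abs_le.1 (abs_le_of_sq_le_sq (show (t 1 - x 1) ^ 2 ≤ (3 * R) ^ 2 by
    nlinarith [sq_nonneg (t 0 - x 0)]) (by positivity))
  refine ht ⟨fun i => ?_, fun i => ?_⟩ <;> fin_cases i <;> simp <;> linarith

lemma abs_det_mul_kernelAt_sub_le (hk : IsKernel k) {R Λ : ℝ} (hR1 : 1 ≤ R)
    (hR : ∀ u, R < |u| → k u = 0) (hΛ : 0 ≤ Λ) (hL : ∀ u v, |k u - k v| ≤ Λ * |u - v|)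
    {σ τ x t : Plane} {h δ : ℝ} (hh : 0 < h) (hh1 : h ≤ 1)
    (hσ1 : 1 / 4 ≤ σ 0 ^ 2 + σ 1 ^ 2) (hσ2 : σ 0 ^ 2 + σ 1 ^ 2 ≤ 1)
    (hτ1 : 1 / 4 ≤ τ 0 ^ 2 + τ 1 ^ 2) (hτ2 : τ 0 ^ 2 + τ 1 ^ 2 ≤ 1)
    (hδ : ∀ i, |σ i - τ i| ≤ δ) :
    |(indexMatrix σ h).det * kernelAt k (indexMatrix σ h) x t -
      (indexMatrix τ h).det * kernelAt k (indexMatrix τ h) x t| ≤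
      (Icc (fun i => x i - 3 * R) (fun i => x i + 3 * R)).indicator
        (fun _ => (4 * supNorm k ^ 2 + 12 * R * supNorm k * Λ) * δ / h ^ 2) t := by
  have hS := hk.supNorm_pos
  have hδ0 : 0 ≤ δ := (abs_nonneg _).trans (hδ 0)
  have hout := fun (ρ : Plane) (hρ : 1 / 4 ≤ ρ 0 ^ 2 + ρ 1 ^ 2) =>
    kernelAt_indexMatrix_eq_zero hR1 hR (ρ := ρ) (x := x) (t := t) hh hh1 hρ
  by_cases ht : t ∈ Icc (fun i => x i - 3 * R) (fun i => x i + 3 * R)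
  swap
  · rw [indicator_of_notMem ht, hout σ hσ1 ht, hout τ hτ1 ht]; simp
  rw [indicator_of_mem ht]
  have hu0 : |t 0 - x 0| ≤ 3 * R := abs_le.2 ⟨by linarith [ht.1 0], by linarith [ht.2 0]⟩
  have hu1 : |t 1 - x 1| ≤ 3 * R := abs_le.2 ⟨by linarith [ht.1 1], by linarith [ht.2 1]⟩
  have hdet : |(indexMatrix σ h).det - (indexMatrix τ h).det| ≤ 4 * δ / h := by
    rw [det_indexMatrix, det_indexMatrix, ← mul_sub, abs_mul, abs_of_pos (inv_pos.2 hh),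
      div_eq_inv_mul]
    refine mul_le_mul_of_nonneg_left ?_ (inv_pos.2 hh).le
    have hs : ∀ i, |σ i ^ 2 - τ i ^ 2| ≤ 2 * δ := fun i => by
      have h1 := abs_apply_le_one hσ2 i
      have h2 := abs_apply_le_one hτ2 i
      rw [sq_sub_sq, abs_mul]
      have h3 : |σ i + τ i| ≤ 2 := (abs_add_le _ _).trans (by linarith)
      exact mul_le_mul h3 (hδ i) (abs_nonneg _) (by norm_num)
    calc |σ 0 ^ 2 + σ 1 ^ 2 - (τ 0 ^ 2 + τ 1 ^ 2)|
        = |(σ 0 ^ 2 - τ 0 ^ 2) + (σ 1 ^ 2 - τ 1 ^ 2)| := by ring_nf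
      _ ≤ _ := (abs_add_le _ _).trans (by linarith [hs 0, hs 1])
  have hdet2 : |(indexMatrix τ h).det| ≤ 1 / h := by
    rw [det_indexMatrix, abs_of_nonneg (by positivity), one_div]
    exact mul_le_of_le_one_right (by positivity) hτ2
  have hK : |kernelAt k (indexMatrix σ h) x t - kernelAt k (indexMatrix τ h) x t| ≤
      12 * R * supNorm k * Λ * δ / h := by
    rw [kernelAt_indexMatrix, kernelAt_indexMatrix]
    set a := h⁻¹ * (σ 0 * (t 0 - x 0) + σ 1 * (t 1 - x 1)) with ha
    set b := σ 0 * (t 1 - x 1) - σ 1 * (t 0 - x 0) with hb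
    set a' := h⁻¹ * (τ 0 * (t 0 - x 0) + τ 1 * (t 1 - x 1)) with ha'
    set b' := τ 0 * (t 1 - x 1) - τ 1 * (t 0 - x 0) with hb'
    have hp : ∀ i (u : ℝ), |u| ≤ 3 * R → |(σ i - τ i) * u| ≤ δ * (3 * R) := fun i u hu => by
      rw [abs_mul]; exact mul_le_mul (hδ i) hu (abs_nonneg _) hδ0
    have hda : |a - a'| ≤ 6 * R * δ / h := by
      have : a - a' = h⁻¹ * ((σ 0 - τ 0) * (t 0 - x 0) + (σ 1 - τ 1) * (t 1 - x 1)) := by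
        rw [ha, ha']; ring
      rw [this, abs_mul, abs_of_pos (inv_pos.2 hh), div_eq_inv_mul]
      refine mul_le_mul_of_nonneg_left ((abs_add_le _ _).trans ?_) (inv_pos.2 hh).le
      linarith [hp 0 _ hu0, hp 1 _ hu1]
    have hdb : |b - b'| ≤ 6 * R * δ / h := by
      have : b - b' = (σ 0 - τ 0) * (t 1 - x 1) + -((σ 1 - τ 1) * (t 0 - x 0)) := by
        rw [hb, hb']; ring
      rw [this]
      refine (abs_add_le _ _).trans ?_
      rw [abs_neg]
      have h1 : 6 * R * δ ≤ 6 * R * δ / h := by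
        rw [le_div_iff₀ hh]; exact mul_le_of_le_one_right (by positivity) hh1
      linarith [hp 0 _ hu1, hp 1 _ hu0]
    have hdec : k a * k b - k a' * k b' = (k a - k a') * k b + k a' * (k b - k b') := by ring
    rw [hdec]
    refine (abs_add_le _ _).trans ?_
    rw [abs_mul, abs_mul]
    have h1 : |k a - k a'| * |k b| ≤ (Λ * (6 * R * δ / h)) * supNorm k :=
      mul_le_mul ((hL _ _).trans (mul_le_mul_of_nonneg_left hda hΛ)) (hk.abs_le _) (abs_nonneg _)
        (by positivity)
    have h2 : |k a'| * |k b - k b'| ≤ supNorm k * (Λ * (6 * R * δ / h)) :=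
      mul_le_mul (hk.abs_le _) ((hL _ _).trans (mul_le_mul_of_nonneg_left hdb hΛ)) (abs_nonneg _)
        hS.le
    refine (add_le_add h1 h2).trans (le_of_eq ?_)
    ring
  have hdec : (indexMatrix σ h).det * kernelAt k (indexMatrix σ h) x t -
      (indexMatrix τ h).det * kernelAt k (indexMatrix τ h) x t =
      ((indexMatrix σ h).det - (indexMatrix τ h).det) * kernelAt k (indexMatrix σ h) x t +
      (indexMatrix τ h).det *
        (kernelAt k (indexMatrix σ h) x t - kernelAt k (indexMatrix τ h) x t) := by ring
  rw [hdec]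
  refine (abs_add_le _ _).trans ?_
  rw [abs_mul, abs_mul]
  have h1 := mul_le_mul hdet (abs_kernelAt_le hk (indexMatrix σ h) x t) (abs_nonneg _)
    (by positivity)
  have h2 := mul_le_mul hdet2 hK (abs_nonneg _) (by positivity)
  refine (add_le_add h1 h2).trans ?_
  have h3 : 4 * δ / h * supNorm k ^ 2 ≤ 4 * δ / h ^ 2 * supNorm k ^ 2 := by
    refine mul_le_mul_of_nonneg_right ?_ (by positivity)
    refine div_le_div_of_nonneg_left (by positivity) (by positivity) ?_
    nlinarith
  refine (add_le_add_left h3 _).trans (le_of_eq ?_)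
  field_simp

/-- The kernels of the estimators are Lipschitz in `σ` as elements of `L²`. The power of `h` is not
optimal, but any power is sufficient. -/
lemma setIntegral_det_mul_kernelAt_sub_sq_le (hk : IsKernel k) {R Λ : ℝ} (hR1 : 1 ≤ R)
    (hR : ∀ u, R < |u| → k u = 0) (hΛ : 0 ≤ Λ) (hL : ∀ u v, |k u - k v| ≤ Λ * |u - v|)
    {σ τ : Plane} (x : Plane) {h δ : ℝ} (hh : 0 < h) (hh1 : h ≤ 1)
    (hσ1 : 1 / 4 ≤ σ 0 ^ 2 + σ 1 ^ 2) (hσ2 : σ 0 ^ 2 + σ 1 ^ 2 ≤ 1)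
    (hτ1 : 1 / 4 ≤ τ 0 ^ 2 + τ 1 ^ 2) (hτ2 : τ 0 ^ 2 + τ 1 ^ 2 ≤ 1)
    (hδ : ∀ i, |σ i - τ i| ≤ δ) (D : Set Plane) :
    ∫ t in D, ((indexMatrix σ h).det * kernelAt k (indexMatrix σ h) x t -
      (indexMatrix τ h).det * kernelAt k (indexMatrix τ h) x t) ^ 2 ≤
      (6 * R * (4 * supNorm k ^ 2 + 12 * R * supNorm k * Λ) * δ / h ^ 2) ^ 2 := by
  set c := (4 * supNorm k ^ 2 + 12 * R * supNorm k * Λ) * δ / h ^ 2 with hc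
  set B : Set Plane := Icc (fun i => x i - 3 * R) (fun i => x i + 3 * R) with hB
  have hBm : MeasurableSet B := measurableSet_Icc
  have hBv : volume.real B = (6 * R) ^ 2 := by
    rw [Measure.real, hB, Real.volume_Icc_pi_toReal (fun i => by simp; linarith)]
    simp only [Fin.prod_univ_two]
    ring
  have hBf : volume B ≠ ∞ := isCompact_Icc.measure_lt_top.ne
  have hi : Integrable (B.indicator fun _ => c ^ 2) (volume : Measure Plane) :=
    (integrable_indicator_iff hBm).2 (integrableOn_const hBf)
  calc _ ≤ ∫ t in D, B.indicator (fun _ => c ^ 2) t := by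
        refine integral_mono_of_nonneg (Filter.Eventually.of_forall fun _ => sq_nonneg _)
          hi.integrableOn (Filter.Eventually.of_forall fun t => ?_)
        have := abs_det_mul_kernelAt_sub_le hk hR1 hR hΛ hL (x := x) (t := t) hh hh1 hσ1 hσ2 hτ1
          hτ2 hδ
        simp only
        rw [← sq_abs]
        refine (pow_le_pow_left₀ (abs_nonneg _) this 2).trans (le_of_eq ?_)
        by_cases ht : t ∈ B
        · rw [indicator_of_mem ht, indicator_of_mem ht]
        · rw [indicator_of_notMem ht, indicator_of_notMem ht]; simp
    _ ≤ ∫ t, B.indicator (fun _ => c ^ 2) t := setIntegral_le_integral hi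
        (Filter.Eventually.of_forall fun t => indicator_nonneg (fun _ _ => sq_nonneg _) t)
    _ = (6 * R) ^ 2 * c ^ 2 := by
        rw [integral_indicator hBm, setIntegral_const, hBv, smul_eq_mul]
    _ = _ := by rw [hc]; ring

end SingleIndex

/-! ### Approximation errors and the oracle bandwidth -/

namespace SingleIndex

variable {k f : ℝ → ℝ} {M : ℝ}

lemma integrable_kernel_mul_comp (hk : IsKernel k) (hf : Measurable f) (hM : ∀ u, |f u| ≤ M)
    (y b : ℝ) : Integrable fun w => k w * f (y + b * w) := by
  have := hk.integrable.bdd_mul (f := fun w => f (y + b * w)) (c := M)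
    (hf.comp (by fun_prop)).aestronglyMeasurable (Filter.Eventually.of_forall fun p => hM _)
  exact this.congr (Filter.Eventually.of_forall fun p => mul_comm _ _)

lemma inv_mul_integral_eq (hk : IsKernel k) (hf : Measurable f) (hM : ∀ u, |f u| ≤ M) {δ : ℝ}
    (hδ : 0 < δ) (z : ℝ) : δ⁻¹ * ∫ u, k ((u - z) / δ) * (f u - f z) =
      (∫ w, k w * f (z + δ * w)) - f z := by
  have h1 : ∫ u, k ((u - z) / δ) * (f u - f z) = δ * ∫ w, k w * (f (z + δ * w) - f z) := by
    have e : ∀ u, k ((u - z) / δ) * (f u - f z) =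
        (fun v => (fun w => k w * (f (z + δ * w) - f z)) (v / δ)) (u - z) := fun u => by
      have : z + δ * ((u - z) / δ) = u := by field_simp; ring
      simp only [this]
    simp_rw [e]
    rw [integral_sub_right_eq_self
      (fun v => (fun w => k w * (f (z + δ * w) - f z)) (v / δ)) z,
      Measure.integral_comp_div (fun w => k w * (f (z + δ * w) - f z)) δ,
      abs_of_pos hδ, smul_eq_mul]
  rw [h1, inv_mul_cancel_left₀ hδ.ne']
  simp_rw [mul_sub]
  rw [integral_sub (integrable_kernel_mul_comp hk hf hM z δ) (hk.integrable.mul_const _),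
    integral_mul_const, hk.integral_eq_one, one_mul]

lemma abs_integral_kernel_mul_le (hk : IsKernel k) (hM : ∀ u, |f u| ≤ M)
    (y b : ℝ) : |∫ w, k w * f (y + b * w)| ≤ l1Norm k * M := by
  rw [l1Norm, ← integral_mul_const, ← Real.norm_eq_abs]
  refine norm_integral_le_of_norm_le (hk.integrable.abs.mul_const M)
    (Filter.Eventually.of_forall fun w => ?_)
  rw [Real.norm_eq_abs, abs_mul]
  exact mul_le_mul_of_nonneg_left (hM _) (abs_nonneg _)

lemma abs_approx_le (hk : IsKernel k) (hf : Measurable f) (hM : ∀ u, |f u| ≤ M) {δ : ℝ}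
    (hδ : 0 < δ) (z : ℝ) :
    |δ⁻¹ * ∫ u, k ((u - z) / δ) * (f u - f z)| ≤ 2 * M * l1Norm k := by
  rw [inv_mul_integral_eq hk hf hM hδ]
  have h1 := abs_integral_kernel_mul_le hk hM z δ
  have h2 := hM z
  have h3 : M ≤ l1Norm k * M :=
    le_mul_of_one_le_left ((abs_nonneg _).trans h2) hk.one_le_l1Norm
  refine (abs_sub _ _).trans ?_
  linarith

lemma bddAbove_approx (hk : IsKernel k) (hf : Measurable f) (hM : ∀ u, |f u| ≤ M) (h z : ℝ) :
    BddAbove (range fun δ : Ioc (0 : ℝ) h =>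
      |(δ : ℝ)⁻¹ * ∫ u, k ((u - z) / δ) * (f u - f z)|) :=
  ⟨2 * M * l1Norm k, by rintro _ ⟨δ, rfl⟩; exact abs_approx_le hk hf hM δ.2.1 z⟩

lemma approxError_nonneg (k f : ℝ → ℝ) (h z : ℝ) : 0 ≤ approxError k f h z :=
  Real.iSup_nonneg fun _ => abs_nonneg _

lemma approxError_le (hk : IsKernel k) (hf : Measurable f) (hM : ∀ u, |f u| ≤ M) (h z : ℝ) :
    approxError k f h z ≤ 2 * M * l1Norm k := by
  have hM0 := (abs_nonneg _).trans (hM 0)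
  exact Real.iSup_le (fun δ => abs_approx_le hk hf hM δ.2.1 z)
    (mul_nonneg (by linarith) (zero_le_one.trans hk.one_le_l1Norm))

lemma abs_integral_sub_le_approxError (hk : IsKernel k) (hf : Measurable f)
    (hM : ∀ u, |f u| ≤ M) {α h : ℝ} (hα : |α| ≤ h) (z : ℝ) :
    |(∫ w, k w * f (z + α * w)) - f z| ≤ approxError k f h z := by
  rcases eq_or_ne α 0 with rfl | h0
  · simp [integral_mul_const, hk.integral_eq_one, approxError_nonneg]
  have key : ∀ δ : ℝ, 0 < δ → δ ≤ h →
      |(∫ w, k w * f (z + δ * w)) - f z| ≤ approxError k f h z := fun δ h1 h2 => by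
    rw [← inv_mul_integral_eq hk hf hM h1]
    exact le_ciSup (bddAbove_approx hk hf hM h z) ⟨δ, h1, h2⟩
  rcases lt_or_gt_of_ne h0 with hneg | hpos
  · have e : ∫ w, k w * f (z + α * w) = ∫ w, k w * f (z + -α * w) := by
      rw [← integral_neg_eq_self]
      simp only [hk.symmetric, mul_neg, neg_mul]
    rw [e]
    exact key _ (by linarith) (by rwa [abs_of_neg hneg] at hα)
  · exact key α hpos (by rwa [abs_of_pos hpos] at hα)

lemma approxError_mono (hk : IsKernel k) (hf : Measurable f) (hM : ∀ u, |f u| ≤ M) {h h' : ℝ}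
    (hh : h ≤ h') (z : ℝ) : approxError k f h z ≤ approxError k f h' z :=
  Real.iSup_le (fun δ => le_ciSup (bddAbove_approx hk hf hM h' z) ⟨δ, δ.2.1, δ.2.2.trans hh⟩)
    (approxError_nonneg _ _ _ _)

/-- The supremum over the uncountable set of bandwidths is one over a countable dense set. -/
lemma measurable_approxError (hk : IsKernel k) (hf : Measurable f) (hM : ∀ u, |f u| ≤ M) (h : ℝ) :
    Measurable (approxError k f h) := by
  rcases le_or_gt h 0 with hh | hh
  · have : IsEmpty (Ioc (0 : ℝ) h) := by rw [Ioc_eq_empty (not_lt.2 hh)]; infer_instance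
    have : approxError k f h = fun _ => 0 := funext fun z => Real.iSup_of_isEmpty _
    rw [this]; exact measurable_const
  have : Nonempty (Ioc (0 : ℝ) h) := ⟨⟨h, hh, le_rfl⟩⟩
  set u := TopologicalSpace.denseSeq (Ioc (0 : ℝ) h) with hu
  obtain ⟨R, hR1, hR⟩ := hk.exists_radius
  have hcont : ∀ z, Continuous fun δ : Ioc (0 : ℝ) h =>
      |(δ : ℝ)⁻¹ * ∫ u, k ((u - z) / δ) * (f u - f z)| := fun z => by
    refine Continuous.abs (Continuous.mul
      (Continuous.inv₀ continuous_subtype_val fun δ => δ.2.1.ne') ?_)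
    refine continuous_of_dominated (bound := (Icc (z - h * R) (z + h * R)).indicator
      fun _ => supNorm k * (2 * M)) (fun δ => ?_) (fun δ => ?_) ?_ ?_
    · exact ((hk.continuous.measurable.comp (by fun_prop)).mul (by fun_prop)).aestronglyMeasurable
    · refine Filter.Eventually.of_forall fun v => ?_
      have hM' : |f v - f z| ≤ 2 * M := (abs_sub _ _).trans (by linarith [hM v, hM z])
      by_cases hv : v ∈ Icc (z - h * R) (z + h * R)
      · rw [indicator_of_mem hv, Real.norm_eq_abs, abs_mul]
        exact mul_le_mul (hk.abs_le _) hM' (abs_nonneg _) hk.supNorm_pos.le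
      · rw [indicator_of_notMem hv, hR, zero_mul, norm_zero]
        rw [abs_div, abs_of_pos δ.2.1, lt_div_iff₀ δ.2.1]
        have h1 : h * R < |v - z| := by
          by_contra! hc
          exact hv ⟨by linarith [(abs_le.1 hc).1], by linarith [(abs_le.1 hc).2]⟩
        have h2 : (δ : ℝ) * R ≤ h * R := mul_le_mul_of_nonneg_right δ.2.2 (by linarith)
        linarith
    · exact (integrable_indicator_iff measurableSet_Icc).2
        (integrableOn_const isCompact_Icc.measure_lt_top.ne)
    · refine Filter.Eventually.of_forall fun v => ?_
      exact (hk.continuous.comp (continuous_const.div continuous_subtype_val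
        fun δ => δ.2.1.ne')).mul continuous_const
  have e : approxError k f h = fun z => ⨆ n : ℕ,
      |(u n : ℝ)⁻¹ * ∫ v, k ((v - z) / u n) * (f v - f z)| := by
    funext z
    have hb := bddAbove_approx hk hf hM h z
    have hb' : BddAbove (range fun n : ℕ =>
        |(u n : ℝ)⁻¹ * ∫ v, k ((v - z) / u n) * (f v - f z)|) :=
      hb.mono (by rintro _ ⟨n, rfl⟩; exact ⟨u n, rfl⟩)
    refine le_antisymm (ciSup_le fun δ => ?_) (ciSup_le fun n => le_ciSup hb (u n))
    refine (TopologicalSpace.denseRange_denseSeq (Ioc (0 : ℝ) h)).induction_on δ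
      (isClosed_le (hcont z) continuous_const) fun n => le_ciSup hb' n
  rw [e]
  refine Measurable.iSup fun n => ?_
  simp_rw [inv_mul_integral_eq hk hf hM (u n).2.1]
  have h1 : StronglyMeasurable fun z : ℝ => ∫ w, k w * f (z + (u n : ℝ) * w) := by
    refine StronglyMeasurable.integral_prod_right'
      (f := fun p : ℝ × ℝ => k p.2 * f (p.1 + (u n : ℝ) * p.2)) ?_
    have := hk.continuous.measurable
    exact Measurable.stronglyMeasurable (by fun_prop)
  exact continuous_abs.measurable.comp (h1.measurable.sub hf)

lemma locallyIntegrable_approxError (hk : IsKernel k) (hf : Measurable f) (hM : ∀ u, |f u| ≤ M)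
    (h : ℝ) : LocallyIntegrable (approxError k f h) := by
  refine (locallyIntegrable_const (2 * M * l1Norm k)).mono
    (measurable_approxError hk hf hM h).aestronglyMeasurable
    (Filter.Eventually.of_forall fun z => ?_)
  rw [Real.norm_of_nonneg (approxError_nonneg _ _ _ _)]
  exact (approxError_le hk hf hM h z).trans (le_abs_self _)

lemma intervalIntegrable_approxError (hk : IsKernel k) (hf : Measurable f)
    (hM : ∀ u, |f u| ≤ M) (h a b : ℝ) :
    IntervalIntegrable (approxError k f h) volume a b :=
  ((locallyIntegrable_approxError hk hf hM h).integrableOn_isCompact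
    isCompact_uIcc).intervalIntegrable

lemma mean_approxError_le (hk : IsKernel k) (hf : Measurable f)
    (hM : ∀ u, |f u| ≤ M) (h y : ℝ) {a : ℝ} (ha : 0 < a) :
    (2 * a)⁻¹ * ∫ z in (y - a)..(y + a), approxError k f h z ≤ 2 * M * l1Norm k := by
  rw [inv_mul_le_iff₀ (by positivity)]
  have := intervalIntegral.integral_mono_on (show y - a ≤ y + a by linarith)
    (intervalIntegrable_approxError hk hf hM h _ _)
    (intervalIntegrable_const (c := 2 * M * l1Norm k))
    fun z _ => approxError_le hk hf hM h z
  rw [intervalIntegral.integral_const, smul_eq_mul] at this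
  linarith

lemma bddAbove_mean_approxError (hk : IsKernel k) (hf : Measurable f)
    (hM : ∀ u, |f u| ≤ M) (h y : ℝ) : BddAbove (range fun a : Ioi (0 : ℝ) =>
      (2 * (a : ℝ))⁻¹ * ∫ z in (y - a)..(y + a), approxError k f h z) :=
  ⟨2 * M * l1Norm k, by rintro _ ⟨a, rfl⟩; exact mean_approxError_le hk hf hM h y a.2⟩

lemma starApproxError_nonneg (k f : ℝ → ℝ) (h y : ℝ) : 0 ≤ starApproxError k f h y :=
  (approxError_nonneg k f h y).trans (le_max_right _ _)

lemma starApproxError_le (hk : IsKernel k) (hf : Measurable f)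
    (hM : ∀ u, |f u| ≤ M) (h y : ℝ) : starApproxError k f h y ≤ 2 * M * l1Norm k :=
  max_le (ciSup_le fun a => mean_approxError_le hk hf hM h y a.2) (approxError_le hk hf hM h y)

lemma starApproxError_mono (hk : IsKernel k) (hf : Measurable f)
    (hM : ∀ u, |f u| ≤ M) {h h' : ℝ} (hh : h ≤ h') (y : ℝ) :
    starApproxError k f h y ≤ starApproxError k f h' y := by
  refine max_le_max (ciSup_mono (bddAbove_mean_approxError hk hf hM h' y) fun a => ?_)
    (approxError_mono hk hf hM hh y)
  have ha : 0 < (a : ℝ) := a.2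
  refine mul_le_mul_of_nonneg_left ?_ (by positivity)
  exact intervalIntegral.integral_mono_on (by linarith)
    (intervalIntegrable_approxError hk hf hM h _ _)
    (intervalIntegrable_approxError hk hf hM h' _ _) fun z _ => approxError_mono hk hf hM hh z

/-- For `b ≠ 0` the average is one over an interval around `y`, which the maximal function bounds; for
`b = 0` the value of the approximation error at `y` itself is needed. -/
lemma integral_abs_kernel_mul_approxError_le (hk : IsKernel k) (hf : Measurable f)
    (hM : ∀ u, |f u| ≤ M) {R : ℝ} (hR1 : 1 ≤ R) (hR : ∀ u, R < |u| → k u = 0) (h y b : ℝ) :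
    ∫ w, |k w| * approxError k f h (y + b * w) ≤ 2 * R * supNorm k * starApproxError k f h y := by
  have hS := hk.supNorm_pos
  rcases eq_or_ne b 0 with rfl | hb
  · simp only [zero_mul, add_zero, integral_mul_const]
    exact mul_le_mul (hk.l1Norm_le (by linarith) hR) (le_max_right _ _) (approxError_nonneg _ _ _ _)
      (by positivity)
  have hb' : 0 < |b| * R := mul_pos (abs_pos.2 hb) (by linarith)
  have hli : LocallyIntegrable fun w => approxError k f h (y + b * w) := by
    refine (locallyIntegrable_const (2 * M * l1Norm k)).mono
      ((measurable_approxError hk hf hM h).comp (by fun_prop)).aestronglyMeasurable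
      (Filter.Eventually.of_forall fun z => ?_)
    rw [Real.norm_of_nonneg (approxError_nonneg _ _ _ _)]
    exact (approxError_le hk hf hM h _).trans (le_abs_self _)
  refine (hk.integral_abs_mul_le (by linarith) hR (fun w => approxError_nonneg _ _ _ _)
    hli).trans ?_
  rw [intervalIntegral.integral_comp_add_mul (fun z => approxError k f h z) hb, smul_eq_mul]
  have e : b⁻¹ * ∫ z in (y + b * -R)..(y + b * R), approxError k f h z =
      |b|⁻¹ * ∫ z in (y - |b| * R)..(y + |b| * R), approxError k f h z := by
    rcases lt_or_gt_of_ne hb with hneg | hpos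
    · rw [abs_of_neg hneg, intervalIntegral.integral_symm]
      rw [show y + b * R = y - -b * R by ring, show y + b * -R = y + -b * R by ring, inv_neg]
      ring
    · rw [abs_of_pos hpos, show y + b * -R = y - b * R by ring]
  rw [e]
  have h1 : (2 * (|b| * R))⁻¹ * ∫ z in (y - |b| * R)..(y + |b| * R), approxError k f h z ≤
      starApproxError k f h y :=
    (le_ciSup (bddAbove_mean_approxError hk hf hM h y) ⟨|b| * R, hb'⟩).trans (le_max_left _ _)
  have h2 : |b|⁻¹ * ∫ z in (y - |b| * R)..(y + |b| * R), approxError k f h z =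
      2 * R * ((2 * (|b| * R))⁻¹ * ∫ z in (y - |b| * R)..(y + |b| * R), approxError k f h z) := by
    have := abs_pos.2 hb
    field_simp
  rw [h2]
  have := mul_le_mul_of_nonneg_left h1 (show 0 ≤ 2 * R * supNorm k by positivity)
  linarith

/-- Averaging over the direction orthogonal to the window costs nothing: up to `Δ*`, the mean of a
kernel estimator does not depend on its bandwidth, only on `β`. -/
lemma abs_integral_integral_sub_le (hk : IsKernel k) (hf : Measurable f)
    (hM : ∀ u, |f u| ≤ M) {R : ℝ} (hR1 : 1 ≤ R) (hR : ∀ u, R < |u| → k u = 0) {α h : ℝ}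
    (hα : |α| ≤ h) (y β : ℝ) :
    |(∫ b, k b * ∫ a, k a * f (y + α * a + β * b)) - ∫ b, k b * f (y + β * b)| ≤
      2 * R * supNorm k * starApproxError k f h y := by
  have h1 : ∀ b, ∫ a, k a * f (y + α * a + β * b) = ∫ a, k a * f (y + β * b + α * a) := fun b => by
    congr 1; ext a; ring_nf
  simp_rw [h1]
  have hsm : StronglyMeasurable fun b : ℝ => ∫ a, k a * f (y + β * b + α * a) := by
    refine StronglyMeasurable.integral_prod_right'
      (f := fun p : ℝ × ℝ => k p.2 * f (y + β * p.1 + α * p.2)) ?_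
    have := hk.continuous.measurable
    exact Measurable.stronglyMeasurable (by fun_prop)
  have hi1 : Integrable fun b => k b * ∫ a, k a * f (y + β * b + α * a) := by
    have := hk.integrable.bdd_mul (f := fun b => ∫ a, k a * f (y + β * b + α * a))
      (c := l1Norm k * M) hsm.aestronglyMeasurable
      (Filter.Eventually.of_forall fun b => abs_integral_kernel_mul_le hk hM _ _)
    exact this.congr (Filter.Eventually.of_forall fun p => mul_comm _ _)
  rw [← integral_sub hi1 (integrable_kernel_mul_comp hk hf hM y β)]
  refine le_trans ?_ (integral_abs_kernel_mul_approxError_le hk hf hM hR1 hR h y β)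
  rw [← Real.norm_eq_abs]
  refine norm_integral_le_of_norm_le ?_ (Filter.Eventually.of_forall fun b => ?_)
  · have := hk.integrable.abs.bdd_mul (f := fun b => approxError k f h (y + β * b))
      (c := 2 * M * l1Norm k)
      ((measurable_approxError hk hf hM h).comp (by fun_prop)).aestronglyMeasurable
      (Filter.Eventually.of_forall fun b => by
        rw [Real.norm_of_nonneg (approxError_nonneg _ _ _ _)]
        exact approxError_le hk hf hM h _)
    exact this.congr (Filter.Eventually.of_forall fun p => mul_comm _ _)
  · rw [← mul_sub, Real.norm_eq_abs, abs_mul]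
    exact mul_le_mul_of_nonneg_left (abs_integral_sub_le_approxError hk hf hM hα _) (abs_nonneg _)

lemma exists_grid_mem {ε u : ℝ} (hu0 : 0 < u) (hu1 : u ≤ 1) (hεu : 2 * ε ^ 2 ≤ u) :
    ∃ h ∈ grid ε, u / 2 ≤ h ∧ h ≤ u := by
  obtain ⟨n, h1, h2⟩ := exists_nat_pow_near_of_lt_one hu0 hu1 (y := (2⁻¹ : ℝ)) (by norm_num)
    (by norm_num)
  have h3 : u / 2 ≤ 2⁻¹ ^ (n + 1) := by rw [pow_succ]; linarith
  exact ⟨2⁻¹ ^ (n + 1), ⟨⟨n + 1, rfl⟩, by linarith, h1.le.trans hu1⟩, h3, h1.le⟩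

/-- The oracle bandwidth, up to a factor `8`, is attained by a bandwidth in the grid. -/
lemma exists_oracle_grid (hk : IsKernel k) (hf : Measurable f)
    (hM : ∀ u, |f u| ≤ M) {ε : ℝ} (hε : 0 < ε) (hε2 : 2 * ε ^ 2 ≤ 1)
    (hML : 2 * M * l1Norm k ≤ supNorm k * √(Real.log (1 / ε))) (y : ℝ) :
    ε ^ 2 ≤ oracleBandwidth k f ε y ∧
    ∃ h ∈ grid ε, oracleBandwidth k f ε y / 8 ≤ h ∧ ∀ η, 0 < η → η ≤ h →
      √η * starApproxError k f (2 * η) y ≤ 2 * supNorm k * ε * √(Real.log (1 / ε)) := by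
  set s := {h | h ∈ Icc (ε ^ 2) 1 ∧
    √h * starApproxError k f h y ≤ supNorm k * ε * √(Real.log (1 / ε))} with hs
  have hstar : ∀ h, starApproxError k f h y ≤ supNorm k * √(Real.log (1 / ε)) := fun h =>
    (starApproxError_le hk hf hM h y).trans hML
  have hmem : ε ^ 2 ∈ s := by
    refine ⟨⟨le_rfl, by nlinarith⟩, ?_⟩
    rw [Real.sqrt_sq hε.le]
    have := mul_le_mul_of_nonneg_left (hstar (ε ^ 2)) hε.le
    linarith
  have hbdd : BddAbove s := ⟨1, fun h hh => hh.1.2⟩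
  have hle : ε ^ 2 ≤ oracleBandwidth k f ε y := le_csSup hbdd hmem
  refine ⟨hle, ?_⟩
  have hε2' : 0 < ε ^ 2 := by positivity
  obtain ⟨h', hh', hlt⟩ := exists_lt_of_lt_csSup ⟨_, hmem⟩
    (show oracleBandwidth k f ε y / 2 < sSup s by
      change _ < oracleBandwidth k f ε y; linarith)
  have hmono : ∀ h η, 0 < η → η ≤ h → √η * starApproxError k f (2 * η) y ≤
      √h * starApproxError k f (2 * h) y := fun h η _ hη =>
    mul_le_mul (Real.sqrt_le_sqrt hη) (starApproxError_mono hk hf hM (by linarith) y)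
      (starApproxError_nonneg _ _ _ _) (Real.sqrt_nonneg _)
  have hpos : 0 ≤ supNorm k * ε * √(Real.log (1 / ε)) := by
    have := hk.supNorm_pos; positivity
  -- for `h'` of the order `ε²` the smallest bandwidth of the grid works, as `f` is bounded
  rcases le_or_gt (4 * ε ^ 2) h' with hc | hc
  · obtain ⟨h, hg, h1, h2⟩ := exists_grid_mem (ε := ε) (u := h' / 2) (by linarith)
      (by linarith [hh'.1.2]) (by linarith)
    refine ⟨h, hg, by linarith, fun η hη hηh => (hmono h η hη hηh).trans ?_⟩
    have h3 : √h * starApproxError k f (2 * h) y ≤ √h' * starApproxError k f h' y :=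
      mul_le_mul (Real.sqrt_le_sqrt (by linarith))
        (starApproxError_mono hk hf hM (by linarith) y)
        (starApproxError_nonneg _ _ _ _) (Real.sqrt_nonneg _)
    linarith [hh'.2]
  · obtain ⟨h, hg, h1, h2⟩ := exists_grid_mem (ε := ε) (u := 2 * ε ^ 2) (by linarith) hε2 le_rfl
    refine ⟨h, hg, by linarith, fun η hη hηh => (hmono h η hη hηh).trans ?_⟩
    have h3 : √h ≤ 2 * ε := by
      rw [Real.sqrt_le_left (by linarith)]; nlinarith
    have := mul_le_mul h3 (hstar (2 * h)) (starApproxError_nonneg _ _ _ _) (by linarith)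
    linarith

end SingleIndex

/-! ### The selection rule for one realization -/

namespace SingleIndex

lemma pairMatrixAux_eq (θ ν : Plane) (h : ℝ) :
    pairMatrixAux θ ν h = indexMatrix ((2 * (1 + |ν ⬝ᵥ θ|))⁻¹ • (θ + ν)) h := by
  have h1 : 0 < 1 + |ν ⬝ᵥ θ| := by positivity
  ext i j
  fin_cases i <;> fin_cases j <;> simp [pairMatrixAux, indexMatrix, div_eq_mul_inv] <;> ring

lemma dotProduct_eq (x y : Plane) : x ⬝ᵥ y = x 0 * y 0 + x 1 * y 1 := by
  simp [dotProduct, Fin.sum_univ_two]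

lemma neg_mem_unitCircle {θ : Plane} (hθ : θ ∈ unitCircle) : -θ ∈ unitCircle := by
  simpa [unitCircle] using hθ

lemma abs_dotProduct_le_one {θ ν : Plane} (hθ : θ ∈ unitCircle) (hν : ν ∈ unitCircle) :
    |ν ⬝ᵥ θ| ≤ 1 := by
  simp only [unitCircle, mem_ofPred_eq] at hθ hν
  rw [dotProduct_eq, abs_le]
  constructor
  · nlinarith [sq_nonneg (ν 0 + θ 0), sq_nonneg (ν 1 + θ 1)]
  · nlinarith [sq_nonneg (ν 0 - θ 0), sq_nonneg (ν 1 - θ 1)]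

lemma det_pairMatrixAux {θ ν : Plane} (hθ : θ ∈ unitCircle) (hν : ν ∈ unitCircle)
    (hθν : 0 ≤ ν ⬝ᵥ θ) (h : ℝ) : (pairMatrixAux θ ν h).det = h⁻¹ * (2 * (1 + ν ⬝ᵥ θ))⁻¹ := by
  have h1 : 0 < 1 + ν ⬝ᵥ θ := by positivity
  rw [pairMatrixAux_eq, det_indexMatrix, abs_of_nonneg hθν]
  simp only [unitCircle, mem_ofPred_eq] at hθ hν
  have h2 : (θ 0 + ν 0) ^ 2 + (θ 1 + ν 1) ^ 2 = 2 * (1 + ν ⬝ᵥ θ) := by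
    rw [dotProduct_eq]; linear_combination hθ + hν
  simp only [Pi.smul_apply, Pi.add_apply, smul_eq_mul, mul_pow]
  rw [← mul_add, h2]
  field_simp

/-- Exchanging the two indices changes the matrix at most by a sign, which an even kernel does not
see. -/
lemma pairMatrix_comm_or (θ ν : Plane) (h : ℝ) :
    pairMatrix θ ν h = pairMatrix ν θ h ∨ pairMatrix θ ν h = -pairMatrix ν θ h := by
  have hc : θ ⬝ᵥ ν = ν ⬝ᵥ θ := dotProduct_comm _ _
  by_cases h0 : 0 ≤ ν ⬝ᵥ θ
  · left
    rw [pairMatrix, pairMatrix, if_pos h0, if_pos (hc ▸ h0), pairMatrixAux_eq, pairMatrixAux_eq,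
      hc, add_comm θ ν]
  · right
    rw [pairMatrix, pairMatrix, if_neg h0, if_neg (hc ▸ h0)]
    ext i j
    fin_cases i <;> fin_cases j <;> simp [pairMatrixAux, hc] <;> ring

lemma det_pairMatrix_pos {θ ν : Plane} (hθ : θ ∈ unitCircle) (hν : ν ∈ unitCircle) {h : ℝ}
    (hh : 0 < h) : 0 < (pairMatrix θ ν h).det := by
  rw [pairMatrix]
  split_ifs with h0
  · rw [det_pairMatrixAux hθ hν h0]; positivity
  · have h1 : 0 ≤ ν ⬝ᵥ -θ := by rw [dotProduct_neg]; linarith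
    rw [det_pairMatrixAux (neg_mem_unitCircle hθ) hν h1]; positivity

lemma det_indexMatrix_pos {θ : Plane} (hθ : θ ∈ unitCircle) {h : ℝ} (hh : 0 < h) :
    0 < (indexMatrix θ h).det := by
  rw [det_indexMatrix, show θ 0 ^ 2 + θ 1 ^ 2 = 1 from hθ]; positivity

lemma continuous_indexMatrix (h : ℝ) : Continuous fun σ : Plane => indexMatrix σ h := by
  refine continuous_matrix fun i j => ?_
  fin_cases i <;> fin_cases j <;> simp [indexMatrix] <;> fun_prop

lemma isCompact_unitCircle : IsCompact unitCircle := by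
  refine Metric.isCompact_of_isClosed_isBounded ?_ ?_
  · exact isClosed_eq (by fun_prop) continuous_const
  · refine (Metric.isBounded_closedBall (x := (0 : Plane)) (r := 1)).subset fun θ hθ => ?_
    rw [mem_closedBall_zero_iff, pi_norm_le_iff_of_nonneg zero_le_one]
    exact abs_apply_le_one (le_of_eq hθ)

lemma finite_grid {ε : ℝ} (hε : 0 < ε) : (grid ε).Finite := by
  obtain ⟨N, hN⟩ := exists_pow_lt_of_lt_one (show 0 < ε ^ 2 by positivity)
    (show (2⁻¹ : ℝ) < 1 by norm_num)
  refine ((Finset.range N).finite_toSet.image fun n : ℕ => (2⁻¹ : ℝ) ^ n).subset ?_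
  rintro h ⟨⟨n, rfl⟩, hn, _⟩
  refine ⟨n, ?_, rfl⟩
  simp only [Finset.coe_range, mem_Iio]
  by_contra! hc
  exact absurd (pow_le_pow_of_le_one (by norm_num) (by norm_num) hc : (2⁻¹ : ℝ) ^ n ≤ 2⁻¹ ^ N)
    (by linarith)

lemma grid_pos {ε h : ℝ} (hε : 0 < ε) (hh : h ∈ grid ε) : 0 < h :=
  lt_of_lt_of_le (by positivity) hh.2.1

lemma threshold_eq (C ε η : ℝ) : threshold C ε η = C * threshold 1 ε η := by
  simp [threshold]; ring

lemma threshold_nonneg {C ε : ℝ} (hC : 0 ≤ C) (hε : 0 < ε) (η : ℝ) : 0 ≤ threshold C ε η := by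
  unfold threshold; positivity

lemma threshold_anti {C ε η η' : ℝ} (hC : 0 ≤ C) (hε : 0 < ε) (hε1 : ε ≤ 1) (hη : 0 < η)
    (h : η ≤ η') : threshold C ε η' ≤ threshold C ε η := by
  have : 0 ≤ Real.log (1 / ε) := Real.log_nonneg (by rw [le_div_iff₀ hε]; linarith)
  unfold threshold
  gcongr

section Selection

variable {C ε : ℝ} {j : Matrix (Fin 2) (Fin 2) ℝ → Plane → ℝ} {x : Plane}

/-- The supremum over `ν` in the selection rule is finite. The path `ν ↦ pairMatrix θ ν η` jumps where
`ν ⬝ᵥ θ` changes sign, but it is continuous on each of the two closed half circles. -/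
lemma bddAbove_range_estimator_sub
    (hj : ContinuousOn (fun p : Matrix (Fin 2) (Fin 2) ℝ × Plane => j p.1 p.2) {p | p.1.det ≠ 0})
    {θ : Plane} (hθ : θ ∈ unitCircle) {η : ℝ} (hη : 0 < η) :
    BddAbove (range fun ν : unitCircle =>
      |estimator j (pairMatrix θ ν η) x - estimator j (indexMatrix ν η) x|) := by
  have hest : ∀ (s : Set Plane) (σ : Plane → Plane), Continuous σ →
      (∀ ν ∈ s, (indexMatrix (σ ν) η).det ≠ 0) →
      ContinuousOn (fun ν => estimator j (indexMatrix (σ ν) η) x) s := fun s σ hσ hs => by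
    have hc : Continuous fun ν => indexMatrix (σ ν) η := (continuous_indexMatrix η).comp hσ
    refine ContinuousOn.mul (Continuous.matrix_det hc).continuousOn ?_
    exact hj.comp (Continuous.prodMk hc continuous_const).continuousOn fun ν hν => hs ν hν
  have hhalf : ∀ θ ∈ unitCircle, BddAbove
      ((fun ν => |estimator j (pairMatrixAux θ ν η) x - estimator j (indexMatrix ν η) x|) ''
        (unitCircle ∩ {ν | 0 ≤ ν ⬝ᵥ θ})) := fun θ hθ => by
    have hcpt : IsCompact (unitCircle ∩ {ν | 0 ≤ ν ⬝ᵥ θ}) :=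
      isCompact_unitCircle.inter_right (isClosed_le continuous_const (by
        simp only [dotProduct_eq]; fun_prop))
    refine hcpt.bddAbove_image (ContinuousOn.abs (ContinuousOn.sub ?_ ?_))
    · simp_rw [pairMatrixAux_eq]
      refine hest _ (fun ν => (2 * (1 + |ν ⬝ᵥ θ|))⁻¹ • (θ + ν)) ?_ fun ν hν => ?_
      · simp only [dotProduct_eq]
        have h1 : Continuous fun ν : Plane => 2 * (1 + |ν 0 * θ 0 + ν 1 * θ 1|) := by fun_prop
        exact (h1.inv₀ fun ν => by positivity).smul (continuous_const.add continuous_id)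
      · rw [← pairMatrixAux_eq, det_pairMatrixAux hθ hν.1 hν.2]
        have : 0 ≤ ν ⬝ᵥ θ := hν.2
        positivity
    · exact hest _ (fun ν => ν) continuous_id fun ν hν => (det_indexMatrix_pos hν.1 hη).ne'
  refine ((hhalf θ hθ).union (hhalf (-θ) (neg_mem_unitCircle hθ))).mono ?_
  rintro _ ⟨ν, rfl⟩
  by_cases h0 : 0 ≤ (ν : Plane) ⬝ᵥ θ
  · exact Or.inl ⟨ν, ⟨ν.2, h0⟩, by simp only [pairMatrix, if_pos h0]⟩
  · refine Or.inr ⟨ν, ⟨ν.2, ?_⟩, by simp only [pairMatrix, if_neg h0]⟩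
    simp only [mem_ofPred_eq, dotProduct_neg]; linarith

/-- The acceptance of a pair bounds each of the differences in `R`. -/
lemma abs_estimator_sub_le_of_rStat_nonpos (hε : 0 < ε)
    (hj : ContinuousOn (fun p : Matrix (Fin 2) (Fin 2) ℝ × Plane => j p.1 p.2) {p | p.1.det ≠ 0})
    {θ : Plane} (hθ : θ ∈ unitCircle) {h : ℝ} (hR : rStat C ε j x θ h ≤ 0) {η : ℝ}
    (hη : η ∈ grid ε) (hηh : η ≤ h) {ν : Plane} (hν : ν ∈ unitCircle) :
    |estimator j (pairMatrix θ ν η) x - estimator j (indexMatrix ν η) x| ≤ threshold C ε η := by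
  have hfin : Finite {η // η ∈ grid ε ∧ η ≤ h} :=
    ((finite_grid hε).subset fun η (hη : η ∈ grid ε ∧ η ≤ h) => hη.1).to_subtype
  have h1 := le_ciSup (Set.finite_range fun η : {η // η ∈ grid ε ∧ η ≤ h} =>
    ((⨆ ν : unitCircle, |estimator j (pairMatrix θ ν η) x - estimator j (indexMatrix ν η) x|) -
      threshold C ε η)).bddAbove ⟨η, hη, hηh⟩
  have h2 := le_ciSup (bddAbove_range_estimator_sub (x := x) hj hθ (grid_pos hε hη)) ⟨ν, hν⟩
  have h3 := h1.trans hR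
  simp only at h2 h3
  linarith

lemma rStat_nonpos (hC : 0 ≤ C) (hε : 0 < ε) {θ : Plane} {h : ℝ}
    (hb : ∀ η ∈ grid ε, η ≤ h → ∀ ν ∈ unitCircle,
      |estimator j (pairMatrix θ ν η) x - estimator j (indexMatrix ν η) x| ≤ threshold C ε η) :
    rStat C ε j x θ h ≤ 0 :=
  Real.iSup_nonpos fun η => sub_nonpos.2
    (Real.iSup_le (fun ν => hb η η.2.1 η.2.2 ν ν.2) (threshold_nonneg hC hε _))

lemma IsSelectedIndex.mem_unitCircle {θ : Plane} (hsel : IsSelectedIndex C ε j x θ) :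
    θ ∈ unitCircle := by
  by_cases h : (accepted C ε j x).Nonempty
  · exact (hsel.1 h).1
  · rw [hsel.2 h]; simp [unitCircle]

lemma hHat_mem (hC : 0 ≤ C) (hε : 0 < ε) (hε1 : ε ≤ 1) (θ : Plane) :
    hHat C ε j x θ ∈ {h | h ∈ grid ε ∧ ∀ η ∈ grid ε, η ≤ h →
      |estimator j (indexMatrix θ h) x - estimator j (indexMatrix θ η) x| ≤ threshold C ε η} := by
  refine Set.Nonempty.csSup_mem ?_ ((finite_grid hε).subset fun h hh => hh.1)
  have hne : (grid ε).Nonempty := ⟨1, ⟨0, by simp⟩, by nlinarith, le_rfl⟩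
  obtain ⟨h, hh, hmin⟩ := (finite_grid hε).exists_minimal hne
  refine ⟨h, hh, fun η hη hηh => ?_⟩
  rw [le_antisymm hηh (hmin hη hηh)]
  simpa using threshold_nonneg hC hε _

/-- The oracle inequality for one realization: if up to the bandwidth `h₀` all estimators with
window orthogonal to `ν` are close to a centre `m ν`, so is the selected one to `m θ₀`. -/
lemma abs_finalEstimator_sub_le (hε : 0 < ε) (hε1 : ε ≤ 1)
    (hj : ContinuousOn (fun p : Matrix (Fin 2) (Fin 2) ℝ × Plane => j p.1 p.2) {p | p.1.det ≠ 0})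
    (hsymm : ∀ A : Matrix (Fin 2) (Fin 2) ℝ, A.det ≠ 0 → j (-A) x = j A x)
    {θ₀ θ : Plane} (hθ₀ : θ₀ ∈ unitCircle) (m : Plane → ℝ) {τ h₀ : ℝ} (hτ : 0 ≤ τ)
    (hτC : 2 * τ ≤ C) (hh₀ : h₀ ∈ grid ε)
    (hidx : ∀ ν ∈ unitCircle, ∀ η ∈ grid ε, η ≤ h₀ →
      |estimator j (indexMatrix ν η) x - m ν| ≤ threshold τ ε η)
    (hpair : ∀ ν ∈ unitCircle, ∀ η ∈ grid ε, η ≤ h₀ →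
      |estimator j (pairMatrix θ₀ ν η) x - m ν| ≤ threshold τ ε η)
    (hsel : IsSelectedIndex C ε j x θ) :
    |finalEstimator C ε j x θ - m θ₀| ≤ 4 * C * threshold 1 ε h₀ := by
  have hC : 0 ≤ C := by linarith
  have hτC' : ∀ η, 2 * threshold τ ε η ≤ threshold C ε η := fun η => by
    rw [threshold_eq τ, threshold_eq C]
    have := threshold_nonneg zero_le_one hε η
    nlinarith
  have htri : ∀ a b c t : ℝ, |a - c| ≤ t → |b - c| ≤ t → |a - b| ≤ 2 * t := fun a b c t h1 h2 => by
    rw [abs_le] at *; constructor <;> linarith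
  have hacc : (θ₀, h₀) ∈ accepted C ε j x := by
    refine ⟨hθ₀, hh₀, rStat_nonpos hC hε fun η hη hηh ν hν => ?_⟩
    exact (htri _ _ _ _ (hpair ν hν η hη hηh) (hidx ν hν η hη hηh)).trans (hτC' η)
  obtain ⟨hθ, hg, hR⟩ := hsel.1 ⟨_, hacc⟩
  simp only at hθ hg hR
  have hle : h₀ ≤ hTilde C ε j x := by
    refine le_csSup (((finite_grid hε).subset ?_).bddAbove) ⟨_, hacc, rfl⟩
    rintro _ ⟨p, hp, rfl⟩
    exact hp.2.1
  have hhat := hHat_mem (j := j) (x := x) hC hε hε1 θ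
  have hhle : h₀ ≤ hHat C ε j x θ := by
    refine le_csSup ((finite_grid hε).subset fun h hh => hh.1).bddAbove
      ⟨hh₀, fun η hη hηh => ?_⟩
    refine (htri _ _ (m θ) (threshold τ ε η) ?_ (hidx θ hθ η hη hηh)).trans (hτC' η)
    exact (hidx θ hθ h₀ hh₀ le_rfl).trans (threshold_anti hτ hε hε1 (grid_pos hε hη) hηh)
  have e1 := hhat.2 h₀ hh₀ hhle
  have e2 : |estimator j (pairMatrix θ₀ θ h₀) x - estimator j (indexMatrix θ h₀) x| ≤
      threshold C ε h₀ :=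
    (htri _ _ _ _ (hpair θ hθ h₀ hh₀ le_rfl) (hidx θ hθ h₀ hh₀ le_rfl)).trans (hτC' h₀)
  have e3 := abs_estimator_sub_le_of_rStat_nonpos hε hj hθ hR hh₀ hle hθ₀
  have e4 : estimator j (pairMatrix θ θ₀ h₀) x = estimator j (pairMatrix θ₀ θ h₀) x := by
    rcases pairMatrix_comm_or θ θ₀ h₀ with h | h
    · rw [h]
    · rw [h, estimator, estimator, hsymm _ (det_pairMatrix_pos hθ₀ hθ (grid_pos hε hh₀)).ne',
        Matrix.det_neg]
      simp
  have e5 := hidx θ₀ hθ₀ h₀ hh₀ le_rfl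
  have e6 := hτC' h₀
  have e7 := threshold_nonneg hτ hε h₀
  rw [e4] at e3
  rw [show 4 * C * threshold 1 ε h₀ = 4 * threshold C ε h₀ by rw [threshold_eq C]; ring,
    finalEstimator]
  rw [abs_le] at *
  constructor <;> linarith

end Selection

end SingleIndex

/-! ### The stochastic errors along curves of matrices -/

namespace SingleIndex

section Noise

variable {k : ℝ → ℝ} {D : Set Plane} {F : Plane → ℝ} {ε : ℝ}

/-- The stochastic error of the kernel estimator at bandwidth `η`, in units of its standard
deviation up to a bounded factor: the estimator minus its mean, multiplied by `√η / ε`. -/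
noncomputable def noise (k : ℝ → ℝ) (D : Set Plane) (F : Plane → ℝ) (ε η : ℝ)
    (j : Matrix (Fin 2) (Fin 2) ℝ → Plane → ℝ) (A : Matrix (Fin 2) (Fin 2) ℝ) (x : Plane) : ℝ :=
  √η * ε⁻¹ * (A.det * (j A x - ∫ t in D, kernelAt k A x t * F t))

lemma continuous_setIntegral_kernelAt_mul (hk : IsKernel k) (hD : volume D ≠ ∞)
    (hF : Measurable F) {M : ℝ} (hM : ∀ t, |F t| ≤ M) :
    Continuous fun p : Matrix (Fin 2) (Fin 2) ℝ × Plane =>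
      ∫ t in D, kernelAt k p.1 p.2 t * F t := by
  have : IsFiniteMeasure (volume.restrict D) := ⟨by simpa using hD.lt_top⟩
  have : FirstCountableTopology (Matrix (Fin 2) (Fin 2) ℝ) :=
    inferInstanceAs (FirstCountableTopology (Fin 2 → Fin 2 → ℝ))
  refine continuous_of_dominated (bound := fun _ => supNorm k ^ 2 * M) (fun p => ?_) (fun p => ?_)
    (integrable_const _) ?_
  · have hc := (continuous_kernelAt hk).comp (Continuous.prodMk (continuous_const (y := p))
      continuous_id)
    exact (hc.measurable.mul hF).aestronglyMeasurable
  · refine Filter.Eventually.of_forall fun t => ?_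
    rw [Real.norm_eq_abs, abs_mul]
    exact mul_le_mul (abs_kernelAt_le hk _ _ _) (hM t) (abs_nonneg _) (by positivity)
  · refine Filter.Eventually.of_forall fun t => ?_
    have hc := (continuous_kernelAt hk).comp (Continuous.prodMk continuous_id
      (continuous_const (y := t)))
    exact hc.mul continuous_const

lemma continuousOn_noise (hk : IsKernel k) (hD : volume D ≠ ∞)
    (hF : Measurable F) {M : ℝ} (hM : ∀ t, |F t| ≤ M) (η : ℝ)
    {j : Matrix (Fin 2) (Fin 2) ℝ → Plane → ℝ}
    (hj : ContinuousOn (fun p : Matrix (Fin 2) (Fin 2) ℝ × Plane => j p.1 p.2)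
      {p | p.1.det ≠ 0}) :
    ContinuousOn (fun p : Matrix (Fin 2) (Fin 2) ℝ × Plane => noise k D F ε η j p.1 p.2)
      {p | p.1.det ≠ 0} := by
  unfold noise
  refine continuousOn_const.mul (ContinuousOn.mul ?_ (hj.sub
    (continuous_setIntegral_kernelAt_mul hk hD hF hM).continuousOn))
  exact (Continuous.matrix_det continuous_fst).continuousOn

variable {Ω : Type*} [MeasurableSpace Ω] {P : Measure Ω} {Y : (Plane → ℝ) → Ω → ℝ}
  {J : Ω → Matrix (Fin 2) (Fin 2) ℝ → Plane → ℝ}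

lemma measurable_noise (hk : IsKernel k) (hD : volume D ≠ ∞)
    (hF : Measurable F) {M : ℝ} (hM : ∀ t, |F t| ≤ M) (η : ℝ) (hJ : IsKernelIntegral k P Y J)
    {A : Matrix (Fin 2) (Fin 2) ℝ} (hA : A.det ≠ 0) :
    Measurable fun p : Plane × Ω => noise k D F ε η (J p.2) A p.1 := by
  refine measurable_uncurry_of_continuous_of_measurable
    (u := fun (x : Plane) ω => noise k D F ε η (J ω) A x) (fun ω => ?_) fun x => ?_
  · exact (continuousOn_noise hk hD hF hM η (hJ.continuousOn ω)).comp_continuous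
      (Continuous.prodMk (continuous_const (y := A)) continuous_id) fun x => hA
  · have := hJ.measurable A x
    unfold noise
    fun_prop

lemma IsKernelIntegral.noise_ae_eq {W : (Plane → ℝ) → Ω → ℝ} (hJ : IsKernelIntegral k P Y J)
    (hY : ∀ φ ω, Y φ ω = (∫ t in D, φ t * F t) + ε * W φ ω) (hε : 0 < ε) (η : ℝ)
    {A : Matrix (Fin 2) (Fin 2) ℝ} (hA : A.det ≠ 0) (x : Plane) :
    (fun ω => noise k D F ε η (J ω) A x) =ᵐ[P] fun ω => √η * A.det * W (kernelAt k A x) ω := by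
  filter_upwards [hJ.version A x hA] with ω hω
  rw [noise, hω, hY]
  field_simp
  ring

lemma IsKernelIntegral.lintegral_exp_noise_sub_le {W : (Plane → ℝ) → Ω → ℝ} (hk : IsKernel k)
    (hD : volume D ≠ ∞) (hJ : IsKernelIntegral k P Y J) (hW : IsWhiteNoise D P W)
    (hY : ∀ φ ω, Y φ ω = (∫ t in D, φ t * F t) + ε * W φ ω) (hε : 0 < ε) {η : ℝ} (hη : 0 < η)
    {A B : Matrix (Fin 2) (Fin 2) ℝ} (hA : A.det ≠ 0) (hB : B.det ≠ 0) (x : Plane) {b : ℝ}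
    (hb : b * (η * ∫ t in D, (A.det * kernelAt k A x t - B.det * kernelAt k B x t) ^ 2) ≤ 1 / 4) :
    ∫⁻ ω, ENNReal.ofReal (Real.exp (b *
      (noise k D F ε η (J ω) A x - noise k D F ε η (J ω) B x) ^ 2)) ∂P ≤ 2 := by
  have hae : (fun ω => ENNReal.ofReal (Real.exp (b *
      (noise k D F ε η (J ω) A x - noise k D F ε η (J ω) B x) ^ 2))) =ᵐ[P]
      fun ω => ENNReal.ofReal (Real.exp (b * (√η * A.det * W (kernelAt k A x) ω -
        √η * B.det * W (kernelAt k B x) ω) ^ 2)) := by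
    filter_upwards [hJ.noise_ae_eq hY hε η hA x, hJ.noise_ae_eq hY hε η hB x] with ω h1 h2
    rw [h1, h2]
  rw [lintegral_congr_ae hae]
  refine hW.lintegral_exp_sq_le (memLp_kernelAt hk A x hD) (memLp_kernelAt hk B x hD) _ _
    (le_trans (le_of_eq ?_) hb)
  congr 1
  rw [← integral_const_mul]
  refine integral_congr_ae (Filter.Eventually.of_forall fun t => ?_)
  simp only
  rw [show √η * A.det * kernelAt k A x t - √η * B.det * kernelAt k B x t =
    √η * (A.det * kernelAt k A x t - B.det * kernelAt k B x t) by ring, mul_pow,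
    Real.sq_sqrt hη.le]

lemma IsKernelIntegral.lintegral_exp_noise_le {W : (Plane → ℝ) → Ω → ℝ} (hk : IsKernel k)
    (hD : volume D ≠ ∞) (hJ : IsKernelIntegral k P Y J) (hW : IsWhiteNoise D P W)
    (hY : ∀ φ ω, Y φ ω = (∫ t in D, φ t * F t) + ε * W φ ω) (hε : 0 < ε) {η : ℝ} (hη : 0 < η)
    {A : Matrix (Fin 2) (Fin 2) ℝ} (hA : A.det ≠ 0) (x : Plane) {b : ℝ}
    (hb : b * (η * ∫ t in D, (A.det * kernelAt k A x t) ^ 2) ≤ 1 / 4) :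
    ∫⁻ ω, ENNReal.ofReal (Real.exp (b * noise k D F ε η (J ω) A x ^ 2)) ∂P ≤ 2 := by
  have hae : (fun ω => ENNReal.ofReal (Real.exp (b * noise k D F ε η (J ω) A x ^ 2))) =ᵐ[P]
      fun ω => ENNReal.ofReal (Real.exp (b * (√η * A.det * W (kernelAt k A x) ω -
        0 * W (kernelAt k A x) ω) ^ 2)) := by
    filter_upwards [hJ.noise_ae_eq hY hε η hA x] with ω h1
    rw [h1]; simp
  rw [lintegral_congr_ae hae]
  refine hW.lintegral_exp_sq_le (memLp_kernelAt hk A x hD) (memLp_kernelAt hk A x hD) _ _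
    (le_trans (le_of_eq ?_) hb)
  congr 1
  rw [← integral_const_mul]
  refine integral_congr_ae (Filter.Eventually.of_forall fun t => ?_)
  simp only
  rw [show √η * A.det * kernelAt k A x t - 0 * kernelAt k A x t =
    √η * (A.det * kernelAt k A x t) by ring, mul_pow, Real.sq_sqrt hη.le]

end Noise

section Curves

/-- The curves of vectors `σ` for which `indexMatrix σ η` is used: they are traversed with speed at
most `7` and stay in the annulus `1 / 2 ≤ |σ| ≤ 1`. -/
structure IsIndexCurve (γ : ℝ → Plane) : Prop where
  lower : ∀ t ∈ Icc (0 : ℝ) 1, 1 / 4 ≤ γ t 0 ^ 2 + γ t 1 ^ 2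
  upper : ∀ t ∈ Icc (0 : ℝ) 1, γ t 0 ^ 2 + γ t 1 ^ 2 ≤ 1
  lipschitz : ∀ s t i, |γ s i - γ t i| ≤ 7 * |s - t|

lemma IsIndexCurve.continuous {γ : ℝ → Plane} (hγ : IsIndexCurve γ) : Continuous γ := by
  refine continuous_pi fun i => ?_
  have : LipschitzWith 7 fun t => γ t i := LipschitzWith.of_dist_le_mul fun s t => by
    simpa [Real.dist_eq] using hγ.lipschitz s t i
  exact this.continuous

lemma IsIndexCurve.det_ne_zero {γ : ℝ → Plane} (hγ : IsIndexCurve γ) {t : ℝ}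
    (ht : t ∈ Icc (0 : ℝ) 1) {η : ℝ} (hη : 0 < η) : (indexMatrix (γ t) η).det ≠ 0 := by
  rw [det_indexMatrix]
  have := hγ.lower t ht
  positivity

/-- The three curves which cover the directions of all estimators compared with the index `θ`: the
unit circle, and for the two cases in the definition of `pairMatrix θ ν η` a tangent segment of the
circle of radius `1 / 2`. (The vector `(θ + ν) / |θ + ν|²` is the inversion of `θ + ν`, and the
inversion maps the circle around `θ` through the origin to a line.) -/
noncomputable def indexCurve (θ : Plane) : Fin 3 → ℝ → Plane :=
  ![fun t => ![Real.cos (2 * Real.pi * t - Real.pi), Real.sin (2 * Real.pi * t - Real.pi)],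
    fun t => ![(θ 0 - (2 * t - 1) * θ 1) / 2, (θ 1 + (2 * t - 1) * θ 0) / 2],
    fun t => ![(-θ 0 + (2 * t - 1) * θ 1) / 2, (-θ 1 - (2 * t - 1) * θ 0) / 2]]

lemma isIndexCurve_indexCurve {θ : Plane} (hθ : θ ∈ unitCircle) (c : Fin 3) :
    IsIndexCurve (indexCurve θ c) := by
  have h1 := abs_apply_le_one (ρ := θ) (le_of_eq hθ)
  simp only [unitCircle, mem_ofPred_eq] at hθ
  have hseg : ∀ u : ℝ, ((θ 0 - u * θ 1) / 2) ^ 2 + ((θ 1 + u * θ 0) / 2) ^ 2 = (1 + u ^ 2) / 4 :=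
    fun u => by linear_combination (1 + u ^ 2) / 4 * hθ
  have hu : ∀ t ∈ Icc (0 : ℝ) 1, (2 * t - 1) ^ 2 ≤ 1 := fun t ht => by nlinarith [ht.1, ht.2]
  have hlip : ∀ (s t : ℝ) (i : Fin 2), |(s - t) * θ i| ≤ 7 * |s - t| := fun s t i => by
    rw [abs_mul, mul_comm]
    exact mul_le_mul_of_nonneg_right ((h1 i).trans (by norm_num)) (abs_nonneg _)
  have hang : ∀ s t : ℝ, |(2 * Real.pi * s - Real.pi) - (2 * Real.pi * t - Real.pi)| ≤
      7 * |s - t| := fun s t => by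
    rw [show (2 * Real.pi * s - Real.pi) - (2 * Real.pi * t - Real.pi) =
      (2 * Real.pi) * (s - t) by ring, abs_mul, abs_of_pos Real.two_pi_pos]
    exact mul_le_mul_of_nonneg_right (by linarith [Real.pi_lt_d2]) (abs_nonneg _)
  fin_cases c
  · refine ⟨fun t _ => ?_, fun t _ => ?_, fun s t i => ?_⟩
    · simp [indexCurve]; norm_num
    · simp [indexCurve]
    · fin_cases i
      · have := Real.abs_cos_sub_cos_le (2 * Real.pi * s - Real.pi) (2 * Real.pi * t - Real.pi)
        exact this.trans (hang s t)
      · have := Real.abs_sin_sub_sin_le (2 * Real.pi * s - Real.pi) (2 * Real.pi * t - Real.pi)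
        exact this.trans (hang s t)
  · refine ⟨fun t _ => ?_, fun t ht => ?_, fun s t i => ?_⟩
    · have := hseg (2 * t - 1)
      simp only [indexCurve] at *
      norm_num at *
      nlinarith [sq_nonneg (2 * t - 1)]
    · have := hseg (2 * t - 1)
      have := hu t ht
      simp only [indexCurve] at *
      norm_num at *
      nlinarith
    · fin_cases i
      · have e : (θ 0 - (2 * s - 1) * θ 1) / 2 - (θ 0 - (2 * t - 1) * θ 1) / 2 =
          -((s - t) * θ 1) := by ring
        simpa [indexCurve, e] using hlip s t 1
      · have e : (θ 1 + (2 * s - 1) * θ 0) / 2 - (θ 1 + (2 * t - 1) * θ 0) / 2 =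
          (s - t) * θ 0 := by ring
        simpa [indexCurve, e] using hlip s t 0
  · refine ⟨fun t _ => ?_, fun t ht => ?_, fun s t i => ?_⟩
    · have := hseg (2 * t - 1)
      simp only [indexCurve] at *
      norm_num at *
      nlinarith [sq_nonneg (2 * t - 1)]
    · have := hseg (2 * t - 1)
      have := hu t ht
      simp only [indexCurve] at *
      norm_num at *
      nlinarith
    · fin_cases i
      · have e : (-θ 0 + (2 * s - 1) * θ 1) / 2 - (-θ 0 + (2 * t - 1) * θ 1) / 2 =
          (s - t) * θ 1 := by ring
        simpa [indexCurve, e] using hlip s t 1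
      · have e : (-θ 1 - (2 * s - 1) * θ 0) / 2 - (-θ 1 - (2 * t - 1) * θ 0) / 2 =
          -((s - t) * θ 0) := by ring
        simpa [indexCurve, e] using hlip s t 0

lemma exists_indexCurve_eq (θ : Plane) {ν : Plane} (hν : ν ∈ unitCircle) :
    ∃ t ∈ Icc (0 : ℝ) 1, indexCurve θ 0 t = ν := by
  set z : ℂ := ⟨ν 0, ν 1⟩ with hz
  have hn : ‖z‖ = 1 := by
    rw [Complex.norm_def, Complex.normSq_mk, ← sq, ← sq, show ν 0 ^ 2 + ν 1 ^ 2 = 1 from hν,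
      Real.sqrt_one]
  have hz0 : z ≠ 0 := fun h => by simp [h] at hn
  have hpi := Real.pi_pos
  refine ⟨(Complex.arg z + Real.pi) / (2 * Real.pi), ⟨?_, ?_⟩, ?_⟩
  · exact div_nonneg (by linarith [Complex.neg_pi_lt_arg z]) (by positivity)
  · rw [div_le_one (by positivity)]; linarith [Complex.arg_le_pi z]
  · have e : 2 * Real.pi * ((Complex.arg z + Real.pi) / (2 * Real.pi)) - Real.pi =
        Complex.arg z := by field_simp; ring
    simp only [indexCurve, Matrix.cons_val_zero, e, Complex.cos_arg hz0, Complex.sin_arg, hn]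
    ext i; fin_cases i <;> simp [hz]

/-- With `ν = c θ + d θ^⊥` the vector of the pair is `(θ + d / (1 + c) θ^⊥) / 2`. -/
lemma exists_pairMatrixAux_eq {θ ν : Plane} (hθ : θ ∈ unitCircle) (hν : ν ∈ unitCircle)
    (hθν : 0 ≤ ν ⬝ᵥ θ) (η : ℝ) : ∃ t ∈ Icc (0 : ℝ) 1, pairMatrixAux θ ν η =
      indexMatrix ![(θ 0 - (2 * t - 1) * θ 1) / 2, (θ 1 + (2 * t - 1) * θ 0) / 2] η := by
  set c := ν ⬝ᵥ θ with hc
  set d := ν 1 * θ 0 - ν 0 * θ 1 with hd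
  have hc1 : 0 < 1 + c := by linarith
  simp only [unitCircle, mem_ofPred_eq] at hθ hν
  rw [dotProduct_eq] at hc
  have hcd : c ^ 2 + d ^ 2 = 1 := by
    rw [hc, hd]
    linear_combination (ν 0 ^ 2 + ν 1 ^ 2) * hθ + hν
  have hd1 := abs_le.1 (abs_le_of_sq_le_sq (show d ^ 2 ≤ 1 ^ 2 by nlinarith) zero_le_one)
  refine ⟨(1 + d / (1 + c)) / 2, ⟨?_, ?_⟩, ?_⟩
  · have : -1 ≤ d / (1 + c) := by rw [le_div_iff₀ hc1]; linarith
    linarith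
  · have : d / (1 + c) ≤ 1 := by rw [div_le_one hc1]; linarith
    linarith
  · have h0 : ν 0 = c * θ 0 - d * θ 1 := by
      rw [hc, hd]; linear_combination -ν 0 * hθ
    have h1 : ν 1 = c * θ 1 + d * θ 0 := by
      rw [hc, hd]; linear_combination -ν 1 * hθ
    have e0 : (2 * (1 + c))⁻¹ * (θ 0 + ν 0) =
        (θ 0 - (2 * ((1 + d / (1 + c)) / 2) - 1) * θ 1) / 2 := by
      rw [h0]; field_simp; ring
    have e1 : (2 * (1 + c))⁻¹ * (θ 1 + ν 1) =
        (θ 1 + (2 * ((1 + d / (1 + c)) / 2) - 1) * θ 0) / 2 := by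
      rw [h1]; field_simp; ring
    rw [pairMatrixAux_eq, abs_of_nonneg hθν, ← e0, ← e1]
    congr 1
    ext i; fin_cases i <;> simp

lemma exists_indexCurve_pairMatrix {θ ν : Plane} (hθ : θ ∈ unitCircle) (hν : ν ∈ unitCircle)
    (η : ℝ) : ∃ c : Fin 3, ∃ t ∈ Icc (0 : ℝ) 1,
      pairMatrix θ ν η = indexMatrix (indexCurve θ c t) η := by
  by_cases h0 : 0 ≤ ν ⬝ᵥ θ
  · obtain ⟨t, ht, h⟩ := exists_pairMatrixAux_eq hθ hν h0 η
    exact ⟨1, t, ht, by rw [pairMatrix, if_pos h0, h]; rfl⟩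
  · obtain ⟨t, ht, h⟩ := exists_pairMatrixAux_eq (neg_mem_unitCircle hθ) hν
      (by rw [dotProduct_neg]; linarith) η
    refine ⟨2, t, ht, ?_⟩
    rw [pairMatrix, if_neg h0, h]
    congr 1
    ext i; fin_cases i <;> simp [indexCurve]; ring

end Curves

end SingleIndex

/-! ### The noise envelope -/

namespace SingleIndex

variable {k : ℝ → ℝ} {D : Set Plane} {F : Plane → ℝ} {ε : ℝ}

/-- A random variable which dominates `exp (a Z²)` for the standardized errors `Z` of all estimators
that are compared with the index `θ` at a point `x`, at the bandwidths `2⁻ⁿ`, `n ≤ N`. At the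
bandwidth `η = 2⁻ⁿ` the errors vary on the scale `η²`, so each of the curves is cut into `4ⁿ = η⁻²`
arcs. -/
noncomputable def noiseEnvelope (k : ℝ → ℝ) (D : Set Plane) (F : Plane → ℝ) (ε a : ℝ) (N : ℕ)
    (θ : Plane) (j : Matrix (Fin 2) (Fin 2) ℝ → Plane → ℝ) (x : Plane) : ℝ≥0∞ :=
  ∑ n ∈ Finset.range (N + 1), ∑ i ∈ Finset.range (4 ^ n), ∑ c : Fin 3,
    pathBound a fun t => noise k D F ε (2⁻¹ ^ n) j
      (indexMatrix (indexCurve θ c ((i + t) / 4 ^ n)) (2⁻¹ ^ n)) x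

lemma arc_mem {n i : ℕ} (hi : i < 4 ^ n) {t : ℝ} (ht : t ∈ Icc (0 : ℝ) 1) :
    ((i : ℝ) + t) / 4 ^ n ∈ Icc (0 : ℝ) 1 := by
  have h1 : (i : ℝ) + 1 ≤ 4 ^ n := by exact_mod_cast hi
  refine ⟨div_nonneg (add_nonneg (Nat.cast_nonneg _) ht.1) (by positivity), ?_⟩
  rw [div_le_one (by positivity)]
  linarith [ht.2]

lemma exists_arc (n : ℕ) {u : ℝ} (hu : u ∈ Icc (0 : ℝ) 1) :
    ∃ i : ℕ, i < 4 ^ n ∧ ∃ t ∈ Icc (0 : ℝ) 1, u = ((i : ℝ) + t) / 4 ^ n := by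
  have h4 : (0 : ℝ) < 4 ^ n := by positivity
  rcases eq_or_lt_of_le hu.2 with h1 | h1
  · refine ⟨4 ^ n - 1, Nat.sub_lt (by positivity) one_pos, 1, by simp, ?_⟩
    rw [Nat.cast_sub (Nat.one_le_pow _ _ (by norm_num)), h1]
    push_cast
    field_simp; ring
  · have h0 : 0 ≤ u * 4 ^ n := mul_nonneg hu.1 h4.le
    refine ⟨⌊u * 4 ^ n⌋₊, ?_, u * 4 ^ n - ⌊u * 4 ^ n⌋₊, ⟨?_, ?_⟩, ?_⟩
    · rw [Nat.floor_lt h0]; push_cast; nlinarith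
    · linarith [Nat.floor_le h0]
    · linarith [Nat.lt_floor_add_one (u * 4 ^ n)]
    · field_simp; ring

lemma le_sum_sum_sum (B : ℕ → ℕ → Fin 3 → ℝ≥0∞) {N n i : ℕ} (hn : n ≤ N) (hi : i < 4 ^ n)
    (c : Fin 3) :
    B n i c ≤ ∑ n ∈ Finset.range (N + 1), ∑ i ∈ Finset.range (4 ^ n), ∑ c : Fin 3, B n i c :=
  calc B n i c ≤ ∑ c : Fin 3, B n i c :=
        Finset.single_le_sum (f := fun c => B n i c) (fun _ _ => zero_le) (Finset.mem_univ c)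
    _ ≤ ∑ i ∈ Finset.range (4 ^ n), ∑ c : Fin 3, B n i c :=
        Finset.single_le_sum (f := fun i => ∑ c : Fin 3, B n i c) (fun _ _ => zero_le)
          (Finset.mem_range.2 hi)
    _ ≤ _ := Finset.single_le_sum
        (f := fun n => ∑ i ∈ Finset.range (4 ^ n), ∑ c : Fin 3, B n i c) (fun _ _ => zero_le)
          (Finset.mem_range.2 (Nat.lt_succ_of_le hn))

lemma exp_noise_indexCurve_le_noiseEnvelope (hk : IsKernel k) (hD : volume D ≠ ∞)
    (hF : Measurable F) {M : ℝ} (hM : ∀ t, |F t| ≤ M)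
    {j : Matrix (Fin 2) (Fin 2) ℝ → Plane → ℝ}
    (hj : ContinuousOn (fun p : Matrix (Fin 2) (Fin 2) ℝ × Plane => j p.1 p.2)
      {p | p.1.det ≠ 0}) {a : ℝ} (ha : 0 ≤ a) {N n : ℕ} (hn : n ≤ N) {θ : Plane}
    (hθ : θ ∈ unitCircle) (x : Plane) (c : Fin 3) {u : ℝ} (hu : u ∈ Icc (0 : ℝ) 1) :
    ENNReal.ofReal (Real.exp (a * noise k D F ε (2⁻¹ ^ n) j
      (indexMatrix (indexCurve θ c u) (2⁻¹ ^ n)) x ^ 2)) ≤ noiseEnvelope k D F ε a N θ j x := by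
  obtain ⟨i, hi, t, ht, rfl⟩ := exists_arc n hu
  have hγ := isIndexCurve_indexCurve hθ c
  set g : ℝ → ℝ := fun t => noise k D F ε (2⁻¹ ^ n) j
      (indexMatrix (indexCurve θ c ((i + t) / 4 ^ n)) (2⁻¹ ^ n)) x with hg
  have hgc : ContinuousOn g (Icc 0 1) := by
    have hc : Continuous fun t : ℝ => indexMatrix (indexCurve θ c ((i + t) / 4 ^ n)) (2⁻¹ ^ n) :=
      (continuous_indexMatrix _).comp (hγ.continuous.comp (by fun_prop))
    have hp : ContinuousOn (fun t : ℝ => (indexMatrix (indexCurve θ c ((i + t) / 4 ^ n))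
        (2⁻¹ ^ n), x)) (Icc 0 1) := (Continuous.prodMk hc continuous_const).continuousOn
    have hn := continuousOn_noise (ε := ε) hk hD hF hM (2⁻¹ ^ n) hj
    have hmaps : MapsTo (fun t : ℝ => (indexMatrix (indexCurve θ c ((i + t) / 4 ^ n))
        (2⁻¹ ^ n), x)) (Icc 0 1) {p | p.1.det ≠ 0} := fun t ht =>
      hγ.det_ne_zero (arc_mem hi ht) (by positivity)
    have h := hn.comp hp hmaps
    exact h
  refine (exp_sq_le_pathBound ha hgc ht).trans ?_
  exact le_sum_sum_sum (fun n i c => pathBound a fun t => noise k D F ε (2⁻¹ ^ n) j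
      (indexMatrix (indexCurve θ c ((i + t) / 4 ^ n)) (2⁻¹ ^ n)) x) hn hi c

variable {Ω : Type*} [MeasurableSpace Ω] {P : Measure Ω} {Y : (Plane → ℝ) → Ω → ℝ}
  {J : Ω → Matrix (Fin 2) (Fin 2) ℝ → Plane → ℝ}

lemma measurable_noise_arc (hk : IsKernel k) (hD : volume D ≠ ∞)
    (hF : Measurable F) {M : ℝ} (hM : ∀ t, |F t| ≤ M) (hJ : IsKernelIntegral k P Y J)
    {θ : Plane} (hθ : θ ∈ unitCircle) {n i : ℕ} (hi : i < 4 ^ n) (c : Fin 3) {t : ℝ}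
    (ht : t ∈ Icc (0 : ℝ) 1) :
    Measurable fun p : Plane × Ω => noise k D F ε (2⁻¹ ^ n) (J p.2)
      (indexMatrix (indexCurve θ c ((i + t) / 4 ^ n)) (2⁻¹ ^ n)) p.1 :=
  measurable_noise hk hD hF hM _ hJ
    ((isIndexCurve_indexCurve hθ c).det_ne_zero (arc_mem hi ht) (by positivity))

lemma measurable_noiseEnvelope (hk : IsKernel k) (hD : volume D ≠ ∞)
    (hF : Measurable F) {M : ℝ} (hM : ∀ t, |F t| ≤ M) (hJ : IsKernelIntegral k P Y J) (a : ℝ)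
    (N : ℕ) {θ : Plane} (hθ : θ ∈ unitCircle) :
    Measurable fun p : Plane × Ω => noiseEnvelope k D F ε a N θ (J p.2) p.1 :=
  Finset.measurable_sum _ fun n _ => Finset.measurable_sum _ fun i hi =>
    Finset.measurable_sum _ fun c _ => measurable_pathBound (α := Plane × Ω) a
      (X := fun p t => noise k D F ε (2⁻¹ ^ n) (J p.2)
        (indexMatrix (indexCurve θ c ((i + t) / 4 ^ n)) (2⁻¹ ^ n)) p.1)
      fun _ ht => measurable_noise_arc hk hD hF hM hJ hθ (Finset.mem_range.1 hi) c ht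

lemma lintegral_pathBound_arc_le {W : (Plane → ℝ) → Ω → ℝ} (hk : IsKernel k)
    (hD : volume D ≠ ∞) (hF : Measurable F) {M : ℝ} (hM : ∀ t, |F t| ≤ M)
    (hJ : IsKernelIntegral k P Y J) (hW : IsWhiteNoise D P W)
    (hY : ∀ φ ω, Y φ ω = (∫ t in D, φ t * F t) + ε * W φ ω) (hε : 0 < ε)
    {R Λ : ℝ} (hR1 : 1 ≤ R) (hR : ∀ u, R < |u| → k u = 0) (hΛ : 0 ≤ Λ)
    (hL : ∀ u v, |k u - k v| ≤ Λ * |u - v|) {a : ℝ} (ha : 0 ≤ a)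
    (ha1 : 4 * a * (∫ u, k u ^ 2) ^ 2 ≤ 1 / 4)
    (ha2 : 4 * a * (7 * (6 * R * (4 * supNorm k ^ 2 + 12 * R * supNorm k * Λ))) ^ 2 ≤ 1 / 4)
    {θ : Plane} (hθ : θ ∈ unitCircle) {n i : ℕ} (hi : i < 4 ^ n) (c : Fin 3) (x : Plane) :
    ∫⁻ ω, pathBound a (fun t => noise k D F ε (2⁻¹ ^ n) (J ω)
      (indexMatrix (indexCurve θ c ((i + t) / 4 ^ n)) (2⁻¹ ^ n)) x) ∂P ≤ 4 := by
  have hγ := isIndexCurve_indexCurve hθ c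
  set γ := indexCurve θ c with hγd
  set η : ℝ := 2⁻¹ ^ n with hη
  have hη0 : 0 < η := by positivity
  have hη1 : η ≤ 1 := pow_le_one₀ (by norm_num) (by norm_num)
  have hη2 : (4 ^ n : ℝ)⁻¹ = η ^ 2 := by
    rw [hη, ← pow_mul, mul_comm, pow_mul, ← inv_pow]; norm_num
  have hdet : ∀ t ∈ Icc (0 : ℝ) 1, (indexMatrix (γ ((i + t) / 4 ^ n)) η).det ≠ 0 := fun t ht =>
    hγ.det_ne_zero (arc_mem hi ht) hη0
  refine lintegral_pathBound_le P (X := fun ω t => noise k D F ε η (J ω)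
      (indexMatrix (γ ((i + t) / 4 ^ n)) η) x) (fun t ht => ?_) ?_ fun s hs t ht hst => ?_
  · exact (measurable_noise_arc hk hD hF hM hJ hθ hi c ht).comp
      (measurable_const.prodMk measurable_id : Measurable fun ω : Ω => (x, ω))
  · have h01 : (0 : ℝ) ∈ Icc (0 : ℝ) 1 := by simp
    refine hJ.lintegral_exp_noise_le hk hD hW hY hε hη0 (hdet 0 h01) x (le_trans ?_ ha1)
    refine mul_le_mul_of_nonneg_left ?_ (by positivity)
    set A := indexMatrix (γ ((i + 0) / 4 ^ n)) η with hA
    have h1 := setIntegral_kernelAt_sq_le hk (hdet 0 h01) x D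
    have h2 : |A.det| ≤ η⁻¹ := by
      rw [hA, det_indexMatrix, abs_of_nonneg (by positivity)]
      exact mul_le_of_le_one_right (by positivity) (hγ.upper _ (arc_mem hi h01))
    have h3 : 0 < |A.det| := abs_pos.2 (hdet 0 h01)
    simp_rw [mul_pow]
    rw [integral_const_mul, ← sq_abs]
    calc η * (|A.det| ^ 2 * ∫ t in D, kernelAt k A x t ^ 2)
        ≤ η * (|A.det| ^ 2 * (|A.det|⁻¹ * (∫ u, k u ^ 2) ^ 2)) := by gcongr
      _ = η * |A.det| * (∫ u, k u ^ 2) ^ 2 := by field_simp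
      _ ≤ η * η⁻¹ * (∫ u, k u ^ 2) ^ 2 := by gcongr
      _ = _ := by rw [mul_inv_cancel₀ hη0.ne', one_mul]
  · simp_rw [mul_pow, ← mul_assoc]
    refine hJ.lintegral_exp_noise_sub_le hk hD hW hY hε hη0 (hdet t ht) (hdet s hs) x
      (le_trans ?_ ha2)
    have hts : 0 < t - s := sub_pos.2 hst
    have hδ : ∀ l, |γ ((i + t) / 4 ^ n) l - γ ((i + s) / 4 ^ n) l| ≤ 7 * (η ^ 2 * (t - s)) :=
      fun l => by
        refine (hγ.lipschitz _ _ l).trans (le_of_eq ?_)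
        rw [← sub_div, add_sub_add_left_eq_sub, abs_div, abs_of_pos hts,
          abs_of_pos (by positivity), div_eq_inv_mul, hη2]
    -- along an arc the parameter has speed at most `7 η²`, which compensates the factor `η⁻²`
    have h1 := setIntegral_det_mul_kernelAt_sub_sq_le hk hR1 hR hΛ hL x hη0 hη1
      (hγ.lower _ (arc_mem hi ht)) (hγ.upper _ (arc_mem hi ht)) (hγ.lower _ (arc_mem hi hs))
      (hγ.upper _ (arc_mem hi hs)) hδ D
    set I := ∫ u in D, ((indexMatrix (γ ((i + t) / 4 ^ n)) η).det *
      kernelAt k (indexMatrix (γ ((i + t) / 4 ^ n)) η) x u -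
      (indexMatrix (γ ((i + s) / 4 ^ n)) η).det *
        kernelAt k (indexMatrix (γ ((i + s) / 4 ^ n)) η) x u) ^ 2 with hI
    set K := 4 * supNorm k ^ 2 + 12 * R * supNorm k * Λ with hK
    have hI0 : 0 ≤ I := integral_nonneg fun _ => sq_nonneg _
    have h2 : 6 * R * K * (7 * (η ^ 2 * (t - s))) / η ^ 2 = (t - s) * (7 * (6 * R * K)) := by
      field_simp
    rw [h2, mul_pow] at h1
    calc 4 * a * (t - s)⁻¹ ^ 2 * (η * I) ≤ 4 * a * (t - s)⁻¹ ^ 2 * (1 * I) := by gcongr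
      _ ≤ 4 * a * (t - s)⁻¹ ^ 2 * (1 * ((t - s) ^ 2 * (7 * (6 * R * K)) ^ 2)) := by gcongr
      _ = _ := by field_simp

lemma lintegral_noiseEnvelope_le {W : (Plane → ℝ) → Ω → ℝ} (hk : IsKernel k)
    (hD : volume D ≠ ∞) (hF : Measurable F) {M : ℝ} (hM : ∀ t, |F t| ≤ M)
    (hJ : IsKernelIntegral k P Y J) (hW : IsWhiteNoise D P W)
    (hY : ∀ φ ω, Y φ ω = (∫ t in D, φ t * F t) + ε * W φ ω) (hε : 0 < ε)
    {R Λ : ℝ} (hR1 : 1 ≤ R) (hR : ∀ u, R < |u| → k u = 0) (hΛ : 0 ≤ Λ)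
    (hL : ∀ u v, |k u - k v| ≤ Λ * |u - v|) {a : ℝ} (ha : 0 ≤ a)
    (ha1 : 4 * a * (∫ u, k u ^ 2) ^ 2 ≤ 1 / 4)
    (ha2 : 4 * a * (7 * (6 * R * (4 * supNorm k ^ 2 + 12 * R * supNorm k * Λ))) ^ 2 ≤ 1 / 4)
    {N : ℕ} (hN : ε ^ 2 ≤ 2⁻¹ ^ N)
    {θ : Plane} (hθ : θ ∈ unitCircle) (x : Plane) :
    ∫⁻ ω, noiseEnvelope k D F ε a N θ (J ω) x ∂P ≤ ENNReal.ofReal (16 * (ε ^ 4)⁻¹) := by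
  have hm : ∀ n i c, i ∈ Finset.range (4 ^ n) → Measurable fun ω => pathBound a fun t =>
      noise k D F ε (2⁻¹ ^ n) (J ω) (indexMatrix (indexCurve θ c ((i + t) / 4 ^ n)) (2⁻¹ ^ n)) x :=
    fun n i c hi => measurable_pathBound a (X := fun ω t => noise k D F ε (2⁻¹ ^ n) (J ω)
        (indexMatrix (indexCurve θ c ((i + t) / 4 ^ n)) (2⁻¹ ^ n)) x) fun t ht =>
      (measurable_noise_arc hk hD hF hM hJ hθ (Finset.mem_range.1 hi) c ht).comp
        (measurable_const.prodMk measurable_id : Measurable fun ω : Ω => (x, ω))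
  unfold noiseEnvelope
  rw [lintegral_finsetSum _ fun n _ => Finset.measurable_sum _ fun i hi =>
    Finset.measurable_sum _ fun c _ => hm n i c hi]
  have h1 : ∀ n ∈ Finset.range (N + 1), ∫⁻ ω, (∑ i ∈ Finset.range (4 ^ n), ∑ c : Fin 3,
      pathBound a fun t => noise k D F ε (2⁻¹ ^ n) (J ω)
        (indexMatrix (indexCurve θ c ((i + t) / 4 ^ n)) (2⁻¹ ^ n)) x) ∂P ≤
      ENNReal.ofReal (12 * 4 ^ n) := fun n _ => by
    rw [lintegral_finsetSum _ fun i hi => Finset.measurable_sum _ fun c _ => hm n i c hi]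
    refine (Finset.sum_le_sum fun i hi => ?_).trans (?_ : ∑ i ∈ Finset.range (4 ^ n), (12 : ℝ≥0∞) ≤ _)
    · rw [lintegral_finsetSum _ fun c _ => hm n i c hi]
      refine (Finset.sum_le_sum fun c _ => lintegral_pathBound_arc_le hk hD hF hM hJ hW hY hε hR1
        hR hΛ hL ha ha1 ha2 hθ (Finset.mem_range.1 hi) c x).trans ?_
      simp only [Finset.sum_const, Finset.card_univ, Fintype.card_fin]
      norm_num
    · rw [Finset.sum_const, Finset.card_range, nsmul_eq_mul, ENNReal.ofReal_mul (by norm_num),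
        mul_comm, ENNReal.ofReal_pow (by norm_num)]
      norm_num
  refine (Finset.sum_le_sum h1).trans ?_
  rw [← ENNReal.ofReal_sum_of_nonneg fun _ _ => by positivity]
  refine ENNReal.ofReal_le_ofReal ?_
  rw [← Finset.mul_sum, geom_sum_eq (by norm_num)]
  have h2 : (4 : ℝ) ^ N ≤ (ε ^ 4)⁻¹ := by
    rw [le_inv_comm₀ (by positivity) (by positivity)]
    calc ε ^ 4 = (ε ^ 2) ^ 2 := by ring
      _ ≤ (2⁻¹ ^ N) ^ 2 := by gcongr
      _ = (4 ^ N)⁻¹ := by rw [← pow_mul, mul_comm, pow_mul, ← inv_pow]; norm_num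
  rw [pow_succ]
  norm_num
  linarith

end SingleIndex

/-! ### The oracle inequality outside a rare event -/

namespace SingleIndex

variable {k f : ℝ → ℝ} {M ε : ℝ} {D : Set Plane}

lemma kernelAt_neg (hk : IsKernel k) (A : Matrix (Fin 2) (Fin 2) ℝ) (x : Plane) :
    kernelAt k (-A) x = kernelAt k A x := by
  ext t
  rw [kernelAt, kernelAt, Matrix.neg_mulVec, Pi.neg_apply, Pi.neg_apply, hk.symmetric, hk.symmetric]

/-- The kernel integrals are even in the matrix, simultaneously for all matrices and points. -/
lemma IsKernelIntegral.ae_neg_eq {Ω : Type*} [MeasurableSpace Ω] {P : Measure Ω}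
    {Y : (Plane → ℝ) → Ω → ℝ} {J : Ω → Matrix (Fin 2) (Fin 2) ℝ → Plane → ℝ} (hk : IsKernel k)
    (hJ : IsKernelIntegral k P Y J) :
    ∀ᵐ ω ∂P, ∀ (A : Matrix (Fin 2) (Fin 2) ℝ) (x : Plane), A.det ≠ 0 → J ω (-A) x = J ω A x := by
  set U : Set (Matrix (Fin 2) (Fin 2) ℝ × Plane) := {p | p.1.det ≠ 0} with hU
  have : SecondCountableTopology (Matrix (Fin 2) (Fin 2) ℝ) :=
    inferInstanceAs (SecondCountableTopology (Fin 2 → Fin 2 → ℝ))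
  have hneg : ∀ A : Matrix (Fin 2) (Fin 2) ℝ, A.det ≠ 0 → (-A).det ≠ 0 := fun A hA => by
    rw [Matrix.det_neg]; simpa using hA
  have : Nonempty U := ⟨⟨(1, 0), by simp [hU]⟩⟩
  set u := TopologicalSpace.denseSeq U with hu
  have hae : ∀ᵐ ω ∂P, ∀ n, J ω (-(u n).1.1) (u n).1.2 = J ω (u n).1.1 (u n).1.2 := by
    rw [ae_all_iff]
    intro n
    filter_upwards [hJ.version (u n).1.1 (u n).1.2 (u n).2,
      hJ.version (-(u n).1.1) (u n).1.2 (hneg _ (u n).2)] with ω h1 h2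
    rw [h1, h2, kernelAt_neg hk]
  filter_upwards [hae] with ω hω A x hA
  have h1 : Continuous fun p : U => J ω p.1.1 p.1.2 :=
    (hJ.continuousOn ω).comp_continuous continuous_subtype_val fun p => p.2
  have h2 : Continuous fun p : U => J ω (-p.1.1) p.1.2 :=
    (hJ.continuousOn ω).comp_continuous
      ((continuous_fst.comp continuous_subtype_val).neg.prodMk
        (continuous_snd.comp continuous_subtype_val)) fun p => hneg _ p.2
  exact (TopologicalSpace.denseRange_denseSeq U).induction_on
    (p := fun p : U => J ω (-p.1.1) p.1.2 = J ω p.1.1 p.1.2) ⟨(A, x), hA⟩ (isClosed_eq h2 h1) hω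

/-- The common centre of all the estimators whose windows are orthogonal to `ν`. -/
noncomputable def centre (k f : ℝ → ℝ) (θ x ν : Plane) : ℝ :=
  ∫ w, k w * f (x ⬝ᵥ θ + (ν 0 * θ 1 - ν 1 * θ 0) * w)

lemma centre_self (hk : IsKernel k) (f : ℝ → ℝ) (θ x : Plane) :
    centre k f θ x θ = f (x ⬝ᵥ θ) := by
  simp [centre, mul_comm (θ 0), integral_mul_const, hk.integral_eq_one]

lemma abs_mean_indexMatrix_sub_centre_le (hk : IsKernel k) (hf : Measurable f)
    (hM : ∀ u, |f u| ≤ M) {R : ℝ} (hR1 : 1 ≤ R) (hR : ∀ u, R < |u| → k u = 0)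
    {σ θ x ν : Plane} {η s : ℝ} (hη : 0 < η) (hs : 0 < s)
    (hq : σ 0 ^ 2 + σ 1 ^ 2 = s)
    (hα : |σ ⬝ᵥ θ| ≤ 2 * s) (hβ : σ 0 * θ 1 - σ 1 * θ 0 = s * (ν 0 * θ 1 - ν 1 * θ 0))
    (hD : ∀ t, kernelAt k (indexMatrix σ η) x t ≠ 0 → t ∈ D) :
    |(indexMatrix σ η).det * (∫ t in D, kernelAt k (indexMatrix σ η) x t * f (t ⬝ᵥ θ)) -
      centre k f θ x ν| ≤ 2 * R * supNorm k * starApproxError k f (2 * η) (x ⬝ᵥ θ) := by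
  rw [det_mul_setIntegral_kernelAt hk hf hM (hq ▸ hs) hη θ x hD, hq, hβ,
    mul_div_cancel_left₀ _ hs.ne']
  refine abs_integral_integral_sub_le hk hf hM hR1 hR ?_ _ _
  rw [abs_mul, abs_of_pos hη, abs_div, abs_of_pos hs, mul_comm 2 η]
  refine mul_le_mul_of_nonneg_left ?_ hη.le
  rwa [div_le_iff₀ hs]

lemma abs_mean_index_sub_centre_le (hk : IsKernel k) (hf : Measurable f)
    (hM : ∀ u, |f u| ≤ M) {R : ℝ} (hR1 : 1 ≤ R) (hR : ∀ u, R < |u| → k u = 0)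
    (hD : WindowsInside k D) {θ x ν : Plane} (hθ : θ ∈ unitCircle) (hν : ν ∈ unitCircle)
    (hx : x ∈ square) {η : ℝ} (hη : 0 < η) (hη1 : η ≤ 1) :
    |(indexMatrix ν η).det * (∫ t in D, kernelAt k (indexMatrix ν η) x t * f (t ⬝ᵥ θ)) -
      centre k f θ x ν| ≤ 2 * R * supNorm k * starApproxError k f (2 * η) (x ⬝ᵥ θ) :=
  abs_mean_indexMatrix_sub_centre_le hk hf hM hR1 hR hη one_pos hν
    ((abs_dotProduct_le_one hθ hν).trans (by norm_num)) (by ring)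
    (hD x hx ν hν η ⟨hη, hη1⟩).1

lemma abs_mean_pair_sub_centre_le (hk : IsKernel k) (hf : Measurable f)
    (hM : ∀ u, |f u| ≤ M) {R : ℝ} (hR1 : 1 ≤ R) (hR : ∀ u, R < |u| → k u = 0)
    (hD : WindowsInside k D) {θ x ν : Plane} (hθ : θ ∈ unitCircle) (hν : ν ∈ unitCircle)
    (hx : x ∈ square) {η : ℝ} (hη : 0 < η) (hη1 : η ≤ 1) :
    |(pairMatrix θ ν η).det * (∫ t in D, kernelAt k (pairMatrix θ ν η) x t * f (t ⬝ᵥ θ)) -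
      centre k f θ x ν| ≤ 2 * R * supNorm k * starApproxError k f (2 * η) (x ⬝ᵥ θ) := by
  have hwin := (hD x hx θ hθ η ⟨hη, hη1⟩).2 ν hν
  -- `c = ± 1` is the sign of `ν ⬝ᵥ θ`
  obtain ⟨c, hc, hpos, he⟩ : ∃ c : ℝ, c ^ 2 = 1 ∧ 0 ≤ c * (ν ⬝ᵥ θ) ∧ pairMatrix θ ν η =
      indexMatrix ((2 * (1 + c * (ν ⬝ᵥ θ)))⁻¹ • (c • θ + ν)) η := by
    by_cases h0 : 0 ≤ ν ⬝ᵥ θ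
    · refine ⟨1, by norm_num, by linarith, ?_⟩
      rw [pairMatrix, if_pos h0, pairMatrixAux_eq, abs_of_nonneg h0]; simp
    · refine ⟨-1, by norm_num, by linarith, ?_⟩
      rw [pairMatrix, if_neg h0, pairMatrixAux_eq, dotProduct_neg, abs_of_pos (by linarith)]; simp
  rw [he] at hwin ⊢
  have hle := abs_le.1 (abs_dotProduct_le_one hθ hν)
  simp only [unitCircle, mem_ofPred_eq] at hθ hν
  set g := ν ⬝ᵥ θ with hg
  rw [dotProduct_eq] at hg
  have hs : 0 < (2 * (1 + c * g))⁻¹ := by positivity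
  refine abs_mean_indexMatrix_sub_centre_le hk hf hM hR1 hR hη hs ?_ ?_ ?_ hwin
  · have h2 : (c * θ 0 + ν 0) ^ 2 + (c * θ 1 + ν 1) ^ 2 = 2 * (1 + c * g) := by
      rw [hg]; linear_combination c ^ 2 * hθ + hν + hc
    simp only [Pi.smul_apply, Pi.add_apply, smul_eq_mul, mul_pow]
    rw [← mul_add, h2]
    field_simp
  · have h1 : |c| ≤ 1 := by
      rw [← sq_le_one_iff_abs_le_one]; exact hc.le
    have h2 : ((2 * (1 + c * g))⁻¹ • (c • θ + ν)) ⬝ᵥ θ = (2 * (1 + c * g))⁻¹ * (c + g) := by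
      rw [dotProduct_eq, hg]
      simp only [Pi.smul_apply, Pi.add_apply, smul_eq_mul]
      linear_combination (2 * (1 + c * (ν 0 * θ 0 + ν 1 * θ 1)))⁻¹ * c * hθ
    rw [h2, abs_mul, abs_of_pos hs, mul_comm]
    refine mul_le_mul_of_nonneg_right ?_ hs.le
    refine (abs_add_le _ _).trans ?_
    have : |g| ≤ 1 := abs_le.2 hle
    linarith
  · simp only [Pi.smul_apply, Pi.add_apply, smul_eq_mul]
    ring

lemma abs_mean_indexMatrix_le (hk : IsKernel k) (hf : Measurable f)
    (hM : ∀ u, |f u| ≤ M) (hD : WindowsInside k D) {θ x ν : Plane} (hν : ν ∈ unitCircle)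
    (hx : x ∈ square) {η : ℝ} (hη : 0 < η) (hη1 : η ≤ 1) :
    |(indexMatrix ν η).det * (∫ t in D, kernelAt k (indexMatrix ν η) x t * f (t ⬝ᵥ θ))| ≤
      l1Norm k * (l1Norm k * M) := by
  have hq : ν 0 ^ 2 + ν 1 ^ 2 = 1 := hν
  rw [det_mul_setIntegral_kernelAt hk hf hM (by rw [hq]; exact one_pos) hη θ x
    (hD x hx ν hν η ⟨hη, hη1⟩).1]
  conv_rhs => rw [l1Norm, ← integral_mul_const]
  rw [← Real.norm_eq_abs]
  refine norm_integral_le_of_norm_le (hk.integrable.abs.mul_const _)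
    (Filter.Eventually.of_forall fun b => ?_)
  rw [Real.norm_eq_abs, abs_mul]
  refine mul_le_mul_of_nonneg_left ?_ (abs_nonneg _)
  have := abs_integral_kernel_mul_le hk hM (x ⬝ᵥ θ + (ν 0 * θ 1 - ν 1 * θ 0) /
    (ν 0 ^ 2 + ν 1 ^ 2) * b) (η * ((ν ⬝ᵥ θ) / (ν 0 ^ 2 + ν 1 ^ 2)))
  refine le_trans (le_of_eq ?_) this
  congr 2; ext a; ring_nf

lemma abs_estimator_sub_mean (hε : 0 < ε) {η : ℝ} (hη : 0 < η) (F : Plane → ℝ)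
    (j : Matrix (Fin 2) (Fin 2) ℝ → Plane → ℝ) (A : Matrix (Fin 2) (Fin 2) ℝ) (x : Plane) :
    |estimator j A x - A.det * ∫ t in D, kernelAt k A x t * F t| =
      ε * (√η)⁻¹ * |noise k D F ε η j A x| := by
  have h1 : 0 < √η := Real.sqrt_pos.2 hη
  rw [noise, abs_mul, abs_of_pos (show 0 < √η * ε⁻¹ by positivity), estimator, mul_sub]
  field_simp

/-- The oracle inequality on the event where the noise envelope is small. -/
lemma abs_finalEstimator_sub_le_of_noise_le (hk : IsKernel k) (hf : Measurable f)
    (hM : ∀ u, |f u| ≤ M) {R : ℝ} (hR1 : 1 ≤ R) (hR : ∀ u, R < |u| → k u = 0)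
    (hε : 0 < ε) (hε2 : 2 * ε ^ 2 ≤ 1) (hL : 1 ≤ Real.log (1 / ε))
    (hML : 2 * M * l1Norm k ≤ supNorm k * √(Real.log (1 / ε)))
    (hD : WindowsInside k D) {j : Matrix (Fin 2) (Fin 2) ℝ → Plane → ℝ}
    (hj : ContinuousOn (fun p : Matrix (Fin 2) (Fin 2) ℝ × Plane => j p.1 p.2) {p | p.1.det ≠ 0})
    {x θ₀ θ : Plane} (hx : x ∈ square)
    (hsymm : ∀ A : Matrix (Fin 2) (Fin 2) ℝ, A.det ≠ 0 → j (-A) x = j A x)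
    (hθ₀ : θ₀ ∈ unitCircle) {c C : ℝ} (hc : 0 ≤ c)
    (hC : 2 * (4 * R * supNorm k ^ 2 + c) ≤ C)
    (hidx : ∀ ν ∈ unitCircle, ∀ η ∈ grid ε,
      |noise k D (fun t => f (t ⬝ᵥ θ₀)) ε η j (indexMatrix ν η) x| ≤ c * √(Real.log (1 / ε)))
    (hpair : ∀ ν ∈ unitCircle, ∀ η ∈ grid ε,
      |noise k D (fun t => f (t ⬝ᵥ θ₀)) ε η j (pairMatrix θ₀ ν η) x| ≤ c * √(Real.log (1 / ε)))
    (hsel : IsSelectedIndex C ε j x θ) :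
    |finalEstimator C ε j x θ - f (x ⬝ᵥ θ₀)| ≤
      12 * C / supNorm k ^ 2 * oracleRate k f ε θ₀ x := by
  have hS := hk.supNorm_pos
  have hε1 : ε ≤ 1 := by nlinarith
  set L := Real.log (1 / ε) with hLdef
  obtain ⟨hstar, h₀, hh₀, hle, hbias⟩ := exists_oracle_grid hk hf hM hε hε2 hML (x ⬝ᵥ θ₀)
  set τ := 4 * R * supNorm k ^ 2 + c with hτ
  have hτ0 : 0 ≤ τ := by positivity
  have hC0 : 0 ≤ C := by linarith
  have hthr : ∀ η, threshold τ ε η = τ * (ε * (√η)⁻¹ * √L) := fun η => by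
    rw [threshold, Real.sqrt_mul' _ (by linarith), Real.sqrt_inv]; ring
  have key : ∀ (A : Matrix (Fin 2) (Fin 2) ℝ) (m η : ℝ), η ∈ grid ε → η ≤ h₀ →
      |A.det * (∫ t in D, kernelAt k A x t * f (t ⬝ᵥ θ₀)) - m| ≤
        2 * R * supNorm k * starApproxError k f (2 * η) (x ⬝ᵥ θ₀) →
      |noise k D (fun t => f (t ⬝ᵥ θ₀)) ε η j A x| ≤ c * √L →
      |estimator j A x - m| ≤ threshold τ ε η := by
    intro A m η hη hηh h1 h2
    have hη0 := grid_pos hε hη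
    have hsη : 0 < √η := Real.sqrt_pos.2 hη0
    have h3 := abs_estimator_sub_mean (D := D) (k := k) hε hη0 (fun t => f (t ⬝ᵥ θ₀)) j A x
    have h4 : starApproxError k f (2 * η) (x ⬝ᵥ θ₀) ≤ 2 * supNorm k * ε * √L * (√η)⁻¹ := by
      rw [← div_eq_mul_inv, le_div_iff₀ hsη, mul_comm]
      exact hbias η hη0 hηh
    have h5 := abs_sub_le (estimator j A x)
      (A.det * ∫ t in D, kernelAt k A x t * f (t ⬝ᵥ θ₀)) m
    have h6 := mul_le_mul_of_nonneg_left h4 (show 0 ≤ 2 * R * supNorm k by positivity)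
    have h7 := mul_le_mul_of_nonneg_left h2 (show 0 ≤ ε * (√η)⁻¹ by positivity)
    rw [hthr, hτ]
    rw [h3] at h5
    linarith
  have hmain := abs_finalEstimator_sub_le (x := x) hε hε1 hj hsymm hθ₀ (centre k f θ₀ x) hτ0 hC hh₀
    (fun ν hν η hη hηh => key _ _ η hη hηh (abs_mean_index_sub_centre_le hk hf hM hR1 hR hD hθ₀
      hν hx (grid_pos hε hη) hη.2.2) (hidx ν hν η hη))
    (fun ν hν η hη hηh => key _ _ η hη hηh (abs_mean_pair_sub_centre_le hk hf hM hR1 hR hD hθ₀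
      hν hx (grid_pos hε hη) hη.2.2) (hpair ν hν η hη)) hsel
  rw [centre_self hk] at hmain
  refine hmain.trans ?_
  set H := oracleBandwidth k f ε (x ⬝ᵥ θ₀) with hH
  have hH0 : 0 < H := lt_of_lt_of_le (by positivity) hstar
  have hh0 := grid_pos hε hh₀
  have hrate : oracleRate k f ε θ₀ x = supNorm k ^ 2 * (ε * √(L / H)) := by
    rw [oracleRate, ← hH, ← hLdef, show supNorm k ^ 4 * ε ^ 2 * L / H =
      (supNorm k ^ 2 * ε) ^ 2 * (L / H) by ring, Real.sqrt_mul (by positivity),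
      Real.sqrt_sq (by positivity)]
    ring
  have h1 : threshold 1 ε h₀ ≤ 3 * (ε * √(L / H)) := by
    have h2 : √(h₀⁻¹ * L) ≤ 3 * √(L / H) := by
      rw [show (3 : ℝ) * √(L / H) = √(3 ^ 2 * (L / H)) by
        rw [Real.sqrt_mul (x := 3 ^ 2) (by positivity), Real.sqrt_sq (by norm_num)]]
      refine Real.sqrt_le_sqrt ?_
      have h3 : h₀⁻¹ ≤ 8 / H := by
        rw [inv_le_comm₀ hh0 (by positivity), inv_div]; exact hle
      calc h₀⁻¹ * L ≤ 8 / H * L := mul_le_mul_of_nonneg_right h3 (by linarith)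
        _ = 8 * (L / H) := by ring
        _ ≤ _ := mul_le_mul_of_nonneg_right (by norm_num) (by positivity)
    rw [threshold, one_mul]
    have := mul_le_mul_of_nonneg_left h2 hε.le
    linarith
  rw [hrate]
  calc 4 * C * threshold 1 ε h₀ ≤ 4 * C * (3 * (ε * √(L / H))) := by gcongr
    _ = _ := by field_simp; ring

end SingleIndex

/-! ### From the pointwise bound to the risks -/

namespace SingleIndex

section Dichotomy

variable {k f : ℝ → ℝ} {M ε : ℝ} {D : Set Plane}

/-- Of the two factors `√G` of `G`, one dominates the power of the logarithm and the other is at least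
`exp (Q L)`. -/
lemma rpow_sqrt_log_le {p c L G : ℝ} (hp : 1 ≤ p) (hc : 0 ≤ c) (hL : 0 ≤ L) {Q : ℝ} (hQ : 0 ≤ Q)
    (hG : Real.exp (2 * Q * L) ≤ G) :
    (c * √(Real.log G)) ^ p ≤ c ^ p * p ^ (p / 2) * Real.exp (-(Q * L)) * G := by
  have hG1 : 1 ≤ G := (Real.one_le_exp (by positivity)).trans hG
  have hG0 : 0 < G := by linarith
  have hlog : 0 ≤ Real.log G := Real.log_nonneg hG1
  have h1 : Real.log G ≤ p * G ^ (1 / p) := by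
    have := Real.log_le_rpow_div hG0.le (show 0 < 1 / p by positivity)
    rwa [div_div_eq_mul_div, div_one, mul_comm] at this
  have h2 : √(Real.log G) ^ p ≤ p ^ (p / 2) * G ^ (1 / 2 : ℝ) := by
    rw [Real.sqrt_eq_rpow, ← Real.rpow_mul hlog]
    calc Real.log G ^ (1 / 2 * p) ≤ (p * G ^ (1 / p)) ^ (1 / 2 * p) :=
          Real.rpow_le_rpow hlog h1 (by positivity)
      _ = p ^ (p / 2) * G ^ (1 / 2 : ℝ) := by
          rw [Real.mul_rpow (by positivity) (by positivity), ← Real.rpow_mul hG0.le]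
          congr 2
          · ring
          · field_simp
  have h3 : G ^ (1 / 2 : ℝ) ≤ Real.exp (-(Q * L)) * G := by
    have h4 : Real.exp (Q * L) ≤ G ^ (1 / 2 : ℝ) := by
      calc Real.exp (Q * L) = Real.exp (2 * Q * L) ^ (1 / 2 : ℝ) := by
            rw [← Real.exp_mul]; congr 1; ring
        _ ≤ _ := Real.rpow_le_rpow (Real.exp_pos _).le hG (by norm_num)
    have h5 : G = G ^ (1 / 2 : ℝ) * G ^ (1 / 2 : ℝ) := by
      rw [← Real.rpow_add hG0]; norm_num
    rw [Real.exp_neg, le_inv_mul_iff₀ (Real.exp_pos _)]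
    nth_rw 2 [h5]
    exact mul_le_mul_of_nonneg_right h4 (by positivity)
  rw [Real.mul_rpow hc (Real.sqrt_nonneg _)]
  calc c ^ p * √(Real.log G) ^ p ≤ c ^ p * (p ^ (p / 2) * (Real.exp (-(Q * L)) * G)) := by
        gcongr
        exact h2.trans (by gcongr)
    _ = _ := by ring

lemma exists_eq_pow_of_mem_grid {N : ℕ} (hN : 2⁻¹ ^ (N + 1) < ε ^ 2) {η : ℝ}
    (hη : η ∈ grid ε) : ∃ n ≤ N, η = 2⁻¹ ^ n := by
  obtain ⟨⟨n, rfl⟩, h1, -⟩ := hη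
  refine ⟨n, ?_, rfl⟩
  by_contra! hc
  have : (2⁻¹ : ℝ) ^ n ≤ 2⁻¹ ^ (N + 1) := pow_le_pow_of_le_one (by norm_num) (by norm_num) hc
  linarith

/-- Either the oracle inequality holds, or the loss is controlled by the noise envelope with a
factor which makes its mean negligible. -/
lemma abs_le_oracleRate_or_rpow_le (hk : IsKernel k) (hf : Measurable f)
    (hM : ∀ u, |f u| ≤ M) {R : ℝ} (hR1 : 1 ≤ R) (hR : ∀ u, R < |u| → k u = 0)
    (hε : 0 < ε) (hε2 : 2 * ε ^ 2 ≤ 1) (hL : 1 ≤ Real.log (1 / ε))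
    (hML : 2 * M * l1Norm k ≤ supNorm k * √(Real.log (1 / ε)))
    (hD : WindowsInside k D) (hDv : volume D ≠ ∞)
    {j : Matrix (Fin 2) (Fin 2) ℝ → Plane → ℝ}
    (hj : ContinuousOn (fun p : Matrix (Fin 2) (Fin 2) ℝ × Plane => j p.1 p.2) {p | p.1.det ≠ 0})
    {x θ₀ θ : Plane} (hx : x ∈ square)
    (hsymm : ∀ A : Matrix (Fin 2) (Fin 2) ℝ, A.det ≠ 0 → j (-A) x = j A x)
    (hθ₀ : θ₀ ∈ unitCircle) {a p C : ℝ} (ha : 0 < a) (hp : 1 ≤ p)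
    (hC : 2 * (4 * R * supNorm k ^ 2 + √(2 * (4 + p) / a)) ≤ C)
    {N : ℕ} (hN : 2⁻¹ ^ (N + 1) < ε ^ 2) (hsel : IsSelectedIndex C ε j x θ) :
    |finalEstimator C ε j x θ - f (x ⬝ᵥ θ₀)| ≤ 12 * C / supNorm k ^ 2 * oracleRate k f ε θ₀ x ∨
    ENNReal.ofReal (|finalEstimator C ε j x θ - f (x ⬝ᵥ θ₀)| ^ p) ≤
      ENNReal.ofReal ((l1Norm k * supNorm k + √(1 / a)) ^ p * p ^ (p / 2) *
        Real.exp (-((4 + p) * Real.log (1 / ε)))) *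
      noiseEnvelope k D (fun t => f (t ⬝ᵥ θ₀)) ε a N θ₀ j x := by
  have hS := hk.supNorm_pos
  have hl1 := hk.one_le_l1Norm
  have hε1 : ε ≤ 1 := by nlinarith
  have hF : Measurable fun t : Plane => f (t ⬝ᵥ θ₀) :=
    hf.comp (by simp only [dotProduct_eq]; fun_prop)
  set L := Real.log (1 / ε) with hLdef
  set F : Plane → ℝ := fun t => f (t ⬝ᵥ θ₀) with hFdef
  set G := noiseEnvelope k D F ε a N θ₀ j x with hGdef
  have hdom : ∀ n ≤ N, ∀ c : Fin 3, ∀ v ∈ Icc (0 : ℝ) 1, ENNReal.ofReal (Real.exp (a * noise k D F ε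
      (2⁻¹ ^ n) j (indexMatrix (indexCurve θ₀ c v) (2⁻¹ ^ n)) x ^ 2)) ≤ G := fun n hn c v hv =>
    exp_noise_indexCurve_le_noiseEnvelope hk hDv hF (fun t => hM _) hj ha.le hn hθ₀ x c hv
  have hidx : ∀ ν ∈ unitCircle, ∀ η ∈ grid ε, ENNReal.ofReal (Real.exp (a * noise k D F ε
      η j (indexMatrix ν η) x ^ 2)) ≤ G := fun ν hν η hη => by
    obtain ⟨n, hn, rfl⟩ := exists_eq_pow_of_mem_grid hN hη
    obtain ⟨v, hv, rfl⟩ := exists_indexCurve_eq θ₀ hν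
    exact hdom n hn 0 v hv
  have hpair : ∀ ν ∈ unitCircle, ∀ η ∈ grid ε, ENNReal.ofReal (Real.exp (a * noise k D F ε
      η j (pairMatrix θ₀ ν η) x ^ 2)) ≤ G := fun ν hν η hη => by
    obtain ⟨n, hn, rfl⟩ := exists_eq_pow_of_mem_grid hN hη
    obtain ⟨c, v, hv, he⟩ := exists_indexCurve_pairMatrix hθ₀ hν (2⁻¹ ^ n)
    rw [he]
    exact hdom n hn c v hv
  rcases le_or_gt G (ENNReal.ofReal (Real.exp (2 * (4 + p) * L))) with hG | hG
  · left
    have hz : ∀ Z : ℝ, ENNReal.ofReal (Real.exp (a * Z ^ 2)) ≤ G →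
        |Z| ≤ √(2 * (4 + p) / a) * √L := fun Z hZ => by
      have h1 := hZ.trans hG
      rw [ENNReal.ofReal_le_ofReal_iff (Real.exp_pos _).le, Real.exp_le_exp] at h1
      rw [← Real.sqrt_mul (by positivity)]
      refine Real.abs_le_sqrt ?_
      rw [div_mul_eq_mul_div, le_div_iff₀ ha]
      linarith
    exact abs_finalEstimator_sub_le_of_noise_le hk hf hM hR1 hR hε hε2 hL hML hD hj hx hsymm hθ₀
      (Real.sqrt_nonneg _) hC (fun ν hν η hη => hz _ (hidx ν hν η hη))
      (fun ν hν η hη => hz _ (hpair ν hν η hη)) hsel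
  · right
    have hpos : 0 < (l1Norm k * supNorm k + √(1 / a)) ^ p * p ^ (p / 2) *
        Real.exp (-((4 + p) * L)) := by positivity
    rcases eq_or_ne G ⊤ with htop | htop
    · rw [htop, ENNReal.mul_top (by simpa using hpos)]; exact le_top
    obtain ⟨g, hg⟩ : ∃ g : ℝ, G = ENNReal.ofReal g := ⟨G.toReal, (ENNReal.ofReal_toReal htop).symm⟩
    rw [hg] at hG hidx ⊢
    have hg1 : Real.exp (2 * (4 + p) * L) < g := (ENNReal.ofReal_lt_ofReal_iff_of_nonneg
      (Real.exp_pos _).le).1 hG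
    have hg0 : 0 < g := (Real.exp_pos _).trans hg1
    rw [← ENNReal.ofReal_mul hpos.le]
    refine ENNReal.ofReal_le_ofReal ?_
    refine le_trans (Real.rpow_le_rpow (abs_nonneg _) ?_ (by linarith))
      (rpow_sqrt_log_le hp (by positivity) (by linarith) (by linarith) hg1.le)
    have hC0 : 0 ≤ C := le_trans (by positivity) hC
    obtain ⟨hη, -⟩ := hHat_mem (j := j) (x := x) hC0 hε hε1 θ
    set η := hHat C ε j x θ with hηdef
    have hθ := hsel.mem_unitCircle
    have hη0 := grid_pos hε hη
    have hLg : 2 * (4 + p) * L ≤ Real.log g := by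
      rw [Real.le_log_iff_exp_le hg0]; exact hg1.le
    have hLg' : √L ≤ √(Real.log g) := Real.sqrt_le_sqrt (by nlinarith)
    have h1 : |noise k D F ε η j (indexMatrix θ η) x| ≤ √(1 / a) * √(Real.log g) := by
      have h2 := hidx θ hθ η hη
      rw [ENNReal.ofReal_le_ofReal_iff hg0.le, ← Real.le_log_iff_exp_le hg0] at h2
      rw [← Real.sqrt_mul (by positivity)]
      refine Real.abs_le_sqrt ?_
      rw [one_div, le_inv_mul_iff₀ ha]
      exact h2
    have h3 := abs_estimator_sub_mean (D := D) (k := k) hε hη0 F j (indexMatrix θ η) x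
    have h4 : ε * (√η)⁻¹ ≤ 1 := by
      rw [← div_eq_mul_inv, div_le_one (Real.sqrt_pos.2 hη0)]
      exact Real.le_sqrt_of_sq_le hη.2.1
    have h5 := abs_mean_indexMatrix_le hk hf hM hD (θ := θ₀) hθ hx hη0 hη.2.2
    have h6 := hM (x ⬝ᵥ θ₀)
    have hM0 : 0 ≤ M := (abs_nonneg _).trans h6
    have h7 : M ≤ l1Norm k * (l1Norm k * M) := by
      have h8 : M ≤ l1Norm k * M := le_mul_of_one_le_left hM0 hl1
      exact h8.trans (le_mul_of_one_le_left (h8.trans' hM0) hl1)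
    have h8 : 2 * (l1Norm k * (l1Norm k * M)) ≤ l1Norm k * supNorm k * √(Real.log g) := by
      have h9 := mul_le_mul_of_nonneg_left (hML.trans (mul_le_mul_of_nonneg_left hLg' hS.le))
        (show 0 ≤ l1Norm k by linarith)
      linarith
    have h9 : ε * (√η)⁻¹ * |noise k D F ε η j (indexMatrix θ η) x| ≤ √(1 / a) * √(Real.log g) :=
      (mul_le_of_le_one_left (abs_nonneg _) h4).trans h1
    rw [finalEstimator, ← hηdef]
    have h10 := abs_sub_le (estimator j (indexMatrix θ η) x) ((indexMatrix θ η).det *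
      ∫ t in D, kernelAt k (indexMatrix θ η) x t * F t) (f (x ⬝ᵥ θ₀))
    have h11 := abs_sub ((indexMatrix θ η).det *
      ∫ t in D, kernelAt k (indexMatrix θ η) x t * F t) (f (x ⬝ᵥ θ₀))
    rw [h3] at h10
    linarith

end Dichotomy

section Risk

lemma lintegral_rpow_le_rpow_lintegral {α : Type*} [MeasurableSpace α] (μ : Measure α)
    [IsProbabilityMeasure μ] {H : α → ℝ≥0∞} (hH : AEMeasurable H μ) {s : ℝ} (hs0 : 0 < s)
    (hs1 : s ≤ 1) : ∫⁻ x, H x ^ s ∂μ ≤ (∫⁻ x, H x ∂μ) ^ s := by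
  have := eLpNorm'_le_eLpNorm'_of_exponent_le hs0 hs1 μ hH.aestronglyMeasurable
  simp only [eLpNorm', enorm_eq_self, ENNReal.rpow_one, one_div, inv_one] at this
  have h2 := ENNReal.rpow_le_rpow this hs0.le
  rwa [← ENNReal.rpow_mul, inv_mul_cancel₀ hs0.ne', ENNReal.rpow_one] at h2

lemma add_rpow_inv_le {r : ℝ} (hr : 0 < r) (a b : ℝ≥0∞) :
    (a + b) ^ (1 / r) ≤ ENNReal.ofReal (2 ^ (1 / r)) * (a ^ (1 / r) + b ^ (1 / r)) := by
  have hr' : 0 ≤ 1 / r := by positivity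
  have h2 : ENNReal.ofReal (2 ^ (1 / r)) = 2 ^ (1 / r) := by
    rw [← ENNReal.ofReal_rpow_of_pos (by norm_num)]; norm_num
  rw [h2]
  rcases le_total a b with h | h
  · calc (a + b) ^ (1 / r) ≤ (2 * b) ^ (1 / r) :=
          ENNReal.rpow_le_rpow (by rw [two_mul]; gcongr) hr'
      _ = 2 ^ (1 / r) * b ^ (1 / r) := ENNReal.mul_rpow_of_nonneg _ _ hr'
      _ ≤ _ := by gcongr; exact le_add_self
  · calc (a + b) ^ (1 / r) ≤ (2 * a) ^ (1 / r) :=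
          ENNReal.rpow_le_rpow (by rw [two_mul]; gcongr) hr'
      _ = 2 ^ (1 / r) * a ^ (1 / r) := ENNReal.mul_rpow_of_nonneg _ _ hr'
      _ ≤ _ := by gcongr; exact le_self_add

lemma lintegral_rpow_risk_le {α : Type*} [MeasurableSpace α] (μ : Measure α)
    [IsProbabilityMeasure μ] {H : α → ℝ≥0∞} (hH : Measurable H) {r p : ℝ} (hr : 0 < r)
    (hrp : r ≤ p) {Z A : α → ℝ}
    (h : ∀ᵐ x ∂μ, |Z x| ≤ A x ∨ ENNReal.ofReal (|Z x| ^ p) ≤ H x) :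
    (∫⁻ x, ENNReal.ofReal (|Z x| ^ r) ∂μ) ^ (1 / r) ≤ ENNReal.ofReal (2 ^ (1 / r)) *
      ((∫⁻ x, ENNReal.ofReal (|A x| ^ r) ∂μ) ^ (1 / r) + (∫⁻ x, H x ∂μ) ^ (1 / p)) := by
  have hp : 0 < p := hr.trans_le hrp
  have h1 : ∀ᵐ x ∂μ, ENNReal.ofReal (|Z x| ^ r) ≤ ENNReal.ofReal (|A x| ^ r) + H x ^ (r / p) := by
    filter_upwards [h] with x hx
    rcases hx with hx | hx
    · refine le_trans (ENNReal.ofReal_le_ofReal ?_) le_self_add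
      exact Real.rpow_le_rpow (abs_nonneg _) (hx.trans (le_abs_self _)) hr.le
    · refine le_trans ?_ le_add_self
      calc ENNReal.ofReal (|Z x| ^ r) = ENNReal.ofReal (|Z x| ^ p) ^ (r / p) := by
            rw [ENNReal.ofReal_rpow_of_nonneg (by positivity) (by positivity),
              ← Real.rpow_mul (abs_nonneg _)]
            congr 2; field_simp
        _ ≤ _ := ENNReal.rpow_le_rpow hx (by positivity)
  have h2 : ∫⁻ x, H x ^ (r / p) ∂μ ≤ (∫⁻ x, H x ∂μ) ^ (r / p) :=
    lintegral_rpow_le_rpow_lintegral μ hH.aemeasurable (by positivity) ((div_le_one hp).2 hrp)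
  calc _ ≤ (∫⁻ x, ENNReal.ofReal (|A x| ^ r) ∂μ + (∫⁻ x, H x ∂μ) ^ (r / p)) ^ (1 / r) := by
        refine ENNReal.rpow_le_rpow ((lintegral_mono_ae h1).trans ?_) (by positivity)
        rw [lintegral_add_right _ (hH.pow_const _)]
        gcongr
    _ ≤ _ := add_rpow_inv_le hr _ _
    _ = _ := by
        rw [← ENNReal.rpow_mul]
        congr 3
        field_simp

/-- The risk of an estimator `Z` whose loss exceeds `A` only in presence of a remainder `H` of small
mean. -/
lemma lintegral_rpow_risk_le_of_const {α : Type*} [MeasurableSpace α] (μ : Measure α)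
    [IsProbabilityMeasure μ] {H : α → ℝ≥0∞} (hH : Measurable H) {r p : ℝ} (hr : 0 < r)
    (hrp : r ≤ p) {Z : α → ℝ} {A b : ℝ} (hA : 0 ≤ A) (hb : 0 ≤ b)
    (hHb : ∫⁻ x, H x ∂μ ≤ ENNReal.ofReal (b ^ p))
    (h : ∀ᵐ x ∂μ, |Z x| ≤ A ∨ ENNReal.ofReal (|Z x| ^ p) ≤ H x) :
    (∫⁻ x, ENNReal.ofReal (|Z x| ^ r) ∂μ) ^ (1 / r) ≤
      ENNReal.ofReal (2 ^ (1 / r) * (A + b)) := by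
  have hp : 0 < p := hr.trans_le hrp
  have hroot : ∀ {a q : ℝ}, 0 ≤ a → 0 < q →
      ENNReal.ofReal (a ^ q) ^ (1 / q) = ENNReal.ofReal a := fun {a q} ha hq => by
    rw [ENNReal.ofReal_rpow_of_nonneg (by positivity) (by positivity), ← Real.rpow_mul ha,
      mul_one_div_cancel hq.ne', Real.rpow_one]
  refine (lintegral_rpow_risk_le μ hH hr hrp (A := fun _ => A) h).trans ?_
  rw [lintegral_const, measure_univ, mul_one, abs_of_nonneg hA, hroot hA hr,
    ENNReal.ofReal_mul (by positivity), ENNReal.ofReal_add hA hb]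
  gcongr
  rw [← hroot hb hp]
  exact ENNReal.rpow_le_rpow hHb (by positivity)

/-- The analogue for the mean of an `L_r` norm. The power `1 / r` of an integral need not be concave;
the remainder is therefore measured in `L_p` with `p ≥ 1`. -/
lemma lintegral_lrNorm_le {α β : Type*} [MeasurableSpace α] [MeasurableSpace β] (μ : Measure α)
    [IsProbabilityMeasure μ] (ν : Measure β) [IsProbabilityMeasure ν] {H : α → β → ℝ≥0∞}
    (hH : Measurable fun q : α × β => H q.1 q.2) {r p : ℝ} (hr : 0 < r)
    (hrp : r ≤ p) (hp1 : 1 ≤ p) {Z : β → α → ℝ} {A : α → ℝ} {b : ℝ} (hb : 0 ≤ b)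
    (hHb : ∀ x, ∫⁻ ω, H x ω ∂ν ≤ ENNReal.ofReal (b ^ p))
    (h : ∀ᵐ ω ∂ν, ∀ᵐ x ∂μ, |Z ω x| ≤ A x ∨ ENNReal.ofReal (|Z ω x| ^ p) ≤ H x ω) :
    ∫⁻ ω, (∫⁻ x, ENNReal.ofReal (|Z ω x| ^ r) ∂μ) ^ (1 / r) ∂ν ≤ ENNReal.ofReal (2 ^ (1 / r)) *
      ((∫⁻ x, ENNReal.ofReal (|A x| ^ r) ∂μ) ^ (1 / r) + ENNReal.ofReal b) := by
  have hp : 0 < p := by linarith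
  have hωx : Measurable fun q : β × α => H q.2 q.1 := hH.comp measurable_swap
  have hInt : Measurable fun ω => ∫⁻ x, H x ω ∂μ := hωx.lintegral_prod_right'
  have hpath : ∀ᵐ ω ∂ν, (∫⁻ x, ENNReal.ofReal (|Z ω x| ^ r) ∂μ) ^ (1 / r) ≤
      ENNReal.ofReal (2 ^ (1 / r)) *
      ((∫⁻ x, ENNReal.ofReal (|A x| ^ r) ∂μ) ^ (1 / r) + (∫⁻ x, H x ω ∂μ) ^ (1 / p)) := by
    filter_upwards [h] with ω hω
    exact lintegral_rpow_risk_le μ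
      (hH.comp (measurable_id.prodMk measurable_const : Measurable fun x : α => (x, ω))) hr hrp hω
  have hmean : ∫⁻ ω, (∫⁻ x, H x ω ∂μ) ^ (1 / p) ∂ν ≤ ENNReal.ofReal b := by
    refine (lintegral_rpow_le_rpow_lintegral ν hInt.aemeasurable (by positivity)
      ((div_le_one hp).2 hp1)).trans ?_
    have e : ENNReal.ofReal b = ENNReal.ofReal (b ^ p) ^ (1 / p) := by
      rw [ENNReal.ofReal_rpow_of_nonneg (by positivity) (by positivity), ← Real.rpow_mul hb,
        mul_one_div_cancel hp.ne', Real.rpow_one]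
    rw [e]
    refine ENNReal.rpow_le_rpow ?_ (by positivity)
    rw [lintegral_lintegral_swap hωx.aemeasurable]
    refine (lintegral_mono fun x => hHb x).trans ?_
    rw [lintegral_const, measure_univ, mul_one]
  refine (lintegral_mono_ae hpath).trans ?_
  rw [lintegral_const_mul' _ _ ENNReal.ofReal_ne_top, lintegral_add_left measurable_const,
    lintegral_const, measure_univ, mul_one]
  gcongr

lemma lrNorm_const_mul {r κ : ℝ} (hr : 0 < r) (hκ : 0 ≤ κ) (g : Plane → ℝ) :
    lrNorm r (fun x => κ * g x) = ENNReal.ofReal κ * lrNorm r g := by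
  unfold lrNorm
  simp_rw [abs_mul, abs_of_nonneg hκ, Real.mul_rpow hκ (abs_nonneg _),
    ENNReal.ofReal_mul (Real.rpow_nonneg hκ r)]
  rw [lintegral_const_mul' _ _ ENNReal.ofReal_ne_top,
    ENNReal.mul_rpow_of_nonneg _ _ (by positivity),
    ENNReal.ofReal_rpow_of_nonneg (by positivity) (by positivity), ← Real.rpow_mul hκ,
    mul_one_div_cancel hr.ne', Real.rpow_one]

lemma volume_square : volume square = 1 := by
  rw [square, Real.volume_Icc_pi]
  norm_num

end Risk

end SingleIndex

theorem theorem1 (k : ℝ → ℝ) (hk : SingleIndex.IsKernel k) (r : ℝ) (hr : 0 < r) :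
    -- the threshold constant: `C₀` and every larger constant `C` can be taken as `C(r, k)`
    ∃ C₀ : ℝ, 0 < C₀ ∧ ∀ C : ℝ, C₀ ≤ C →
    -- the constant `C_{r,1}(k)`
    ∃ C₁ : ℝ, 0 < C₁ ∧ ∀ M : ℝ, 0 < M →
    -- the constant `C_{r,2}(M, k)`
    ∃ C₂ : ℝ, 0 < C₂ ∧
    ∀ (ε : ℝ), 0 < ε →
      ε ≤ Real.exp (-max 1 ((2 * M * SingleIndex.l1Norm k * (SingleIndex.supNorm k)⁻¹) ^ 2)) →
    ∀ (D : Set SingleIndex.Plane), MeasurableSet D → volume D ≠ ∞ →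
      SingleIndex.WindowsInside k D →
    -- the link function and the index
    ∀ (f : ℝ → ℝ), Measurable f → (∀ u, |f u| ≤ M) →
    ∀ θstar ∈ SingleIndex.unitCircle,
    -- the observation of `F(x) = f(xᵀθ*)` in Gaussian white noise, and its kernel integrals
    ∀ (Ω : Type u) [MeasurableSpace Ω] (P : Measure Ω) [IsProbabilityMeasure P]
      (Y : (SingleIndex.Plane → ℝ) → Ω → ℝ)
      (J : Ω → Matrix (Fin 2) (Fin 2) ℝ → SingleIndex.Plane → ℝ),
      SingleIndex.IsObservation D (fun x => f (x ⬝ᵥ θstar)) ε P Y →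
      SingleIndex.IsKernelIntegral k P Y J →
    -- local oracle inequality
    (∀ x ∈ SingleIndex.square, ∀ θhat : Ω → SingleIndex.Plane, Measurable θhat →
      (∀ ω, SingleIndex.IsSelectedIndex C ε (J ω) x (θhat ω)) →
      SingleIndex.pointwiseRisk P r
          (fun ω => SingleIndex.finalEstimator C ε (J ω) x (θhat ω)) (f (x ⬝ᵥ θstar)) ≤
        ENNReal.ofReal (C₁ * SingleIndex.oracleRate k f ε θstar x +
          C₂ * SingleIndex.supNorm k ^ 2 * ε * √(Real.log (1 / ε)))) ∧
    -- global oracle inequality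
    (∀ θhat : Ω → SingleIndex.Plane → SingleIndex.Plane,
      Measurable (fun p : Ω × SingleIndex.Plane => θhat p.1 p.2) →
      (∀ ω, ∀ x ∈ SingleIndex.square, SingleIndex.IsSelectedIndex C ε (J ω) x (θhat ω x)) →
      SingleIndex.globalRisk P r
          (fun ω x => SingleIndex.finalEstimator C ε (J ω) x (θhat ω x))
          (fun x => f (x ⬝ᵥ θstar)) ≤
        ENNReal.ofReal C₁ * SingleIndex.lrNorm r (SingleIndex.oracleRate k f ε θstar) +
          ENNReal.ofReal (C₂ * SingleIndex.supNorm k ^ 2 * ε * √(Real.log (1 / ε)))) := by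
  have hS := hk.supNorm_pos
  obtain ⟨R, hR1, hR⟩ := hk.exists_radius
  obtain ⟨Λ, hΛ, hLip⟩ := hk.exists_lipschitz
  set S := SingleIndex.supNorm k with hSdef
  set v : ℝ := (∫ u, k u ^ 2) ^ 2 with hv
  set w : ℝ := (7 * (6 * R * (4 * S ^ 2 + 12 * R * S * Λ))) ^ 2 with hw
  have hv0 : 0 ≤ v := sq_nonneg _
  have hw0 : 0 ≤ w := sq_nonneg _
  -- `v` and `w` bound the variances of the normalized errors and of their difference quotients
  set a : ℝ := (16 * (v + w + 1))⁻¹ with had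
  have ha : 0 < a := by positivity
  have hab : ∀ z, 0 ≤ z → z ≤ v + w + 1 → 4 * a * z ≤ 1 / 4 := fun z hz hz1 => by
    rw [had, show 4 * (16 * (v + w + 1))⁻¹ * z = (z / (v + w + 1)) * (1 / 4) by
      field_simp; norm_num]
    have : z / (v + w + 1) ≤ 1 := (div_le_one (by positivity)).2 hz1
    linarith
  set p := max r 1 with hpd
  have hp1 : 1 ≤ p := le_max_right _ _
  have hrp : r ≤ p := le_max_left _ _
  have hp0 : 0 < p := by linarith
  set B : ℝ := (SingleIndex.l1Norm k * S + √(1 / a)) ^ p * p ^ (p / 2) with hB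
  have hl1 := hk.one_le_l1Norm
  have hB0 : 0 < B := by positivity
  set c : ℝ := 2 ^ (1 / r) with hc
  have hc0 : 0 < c := by positivity
  refine ⟨2 * (4 * R * S ^ 2 + √(2 * (4 + p) / a)), by positivity, fun C hC => ?_⟩
  have hC0 : 0 < C := lt_of_lt_of_le (by positivity) hC
  refine ⟨c * (12 * C / S ^ 2), by positivity, fun M hM0 => ?_⟩
  refine ⟨c * (16 * B) ^ (1 / p) / S ^ 2, by positivity, ?_⟩
  intro ε hε hεM D _ hDv hD f hf hM θ₀ hθ₀ Ω _ P _ Y J hY hJ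
  obtain ⟨W, hW, hY⟩ := hY
  set L := Real.log (1 / ε) with hLd
  have hLmax : max 1 ((2 * M * SingleIndex.l1Norm k * S⁻¹) ^ 2) ≤ L := by
    have := Real.log_le_log hε hεM
    rw [Real.log_exp] at this
    rw [hLd, one_div, Real.log_inv]
    linarith
  have hL1 : 1 ≤ L := (le_max_left _ _).trans hLmax
  have hML : 2 * M * SingleIndex.l1Norm k ≤ S * √L := by
    have h1 : 2 * M * SingleIndex.l1Norm k * S⁻¹ ≤ √L :=
      Real.le_sqrt_of_sq_le ((le_max_right _ _).trans hLmax)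
    rw [← div_eq_mul_inv, div_le_iff₀ hS] at h1
    linarith
  have hεhalf : ε ≤ 1 / 2 := by
    refine hεM.trans ((Real.exp_le_exp.2 (neg_le_neg (le_max_left _ _))).trans ?_)
    rw [Real.exp_neg, one_div]
    exact inv_anti₀ (by norm_num) (by linarith [Real.add_one_le_exp 1])
  have hε2 : 2 * ε ^ 2 ≤ 1 := by nlinarith
  have hF : Measurable fun t : SingleIndex.Plane => f (t ⬝ᵥ θ₀) :=
    hf.comp (by simp only [SingleIndex.dotProduct_eq]; fun_prop)
  obtain ⟨N, hN1, hN2⟩ := exists_nat_pow_near_of_lt_one (show 0 < ε ^ 2 by positivity)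
    (show ε ^ 2 ≤ 1 by nlinarith) (y := (2⁻¹ : ℝ)) (by norm_num) (by norm_num)
  have hsymm := hJ.ae_neg_eq hk
  set b : ℝ := (16 * B) ^ (1 / p) * ε with hb
  have hb0 : 0 ≤ b := by positivity
  obtain ⟨H, hHm, hHint, hdich⟩ : ∃ H : SingleIndex.Plane → Ω → ℝ≥0∞,
      (Measurable fun q : SingleIndex.Plane × Ω => H q.1 q.2) ∧
      (∀ x, ∫⁻ ω, H x ω ∂P ≤ ENNReal.ofReal (b ^ p)) ∧
      ∀ ω, (∀ (A : Matrix (Fin 2) (Fin 2) ℝ) (x : SingleIndex.Plane), A.det ≠ 0 →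
        J ω (-A) x = J ω A x) → ∀ x ∈ SingleIndex.square, ∀ θ,
        SingleIndex.IsSelectedIndex C ε (J ω) x θ →
        |SingleIndex.finalEstimator C ε (J ω) x θ - f (x ⬝ᵥ θ₀)| ≤
          12 * C / S ^ 2 * SingleIndex.oracleRate k f ε θ₀ x ∨
        ENNReal.ofReal (|SingleIndex.finalEstimator C ε (J ω) x θ - f (x ⬝ᵥ θ₀)| ^ p) ≤
          H x ω := by
    refine ⟨fun x ω => ENNReal.ofReal (B * Real.exp (-((4 + p) * L))) *
      SingleIndex.noiseEnvelope k D (fun t => f (t ⬝ᵥ θ₀)) ε a N θ₀ (J ω) x,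
      (SingleIndex.measurable_noiseEnvelope hk hDv hF (fun t => hM _) hJ a N hθ₀).const_mul _,
      fun x => ?_, fun ω hω x hx θ hsel => SingleIndex.abs_le_oracleRate_or_rpow_le hk hf hM hR1 hR
        hε hε2 hL1 hML hD hDv (hJ.continuousOn ω) hx (fun A hA => hω A x hA) hθ₀ ha hp1 hC hN1 hsel⟩
    have hexp : Real.exp (-((4 + p) * L)) = ε ^ 4 * ε ^ p := by
      rw [hLd, one_div, Real.log_inv, mul_neg, neg_neg, mul_comm, Real.exp_mul, Real.exp_log hε,
        Real.rpow_add hε]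
      norm_cast
    have hbp : b ^ p = 16 * B * ε ^ p := by
      rw [hb, Real.mul_rpow (by positivity) hε.le, ← Real.rpow_mul (by positivity),
        one_div_mul_cancel hp0.ne', Real.rpow_one]
    rw [lintegral_const_mul' _ _ ENNReal.ofReal_ne_top]
    refine (mul_le_mul_right (SingleIndex.lintegral_noiseEnvelope_le hk hDv hF (fun t => hM _) hJ
      hW hY hε hR1 hR hΛ hLip ha.le (hab v hv0 (by linarith)) (hab w hw0 (by linarith)) hN2
      hθ₀ x) _).trans ?_
    rw [← ENNReal.ofReal_mul (by positivity), hexp, hbp]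
    refine ENNReal.ofReal_le_ofReal (le_of_eq ?_)
    field_simp
  have hrem : c * b ≤ c * (16 * B) ^ (1 / p) / S ^ 2 * S ^ 2 * ε * √L := by
    rw [div_mul_cancel₀ _ (by positivity), mul_assoc c, mul_assoc c, ← hb]
    refine mul_le_mul_of_nonneg_left ?_ hc0.le
    exact le_mul_of_one_le_right hb0 (Real.one_le_sqrt.2 hL1)
  have hrate0 : ∀ x, 0 ≤ SingleIndex.oracleRate k f ε θ₀ x := fun x => Real.sqrt_nonneg _
  have hκ0 : 0 ≤ 12 * C / S ^ 2 := by positivity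
  constructor
  · intro x hx θhat _ hsel
    have hHx : Measurable fun ω => H x ω :=
      hHm.comp (measurable_const.prodMk measurable_id : Measurable fun ω : Ω => (x, ω))
    have hmain := SingleIndex.lintegral_rpow_risk_le_of_const P hHx hr hrp
      (Z := fun ω => SingleIndex.finalEstimator C ε (J ω) x (θhat ω) - f (x ⬝ᵥ θ₀))
      (mul_nonneg hκ0 (hrate0 x)) hb0 (hHint x)
      (hsymm.mono fun ω hω => hdich ω hω x hx _ (hsel ω))
    refine hmain.trans (ENNReal.ofReal_le_ofReal ?_)
    rw [← hc, mul_add, ← mul_assoc]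
    linarith
  · intro θhat _ hsel
    have hprob : IsProbabilityMeasure (volume.restrict SingleIndex.square) :=
      ⟨by rw [Measure.restrict_apply_univ, SingleIndex.volume_square]⟩
    have hmain := SingleIndex.lintegral_lrNorm_le (volume.restrict SingleIndex.square) P hHm hr hrp
      hp1 (Z := fun ω x => SingleIndex.finalEstimator C ε (J ω) x (θhat ω x) - f (x ⬝ᵥ θ₀))
      (A := fun x => 12 * C / S ^ 2 * SingleIndex.oracleRate k f ε θ₀ x) hb0 hHint
      (hsymm.mono fun ω hω => ae_restrict_of_forall_mem measurableSet_Icc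
        fun x hx => hdich ω hω x hx _ (hsel ω x hx))
    have hκ := SingleIndex.lrNorm_const_mul hr hκ0 (SingleIndex.oracleRate k f ε θ₀)
    rw [SingleIndex.lrNorm] at hκ
    rw [hκ, mul_add, ← mul_assoc, ← ENNReal.ofReal_mul hc0.le, ← ENNReal.ofReal_mul hc0.le] at hmain
    refine hmain.trans (add_le_add le_rfl (ENNReal.ofReal_le_ofReal hrem))
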